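/- Let $L>0$, let $\mathbb T=(-L,L)$ be the torus of length $2L$, let $\lambda\in\mathbb R$, $\gamma\ge 0$ and $T>0$. Put $\mu_l=\pi l/L$ and $\hat f_l=\frac1{2L}\int_{\mathbb T}e^{-i\mu_l x}f(x)\,dx$ for $l\in\mathbb Z$, and $\|f\|_{H^s}^2=2L\sum_{l}(1+\mu_l^2)^s|\hat f_l|^2$. For a function $\sigma$ let $\sigma(\partial_x)$ be the Fourier multiplier $\sigma(\partial_x)f=\sum_l\sigma(i\mu_l)\hat f_l\,e^{i\mu_l x}$, where for symbols that are singular at $0$ (such as $\partial_x^{-1}$) the mode $l=0$ is omitted. Let $\xi:\mathbb T\to\mathbb R$ and $u_0:\mathbb T\to\mathbb C$ both lie in $H^{\gamma+2}(\mathbb T)$, and let $u$ be a continuous mild solution on $[0,T]\times\mathbb T$ of $$i\partial_t u=-\partial_x^2u+\xi u+\lambda|u|^2u,\qquad u(0)=u_0,$$ that is, $u(t)=e^{it\partial_x^2}u_0-i\int_0^te^{i(t-s)\partial_x^2}\big[(\xi+\lambda|u(s)|^2)u(s)\big]ds$ for $0\le t\le T$. For $\tau>0$ let $u^0=u_0$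 and, for $n\ge0$, $$u^{n+1}=e^{i\tau\partial_x^2}\Big[e^{i\lambda\tau|u^n|^2}u^n+J_1(u^n)+J_2(u^n)-\lambda\tau^2\xi|u^n|^2u^n-\tfrac{\tau^2}{2}\xi^2u^n+\xi_1u^n-2\xi_2\sin(-i\tau\partial_x)u^n-i\tau\hat\xi_0u^n\Big],$$ with the regularized potentials $$\xi_1=\frac{e^{-i\tau\partial_x^2}-1}{\partial_x^2}\,\xi,\qquad \xi_2=\frac{e^{-i\tau\partial_x^2}(i-\tau\partial_x^2)-i}{\tau\partial_x^3}\,\xi$$ and $$J_1(w)=\tfrac\lambda2\Big[e^{-i\tau\partial_x^2}\partial_x^{-1}\Big(\big(e^{-i\tau\partial_x^2}\partial_x^{-1}\overline w\big)\big(e^{i\tau\partial_x^2}w^2\big)\Big)-\partial_x^{-1}\big((\partial_x^{-1}\overline w)w^2\big)\Big]-i\lambda\tau\Big[\widehat{(\overline w)}_0\big(w^2-\widehat{(w^2)}_0\big)+\widehat{(|w|^2w)}_0\Big],$$ $$J_2(w)=\tfrac\lambda2\Big[e^{-i\tau\partial_x^2}\big(\partial_x^{-1}e^{i\tau\partial_x^2}w\big)^2-\big(\partial_x^{-1}w\big)^2\Big]\overline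 w-i\lambda\tau\,\hat w_0\big(2w-\hat w_0\big)\overline w.$$ Then there are constants $\tau_0>0$ and $C$, which do not depend on $n$ or $\tau$, such that for all $0<\tau\le\tau_0$ and all integers $n$ with $0\le n\le T/\tau$ one has $u(n\tau)-u^n\in H^\gamma(\mathbb T)$ and $$\|u(n\tau)-u^n\|_{H^\gamma}\le C\tau^2 .$$ -/

import Mathlib

open MeasureTheory Set
open scoped ComplexConjugate

noncomputable section

namespace DNLS

/-- The torus of length `2 * L`, i.e. `(-L, L)` with its end points identified. -/
abbrev Torus (L : ℝ) : Type := AddCircle (2 * L)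

/-- The frequencies `μ_l = π l / L`. Note that `fourier l x = exp (i μ_l x)` on `Torus L`. -/
def freq (L : ℝ) (l : ℤ) : ℝ := Real.pi * l / L

variable {L : ℝ} [Fact (0 < 2 * L)]

/-- `f ∈ H^s(𝕋)`, for `s ≥ 0`. -/
def MemSobolev (s : ℝ) (f : Torus L → ℂ) : Prop :=
  MemLp f 2 AddCircle.haarAddCircle ∧
    Summable fun l : ℤ => (1 + freq L l ^ 2) ^ s * ‖fourierCoeff f l‖ ^ 2

/-- The norm of `H^s(𝕋)`. The factor `2 * L` makes the case `s = 0` the norm of `L²(-L, L)`,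
since `fourierCoeff` is taken with respect to the normalized Haar measure. -/
def sobolevNorm (s : ℝ) (f : Torus L → ℂ) : ℝ :=
  Real.sqrt (2 * L * ∑' l : ℤ, (1 + freq L l ^ 2) ^ s * ‖fourierCoeff f l‖ ^ 2)

/-- The Fourier multiplier `σ(∂ₓ)`, acting as multiplication by `σ(i μ_l)` on the `l`-th mode. -/
def multiplier (σ : ℂ → ℂ) (f : Torus L → ℂ) : Torus L → ℂ := fun x =>
  ∑' l : ℤ, σ (Complex.I * freq L l) * fourierCoeff f l * fourier l x

/-- The free Schrödinger group `exp(i t ∂ₓ²)`. -/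
def freeFlow (t : ℝ) : (Torus L → ℂ) → Torus L → ℂ :=
  multiplier fun d => Complex.exp (Complex.I * t * d ^ 2)

/-- `∂ₓ⁻¹`, the multiplier `(i μ_l)⁻¹` on the modes `l ≠ 0`; the mode `l = 0` is dropped,
because `0⁻¹ = 0`. -/
def invDeriv : (Torus L → ℂ) → Torus L → ℂ :=
  multiplier fun d => d⁻¹

/-- `sin(-i τ ∂ₓ)`, the multiplier `sin(τ μ_l)`. -/
def sinFilter (τ : ℝ) : (Torus L → ℂ) → Torus L → ℂ :=
  multiplier fun d => Complex.sin (-Complex.I * τ * d)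

/-- The regularized potential `ξ₁ = ∂ₓ⁻² (exp(-i τ ∂ₓ²) - 1) ξ`; the mode `l = 0` is dropped,
because `a / 0 = 0`. -/
def potential₁ (τ : ℝ) (ξ : Torus L → ℝ) : Torus L → ℂ :=
  multiplier (fun d => (Complex.exp (-Complex.I * τ * d ^ 2) - 1) / d ^ 2) fun x => (ξ x : ℂ)

/-- The regularized potential `ξ₂ = (τ ∂ₓ³)⁻¹ (exp(-i τ ∂ₓ²) (i - τ ∂ₓ²) - i) ξ`; the mode
`l = 0` is dropped, because `a / 0 = 0`. -/
def potential₂ (τ : ℝ) (ξ : Torus L → ℝ) : Torus L → ℂ :=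
  multiplier
    (fun d => (Complex.exp (-Complex.I * τ * d ^ 2) * (Complex.I - τ * d ^ 2) - Complex.I) /
      (τ * d ^ 3))
    fun x => (ξ x : ℂ)

/-- The zeroth Fourier mode (the mean). -/
def mean (f : Torus L → ℂ) : ℂ := fourierCoeff f 0

/-- `J₁(w)`: the physical-space form of
`-iλ ∫₀^τ ∑_{l₁+l₂+l₃=l} exp(2i μ_{l₁} μ_l ρ) (w̄)^_{l₁} ŵ_{l₂} ŵ_{l₃} e_l dρ`. -/
def J₁ (lam τ : ℝ) (w : Torus L → ℂ) : Torus L → ℂ := fun x =>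
  lam / 2 *
      (freeFlow (-τ)
          (invDeriv fun y =>
            freeFlow (-τ) (invDeriv fun z => conj (w z)) y * freeFlow τ (fun z => w z ^ 2) y) x
        - invDeriv (fun y => invDeriv (fun z => conj (w z)) y * w y ^ 2) x)
    - Complex.I * lam * τ *
      (mean (fun z => conj (w z)) * (w x ^ 2 - mean fun z => w z ^ 2)
        + mean fun z => (‖w z‖ : ℂ) ^ 2 * w z)

/-- `J₂(w)`: the physical-space form of
`-iλ ∫₀^τ ∑_{l₁+l₂+l₃=l} exp(2i μ_{l₂} μ_{l₃} ρ) (w̄)^_{l₁} ŵ_{l₂} ŵ_{l₃} e_l dρ`. -/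
def J₂ (lam τ : ℝ) (w : Torus L → ℂ) : Torus L → ℂ := fun x =>
  lam / 2 * (freeFlow (-τ) (fun y => invDeriv (freeFlow τ w) y ^ 2) x - invDeriv w x ^ 2)
      * conj (w x)
    - Complex.I * lam * τ * (mean w * (2 * w x - mean w) * conj (w x))

/-- One step `Ψ_τ` of the low-regularity integrator. -/
def lriStep (lam : ℝ) (ξ : Torus L → ℝ) (τ : ℝ) (w : Torus L → ℂ) : Torus L → ℂ :=
  freeFlow τ fun x =>
    Complex.exp (Complex.I * lam * τ * (‖w x‖ : ℂ) ^ 2) * w x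
      + J₁ lam τ w x + J₂ lam τ w x
      - lam * τ ^ 2 * ξ x * (‖w x‖ : ℂ) ^ 2 * w x
      - τ ^ 2 / 2 * (ξ x : ℂ) ^ 2 * w x
      + potential₁ τ ξ x * w x
      - 2 * potential₂ τ ξ x * sinFilter τ w x
      - Complex.I * τ * mean (fun y => (ξ y : ℂ)) * w x

/-- The numerical solution: `u⁰ = u₀`, `uⁿ⁺¹ = Ψ_τ(uⁿ)`. -/
def lri (lam : ℝ) (ξ : Torus L → ℝ) (u₀ : Torus L → ℂ) (τ : ℝ) : ℕ → Torus L → ℂ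
  | 0 => u₀
  | n + 1 => lriStep lam ξ τ (lri lam ξ u₀ τ n)

/-- `u` is a (continuous, mild) solution on `[0, T] × 𝕋` of
`i ∂ₜ u = -∂ₓ² u + ξ u + λ |u|² u`, `u(0) = u₀`: Duhamel's formula
`u(t) = exp(i t ∂ₓ²) u₀ - i ∫₀ᵗ exp(i (t - s) ∂ₓ²) (ξ + λ |u(s)|²) u(s) ds`
holds on `[0, T]`, written mode by mode. -/
structure IsSolution (lam : ℝ) (ξ : Torus L → ℝ) (u₀ : Torus L → ℂ) (T : ℝ)
    (u : ℝ → Torus L → ℂ) : Prop where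
  continuousOn : ContinuousOn (Function.uncurry u) (Icc 0 T ×ˢ univ)
  duhamel : ∀ t ∈ Icc 0 T, ∀ l : ℤ,
    fourierCoeff (u t) l =
      Complex.exp (-Complex.I * t * freq L l ^ 2) * fourierCoeff u₀ l
        - Complex.I * ∫ s in (0 : ℝ)..t,
            Complex.exp (-Complex.I * (t - s) * freq L l ^ 2) *
              fourierCoeff (fun x => (ξ x + lam * (‖u s x‖ : ℂ) ^ 2) * u s x) l

end DNLS

end

open MeasureTheory Set
open scoped ComplexConjugate
open scoped ENNReal

set_option linter.unusedSectionVars false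

noncomputable section

namespace DNLS

section

/-! ### Convolution of nonnegative sequences -/

/-! Everything happens on Fourier coefficients, and every estimate is a pointwise bound by
convolutions of one fixed even majorant `M`, with weights `om L` (here ω) standing for derivatives.
With the submultiplicative weight p = ω^γ, the regularity γ + 2 puts ω²M in weighted ℓ² (`n2`),
hence ωM in weighted ℓ¹ (`n1`) by Cauchy–Schwarz. Young's inequality then controls in ℓ² any
convolution in which at most one factor carries ω² and the others carry at most ω. Such an `M`,
dominating the coefficients of ξ, of u(t) and of the right-hand side for all t, comes from
propagating regularity from a merely continuous mild solution (`IsSolution.exists_n2_om_le`,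
`IsSolution.exists_majorant`).

In the interaction picture the potential term has phase η = μ_k² + β with β = 2μ_kμ_j, and the cubic
term has phase α + β' (`Gs`). The step integrates an approximation of the right-hand side exactly
(`HasCoeff.lriStep`, `integral_approx`). In the cubic term e^{iρα}e^{iρβ'} becomes e^{iρα} +
e^{iρβ'} - 1, with error (e^{iρα} - 1)(e^{iρβ'} - 1). In the potential term e^{iρβ} becomes its
linearization with μ_j filtered to sin(τμ_j)/τ. The second Duhamel iterate is taken with all phases
at time zero. The terms in |w|²w and |w|⁴w are those of exp(iλτ|w|²)w up to O(τ³).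

All resulting errors are O(τ³) with an admissible majorant (`LocalSol.enorm_local_error_sub_le`),
except one: the symbol e^{iρμ_k²}(e^{iρβ} - 1 - iρβ) costs two derivatives on both factors, and a
convolution of two ℓ² sequences need not lie in ℓ². This part is not small enough step by step, but
it is summable over the steps. Propagated to time zero, its m-th copy carries the factor e^{imτη}
times a slowly varying amplitude, so summation by parts leaves a Dirichlet-type bound in the angle
τη. The integrated symbol also gains min(1, 1/|τβ|). For fixed k ≠ 0 both τη and τβ are affine in j
with the same step of size at least a constant times τ, so the kernel has squared ℓ² norm in j of
order τ⁻², uniformly in k (`tsum_kernel_sq_le`, `tsum_resKer_sq_le`). Cauchy–Schwarz in place of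
Young then gives total size τ³·τ⁻¹ = τ² (`n2_sum_bil_kap_le`).

Stability needs the numerical solution bounded in the weighted Wiener algebra. A cruder local error
O(τ²), with only ωM in its majorant, is available there, and a bootstrap keeps the error at most 1
for small τ (`n1_error_le`). The ℓ² error then obeys a discrete Gronwall inequality in summed form
(`n2_error_le`). -/

/-- The convolution of two nonnegative sequences on `ℤ`. -/
def cv (A B : ℤ → ℝ≥0∞) (l : ℤ) : ℝ≥0∞ := ∑' k, A k * B (l - k)

infixr:70 "⊛" => cv

lemma cv_comm (A B : ℤ → ℝ≥0∞) : A ⊛ B = B ⊛ A := by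
  funext l
  unfold cv
  rw [← (Equiv.subLeft l).tsum_eq]
  exact tsum_congr fun k => by simp [mul_comm]

lemma cv_assoc (A B C : ℤ → ℝ≥0∞) : (A ⊛ B) ⊛ C = A ⊛ B ⊛ C := by
  funext l
  unfold cv
  simp_rw [← ENNReal.tsum_mul_right, ← ENNReal.tsum_mul_left]
  rw [ENNReal.tsum_comm]
  refine tsum_congr fun k => ?_
  rw [← (Equiv.addRight k).tsum_eq]
  exact tsum_congr fun j => by simp [mul_assoc, sub_sub, add_comm]

instance : Std.Commutative cv := ⟨cv_comm⟩
instance : Std.Associative cv := ⟨cv_assoc⟩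

lemma cv_left_comm (A B C : ℤ → ℝ≥0∞) : A ⊛ B ⊛ C = B ⊛ A ⊛ C := by ac_rfl

lemma cv_mono {A A' B B' : ℤ → ℝ≥0∞} (hA : A ≤ A') (hB : B ≤ B') : A ⊛ B ≤ A' ⊛ B' :=
  fun l => ENNReal.tsum_le_tsum fun k => mul_le_mul' (hA k) (hB (l - k))

lemma cv_smul_left (c : ℝ≥0∞) (A B : ℤ → ℝ≥0∞) : (c • A) ⊛ B = c • (A ⊛ B) := by
  funext l
  simp [cv, mul_assoc, ENNReal.tsum_mul_left]

lemma cv_smul_right (c : ℝ≥0∞) (A B : ℤ → ℝ≥0∞) : A ⊛ (c • B) = c • (A ⊛ B) := by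
  rw [cv_comm, cv_smul_left, cv_comm]

lemma cv_add_left (A A' B : ℤ → ℝ≥0∞) : (A + A') ⊛ B = A ⊛ B + A' ⊛ B := by
  funext l
  simp [cv, add_mul, ENNReal.tsum_add]

lemma cv_even {A B : ℤ → ℝ≥0∞} (hA : ∀ l, A (-l) = A l) (hB : ∀ l, B (-l) = B l) (l : ℤ) :
    (A ⊛ B) (-l) = (A ⊛ B) l := by
  unfold cv
  rw [← (Equiv.neg ℤ).tsum_eq]
  refine tsum_congr fun k => ?_
  rw [Equiv.neg_apply, hA, ← hB (l - k)]
  congr 2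
  ring

lemma cv_single_zero (A : ℤ → ℝ≥0∞) : (Pi.single 0 1 : ℤ → ℝ≥0∞) ⊛ A = A := by
  funext l
  unfold cv
  rw [tsum_eq_single 0]
  · simp
  · intro k hk
    simp [hk]

/-- Hölder for the counting measure, kept in squared form so that no roots enter the later sums. -/
lemma tsum_mul_sq_le {ι : Type*} [Countable ι] (f g : ι → ℝ≥0∞) :
    (∑' i, f i * g i) ^ 2 ≤ (∑' i, f i ^ 2) * ∑' i, g i ^ 2 := by
  let _ : MeasurableSpace ι := ⊤
  have h := ENNReal.lintegral_mul_le_Lp_mul_Lq (Measure.count : Measure ι)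
    Real.HolderConjugate.two_two (f := f) (g := g)
    (measurable_of_countable f).aemeasurable (measurable_of_countable g).aemeasurable
  simp only [lintegral_count, Pi.mul_apply, ENNReal.rpow_two] at h
  calc _ ≤ _ := pow_le_pow_left' h 2
    _ = _ := by
      rw [mul_pow, ← ENNReal.rpow_two, ← ENNReal.rpow_two, ← ENNReal.rpow_mul, ← ENNReal.rpow_mul]
      norm_num

/-- Cauchy–Schwarz for √f and √f·g. -/
lemma tsum_mul_sq_le_weighted {ι : Type*} [Countable ι] (f g : ι → ℝ≥0∞) :
    (∑' i, f i * g i) ^ 2 ≤ (∑' i, f i) * ∑' i, f i * g i ^ 2 := by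
  have hs : ∀ x : ℝ≥0∞, (x ^ (1 / 2 : ℝ)) ^ 2 = x := fun x => by
    rw [← ENNReal.rpow_two, ← ENNReal.rpow_mul]; norm_num
  have h := tsum_mul_sq_le (fun i => f i ^ (1 / 2 : ℝ)) (fun i => f i ^ (1 / 2 : ℝ) * g i)
  simp only [← mul_assoc, mul_pow, hs, ← sq] at h
  exact h

/-- The weighted `ℓ¹` norm. -/
def n1 (p A : ℤ → ℝ≥0∞) : ℝ≥0∞ := ∑' l, p l * A l

/-- The square of the weighted `ℓ²` norm. -/
def n2 (p A : ℤ → ℝ≥0∞) : ℝ≥0∞ := ∑' l, (p l * A l) ^ 2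

lemma n1_mono {p A B : ℤ → ℝ≥0∞} (h : A ≤ B) : n1 p A ≤ n1 p B :=
  ENNReal.tsum_le_tsum fun l => mul_le_mul' le_rfl (h l)

lemma n2_mono {p A B : ℤ → ℝ≥0∞} (h : A ≤ B) : n2 p A ≤ n2 p B :=
  ENNReal.tsum_le_tsum fun l => pow_le_pow_left' (mul_le_mul' le_rfl (h l)) 2

lemma n1_add (p A B : ℤ → ℝ≥0∞) : n1 p (A + B) = n1 p A + n1 p B := by
  simp [n1, mul_add, ENNReal.tsum_add]

lemma n1_smul (p A : ℤ → ℝ≥0∞) (c : ℝ≥0∞) : n1 p (c • A) = c * n1 p A := by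
  simp [n1, mul_left_comm, ENNReal.tsum_mul_left]

lemma n2_smul (p A : ℤ → ℝ≥0∞) (c : ℝ≥0∞) : n2 p (c • A) = c ^ 2 * n2 p A := by
  simp [n2, mul_left_comm, mul_pow, ENNReal.tsum_mul_left]

lemma ennreal_add_sq_le (a b : ℝ≥0∞) : (a + b) ^ 2 ≤ 2 * a ^ 2 + 2 * b ^ 2 := by
  have h := ENNReal.rpow_add_le_mul_rpow_add_rpow a b (p := 2) (by norm_num)
  simp only [ENNReal.rpow_two] at h
  refine h.trans (le_of_eq ?_)
  norm_num [mul_add]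

lemma n2_add_le (p A B : ℤ → ℝ≥0∞) : n2 p (A + B) ≤ 2 * n2 p A + 2 * n2 p B := by
  simp only [n2, ← ENNReal.tsum_mul_left, ← ENNReal.tsum_add]
  refine ENNReal.tsum_le_tsum fun l => ?_
  rw [Pi.add_apply, mul_add]
  exact ennreal_add_sq_le _ _

lemma n1_tsum {ι : Type*} (p : ℤ → ℝ≥0∞) (A : ι → ℤ → ℝ≥0∞) :
    n1 p (fun l => ∑' i, A i l) = ∑' i, n1 p (A i) := by
  simp only [n1, ← ENNReal.tsum_mul_left]
  exact ENNReal.tsum_comm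

lemma n1_neg {p : ℤ → ℝ≥0∞} (hp : ∀ l, p (-l) = p l) (A : ℤ → ℝ≥0∞) :
    n1 p (fun l => A (-l)) = n1 p A := by
  unfold n1
  rw [← (Equiv.neg ℤ).tsum_eq (fun l => p l * A l)]
  exact tsum_congr fun l => by simp [hp]

lemma n2_neg {p : ℤ → ℝ≥0∞} (hp : ∀ l, p (-l) = p l) (A : ℤ → ℝ≥0∞) :
    n2 p (fun l => A (-l)) = n2 p A := by
  unfold n2
  rw [← (Equiv.neg ℤ).tsum_eq (fun l => (p l * A l) ^ 2)]
  exact tsum_congr fun l => by simp [hp]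

/-- A submultiplicative weight. -/
def Submul (p : ℤ → ℝ≥0∞) : Prop := ∀ k j, p (k + j) ≤ p k * p j

lemma Submul.mul_cv_le {p : ℤ → ℝ≥0∞} (hp : Submul p) (A B : ℤ → ℝ≥0∞) :
    p * (A ⊛ B) ≤ (p * A) ⊛ (p * B) := by
  intro l
  simp only [cv, Pi.mul_apply, ← ENNReal.tsum_mul_left]
  refine ENNReal.tsum_le_tsum fun k => ?_
  calc p l * (A k * B (l - k)) ≤ (p k * p (l - k)) * (A k * B (l - k)) := by
        gcongr
        simpa using hp k (l - k)
    _ = _ := by ring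

lemma tsum_cv (A B : ℤ → ℝ≥0∞) : ∑' l, (A ⊛ B) l = (∑' l, A l) * ∑' l, B l := by
  unfold cv
  rw [ENNReal.tsum_comm, ← ENNReal.tsum_mul_right]
  refine tsum_congr fun k => ?_
  rw [ENNReal.tsum_mul_left]
  exact congrArg _ ((Equiv.subRight k).tsum_eq B)

/-- Young's inequality ℓ¹ ∗ ℓ² ⊆ ℓ²: Cauchy–Schwarz with A as weight, then summation over the output
frequency. -/
lemma tsum_cv_sq_le (A B : ℤ → ℝ≥0∞) :
    ∑' l, (A ⊛ B) l ^ 2 ≤ (∑' l, A l) ^ 2 * ∑' l, B l ^ 2 := by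
  calc ∑' l, (A ⊛ B) l ^ 2 ≤ ∑' l, (∑' k, A k) * ∑' k, A k * B (l - k) ^ 2 :=
        ENNReal.tsum_le_tsum fun l => tsum_mul_sq_le_weighted _ _
    _ = (∑' k, A k) * ∑' l, (A ⊛ fun j => B j ^ 2) l := by
        rw [ENNReal.tsum_mul_left]; rfl
    _ = _ := by rw [tsum_cv]; ring

lemma Submul.n1_cv_le {p : ℤ → ℝ≥0∞} (hp : Submul p) (A B : ℤ → ℝ≥0∞) :
    n1 p (A ⊛ B) ≤ n1 p A * n1 p B :=
  (ENNReal.tsum_le_tsum (hp.mul_cv_le A B)).trans (tsum_cv _ _).le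

/-- The main product estimate: only one factor has to be square summable against the weight, all
others are measured in the weighted Wiener algebra. -/
lemma Submul.n2_cv_le {p : ℤ → ℝ≥0∞} (hp : Submul p) (A B : ℤ → ℝ≥0∞) :
    n2 p (A ⊛ B) ≤ n1 p A ^ 2 * n2 p B :=
  (ENNReal.tsum_le_tsum fun l => pow_le_pow_left' (hp.mul_cv_le A B l) 2).trans
    (tsum_cv_sq_le _ _)

lemma n2_le_n1_sq (p A : ℤ → ℝ≥0∞) : n2 p A ≤ n1 p A ^ 2 := by
  unfold n2 n1
  rw [sq, ← ENNReal.tsum_mul_right]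
  refine ENNReal.tsum_le_tsum fun l => ?_
  rw [sq]
  gcongr
  exact ENNReal.le_tsum (f := fun l => p l * A l) l

/-! ### The weight `1 + |μ_l|` -/

/-- The weight `1 + |μ_l|`. -/
def om (L : ℝ) (l : ℤ) : ℝ≥0∞ := ENNReal.ofReal (1 + |freq L l|)

lemma freq_add (L : ℝ) (k j : ℤ) : freq L (k + j) = freq L k + freq L j := by
  simp only [freq]; push_cast; ring

lemma freq_neg (L : ℝ) (k : ℤ) : freq L (-k) = -freq L k := by
  simp only [freq]; push_cast; ring

@[simp] lemma freq_zero (L : ℝ) : freq L 0 = 0 := by simp [freq]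

lemma om_neg (L : ℝ) (l : ℤ) : om L (-l) = om L l := by simp [om, freq_neg]

lemma one_le_om (L : ℝ) (l : ℤ) : 1 ≤ om L l := by
  rw [om, ← ENNReal.ofReal_one]
  exact ENNReal.ofReal_le_ofReal (by linarith [abs_nonneg (freq L l)])

lemma om_ne_top (L : ℝ) (l : ℤ) : om L l ≠ ⊤ := ENNReal.ofReal_ne_top

lemma om_add_le (L : ℝ) (k j : ℤ) : om L (k + j) ≤ om L k + om L j := by
  rw [om, om, om, ← ENNReal.ofReal_add (by positivity) (by positivity), freq_add]
  exact ENNReal.ofReal_le_ofReal (by linarith [abs_add_le (freq L k) (freq L j)])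

lemma om_submul (L : ℝ) : Submul (om L) := by
  intro k j
  rw [om, om, om, ← ENNReal.ofReal_mul (by positivity), freq_add]
  refine ENNReal.ofReal_le_ofReal ?_
  nlinarith [abs_add_le (freq L k) (freq L j), abs_nonneg (freq L k), abs_nonneg (freq L j),
    mul_nonneg (abs_nonneg (freq L k)) (abs_nonneg (freq L j))]

lemma om_rpow_submul (L : ℝ) {s : ℝ} (hs : 0 ≤ s) : Submul fun l => om L l ^ s := by
  intro k j
  rw [← ENNReal.mul_rpow_of_nonneg _ _ hs]
  exact ENNReal.rpow_le_rpow (om_submul L k j) hs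

lemma one_le_om_rpow (L : ℝ) {s : ℝ} (hs : 0 ≤ s) (l : ℤ) : 1 ≤ om L l ^ s :=
  by simpa using ENNReal.rpow_le_rpow (one_le_om L l) hs

lemma tsum_om_inv_sq_ne_top {L : ℝ} (hL : 0 < L) : ∑' l : ℤ, ((om L l)⁻¹) ^ 2 ≠ ⊤ := by
  have hs : Summable fun l : ℤ => ((1 + |freq L l|)⁻¹) ^ 2 := by
    have h2 : Summable fun l : ℤ => (L / Real.pi) ^ 2 * (1 / (l : ℝ) ^ 2) :=
      (Real.summable_one_div_int_pow.mpr one_lt_two).mul_left _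
    -- The added indicator covers l = 0, where 1/l² is 0 by convention.
    have h3 : Summable fun l : ℤ => (L / Real.pi) ^ 2 * (1 / (l : ℝ) ^ 2) +
        if l = 0 then (1 : ℝ) else 0 :=
      h2.add ((hasSum_ite_eq (0 : ℤ) (1 : ℝ)).summable)
    refine h3.of_nonneg_of_le (fun l => by positivity) fun l => ?_
    by_cases hl : l = 0
    · simp [hl]
    · have hl' : (0 : ℝ) < |(l : ℝ)| := by positivity
      simp only [hl, if_false, add_zero]
      rw [← sq_abs (l : ℝ), one_div, ← inv_pow, ← mul_pow]
      refine pow_le_pow_left₀ (by positivity) ?_ 2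
      rw [div_mul_eq_mul_div, ← div_eq_mul_inv, div_div, inv_eq_one_div,
        div_le_div_iff₀ (by positivity) (by positivity), freq, abs_div, abs_mul, abs_of_pos hL,
        abs_of_pos Real.pi_pos]
      field_simp
      nlinarith
  have h := hs.tsum_ofReal_ne_top
  convert h using 4 with l
  rw [om, ENNReal.ofReal_pow (by positivity), ENNReal.ofReal_inv_of_pos (by positivity)]

/-- Since ω⁻¹ is in ℓ², giving up one power of ω passes from ℓ² to ℓ¹. This is the one-dimensional
Sobolev embedding used throughout. -/
lemma n1_om_ne_top {L : ℝ} (hL : 0 < L) {p A : ℤ → ℝ≥0∞} (h : n2 p (om L ^ 2 * A) ≠ ⊤) :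
    n1 p (om L * A) ≠ ⊤ := by
  have key : n1 p (om L * A) ^ 2 ≤ (∑' l : ℤ, ((om L l)⁻¹) ^ 2) * n2 p (om L ^ 2 * A) := by
    refine le_trans (le_of_eq ?_) (tsum_mul_sq_le _ _)
    unfold n1
    congr 1
    refine tsum_congr fun l => ?_
    simp only [Pi.mul_apply, Pi.pow_apply]
    have h0 : om L l ≠ 0 := (zero_lt_one.trans_le (one_le_om L l)).ne'
    calc p l * (om L l * A l) = 1 * (p l * (om L l * A l)) := by ring
      _ = ((om L l)⁻¹ * om L l) * (p l * (om L l * A l)) := by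
        rw [ENNReal.inv_mul_cancel h0 (om_ne_top L l)]
      _ = _ := by ring
  intro htop
  rw [htop] at key
  exact absurd (top_le_iff.mp (by simpa using key))
    (ENNReal.mul_ne_top (tsum_om_inv_sq_ne_top hL) h)

lemma le_om_mul (L : ℝ) (A : ℤ → ℝ≥0∞) : A ≤ om L * A := fun l => by
  simpa using mul_le_mul' (one_le_om L l) (le_refl (A l))

lemma om_mul_cv_le (L : ℝ) (A B : ℤ → ℝ≥0∞) : om L * (A ⊛ B) ≤ (om L * A) ⊛ (om L * B) :=
  (om_submul L).mul_cv_le A B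

end

section

/-! ### Absolutely summable sequences and bilinear symbols -/

/-- Absolute summability of a sequence of Fourier coefficients. -/
def LOne (a : ℤ → ℂ) : Prop := Summable fun l => ‖a l‖

lemma lOne_iff {a : ℤ → ℂ} : LOne a ↔ ∑' l, ‖a l‖ₑ ≠ ⊤ := by
  constructor
  · intro h
    have h' := h.tsum_ofReal_ne_top
    simpa only [ofReal_norm] using h'
  · intro h
    have h' := ENNReal.summable_toReal h
    simpa only [LOne, toReal_enorm] using h'

lemma lOne_of_le {a : ℤ → ℂ} {A : ℤ → ℝ≥0∞} (h : ∀ l, ‖a l‖ₑ ≤ A l) (hA : ∑' l, A l ≠ ⊤) :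
    LOne a :=
  lOne_iff.mpr (ne_top_of_le_ne_top hA (ENNReal.tsum_le_tsum h))

lemma LOne.mul_of_bound {a : ℤ → ℂ} (ha : LOne a) {m : ℤ → ℂ} {C : ℝ} (hm : ∀ l, ‖m l‖ ≤ C) :
    LOne fun l => m l * a l := by
  refine (Summable.mul_left C ha).of_nonneg_of_le (fun l => norm_nonneg _) fun l => ?_
  rw [norm_mul]
  exact mul_le_mul_of_nonneg_right (hm l) (norm_nonneg _)

lemma LOne.add {a b : ℤ → ℂ} (ha : LOne a) (hb : LOne b) : LOne (a + b) :=
  (Summable.add ha hb).of_nonneg_of_le (fun _ => norm_nonneg _) fun _ => norm_add_le _ _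

lemma LOne.neg {a : ℤ → ℂ} (ha : LOne a) : LOne (-a) := by simpa [LOne] using ha

lemma LOne.sub {a b : ℤ → ℂ} (ha : LOne a) (hb : LOne b) : LOne (a - b) := by
  simpa [sub_eq_add_neg] using ha.add hb.neg

lemma LOne.smul {a : ℤ → ℂ} (ha : LOne a) (c : ℂ) : LOne (c • a) :=
  ha.mul_of_bound (m := fun _ => c) fun _ => le_rfl

lemma lOne_single (c : ℂ) : LOne (Pi.single 0 c) := by
  refine summable_of_ne_finset_zero (s := {0}) fun l hl => ?_
  simp only [Finset.mem_singleton] at hl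
  simp [hl]

/-- The coefficients of the complex conjugate of a function with coefficients `a`. -/
def cj (a : ℤ → ℂ) (l : ℤ) : ℂ := conj (a (-l))

lemma LOne.cj {a : ℤ → ℂ} (ha : LOne a) : LOne (cj a) := by
  have := (Equiv.neg ℤ).summable_iff.mpr ha
  simpa [LOne, DNLS.cj, Function.comp_def] using this

lemma cj_sub (a b : ℤ → ℂ) : cj (a - b) = cj a - cj b := by
  funext l; simp [cj]

lemma enorm_conj (z : ℂ) : ‖conj z‖ₑ = ‖z‖ₑ := by
  rw [← ofReal_norm, ← ofReal_norm, Complex.norm_conj]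

lemma enorm_cj_le {a : ℤ → ℂ} {A : ℤ → ℝ≥0∞} (hA : ∀ l, A (-l) = A l) (h : ∀ l, ‖a l‖ₑ ≤ A l)
    (l : ℤ) : ‖cj a l‖ₑ ≤ A l := by
  rw [cj, enorm_conj, ← hA l]
  exact h _

/-- The bilinear operator with symbol `σ`, acting on Fourier coefficients. -/
def bil (σ : ℤ → ℤ → ℂ) (a b : ℤ → ℂ) (l : ℤ) : ℂ := ∑' k, σ k (l - k) * a k * b (l - k)

/-- The convolution, i.e. the coefficients of a product. -/
def conv (a b : ℤ → ℂ) : ℤ → ℂ := bil (fun _ _ => 1) a b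

/-- Absolute convergence of the series defining `bil σ a b l`. -/
def BilSummable (σ : ℤ → ℤ → ℂ) (a b : ℤ → ℂ) (l : ℤ) : Prop :=
  Summable fun k => σ k (l - k) * a k * b (l - k)

section bil

variable {σ σ' : ℤ → ℤ → ℂ} {a a' b b' : ℤ → ℂ} {A B : ℤ → ℝ≥0∞} {l : ℤ}

/-- No summability is assumed: if the norms are not summable the right side is `⊤`. -/
lemma enorm_tsum_le' {ι : Type*} (f : ι → ℂ) : ‖∑' i, f i‖ₑ ≤ ∑' i, ‖f i‖ₑ := by
  by_cases h : ∑' i, ‖f i‖ₑ = ⊤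
  · simp [h]
  · have hs : Summable fun i => ‖f i‖ := by simpa using ENNReal.summable_toReal h
    rw [← ofReal_norm]
    refine (ENNReal.ofReal_le_ofReal (norm_tsum_le_tsum_norm hs)).trans ?_
    rw [ENNReal.ofReal_tsum_of_nonneg (fun _ => norm_nonneg _) hs]
    simp

/-- Reduces the estimate of a bilinear operator to a bound of its symbol by a product of a weight in
k and a weight in j. -/
lemma enorm_bil_le (h : ∀ k j, ‖σ k j‖ₑ * ‖a k‖ₑ * ‖b j‖ₑ ≤ A k * B j) (l : ℤ) :
    ‖bil σ a b l‖ₑ ≤ (A ⊛ B) l := by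
  refine (enorm_tsum_le' _).trans (ENNReal.tsum_le_tsum fun k => ?_)
  simpa [enorm_mul] using h k (l - k)

lemma bilSummable_of_le (h : ∀ k j, ‖σ k j‖ₑ * ‖a k‖ₑ * ‖b j‖ₑ ≤ A k * B j)
    (hfin : (A ⊛ B) l ≠ ⊤) : BilSummable σ a b l := by
  refine Summable.of_norm ?_
  have : ∑' k, ‖σ k (l - k) * a k * b (l - k)‖ₑ ≠ ⊤ := by
    refine ne_top_of_le_ne_top hfin (ENNReal.tsum_le_tsum fun k => ?_)
    simpa [enorm_mul] using h k (l - k)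
  simpa using ENNReal.summable_toReal this

lemma bil_add_symbol (h : BilSummable σ a b l) (h' : BilSummable σ' a b l) :
    bil (fun k j => σ k j + σ' k j) a b l = bil σ a b l + bil σ' a b l := by
  unfold bil
  rw [← Summable.tsum_add h h']
  exact tsum_congr fun k => by ring

lemma bil_sub_symbol (h : BilSummable σ a b l) (h' : BilSummable σ' a b l) :
    bil (fun k j => σ k j - σ' k j) a b l = bil σ a b l - bil σ' a b l := by
  unfold bil
  rw [← Summable.tsum_sub h h']
  exact tsum_congr fun k => by ring

lemma bil_smul_symbol (c : ℂ) : bil (fun k j => c * σ k j) a b l = c * bil σ a b l := by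
  unfold bil
  rw [← tsum_mul_left]
  exact tsum_congr fun k => by ring

lemma bil_sub_left (h : BilSummable σ a b l) (h' : BilSummable σ a' b l) :
    bil σ (a - a') b l = bil σ a b l - bil σ a' b l := by
  unfold bil
  rw [← Summable.tsum_sub h h']
  exact tsum_congr fun k => by simp only [Pi.sub_apply]; ring

lemma bil_sub_right (h : BilSummable σ a b l) (h' : BilSummable σ a b' l) :
    bil σ a (b - b') l = bil σ a b l - bil σ a b' l := by
  unfold bil
  rw [← Summable.tsum_sub h h']
  exact tsum_congr fun k => by simp only [Pi.sub_apply]; ring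

lemma bil_smul_left (c : ℂ) : bil σ (c • a) b = c • bil σ a b := by
  funext l
  simp only [bil, Pi.smul_apply, smul_eq_mul, ← tsum_mul_left]
  exact tsum_congr fun k => by ring

lemma bil_smul_right (c : ℂ) : bil σ a (c • b) = c • bil σ a b := by
  funext l
  simp only [bil, Pi.smul_apply, smul_eq_mul, ← tsum_mul_left]
  exact tsum_congr fun k => by ring

lemma enorm_le_of_norm_le {z : ℂ} {C : ℝ} (h : ‖z‖ ≤ C) : ‖z‖ₑ ≤ ENNReal.ofReal C := by
  rw [← ofReal_norm]
  exact ENNReal.ofReal_le_ofReal h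

lemma bound_of_bdd_symbol {C : ℝ} (hσ : ∀ k j, ‖σ k j‖ ≤ C) (k j : ℤ) :
    ‖σ k j‖ₑ * ‖a k‖ₑ * ‖b j‖ₑ ≤ (ENNReal.ofReal C * ‖a k‖ₑ) * ‖b j‖ₑ := by
  gcongr
  exact enorm_le_of_norm_le (hσ k j)

lemma cv_enorm_ne_top (ha : LOne a) (hb : LOne b) (C : ℝ) :
    ∑' l, ((fun k => ENNReal.ofReal C * ‖a k‖ₑ) ⊛ fun j => ‖b j‖ₑ) l ≠ ⊤ := by
  rw [tsum_cv, ENNReal.tsum_mul_left]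
  exact ENNReal.mul_ne_top (ENNReal.mul_ne_top ENNReal.ofReal_ne_top (lOne_iff.mp ha))
    (lOne_iff.mp hb)

lemma LOne.bilSummable {C : ℝ} (hσ : ∀ k j, ‖σ k j‖ ≤ C) (ha : LOne a) (hb : LOne b) (l : ℤ) :
    BilSummable σ a b l :=
  bilSummable_of_le (bound_of_bdd_symbol hσ)
    (ne_top_of_le_ne_top (cv_enorm_ne_top ha hb C) (ENNReal.le_tsum l))

lemma LOne.bil {C : ℝ} (hσ : ∀ k j, ‖σ k j‖ ≤ C) (ha : LOne a) (hb : LOne b) :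
    LOne (bil σ a b) :=
  lOne_of_le (enorm_bil_le (bound_of_bdd_symbol hσ)) (cv_enorm_ne_top ha hb C)

lemma LOne.conv (ha : LOne a) (hb : LOne b) : LOne (conv a b) :=
  LOne.bil (C := 1) (by simp) ha hb

lemma enorm_bil_le_of_norm_le_one (hσ : ∀ k j, ‖σ k j‖ ≤ 1) (ha : ∀ l, ‖a l‖ₑ ≤ A l)
    (hb : ∀ l, ‖b l‖ₑ ≤ B l) (l : ℤ) : ‖bil σ a b l‖ₑ ≤ (A ⊛ B) l := by
  refine enorm_bil_le (fun k j => ?_) l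
  have h1 := enorm_le_of_norm_le (hσ k j)
  rw [ENNReal.ofReal_one] at h1
  calc _ ≤ 1 * A k * B j := by gcongr; exacts [ha k, hb j]
    _ = _ := by ring

lemma enorm_conv_le (ha : ∀ l, ‖a l‖ₑ ≤ A l) (hb : ∀ l, ‖b l‖ₑ ≤ B l) (l : ℤ) :
    ‖conv a b l‖ₑ ≤ (A ⊛ B) l :=
  enorm_bil_le_of_norm_le_one (by simp) ha hb l

end bil

/-! ### Functions given by absolutely convergent Fourier series -/

variable {L : ℝ} [Fact (0 < 2 * L)]

/-- The function with Fourier coefficients `a`. -/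
def synth (a : ℤ → ℂ) (x : Torus L) : ℂ := ∑' l, a l * fourier l x

lemma norm_fourier_apply (l : ℤ) (x : Torus L) : ‖fourier l x‖ = 1 := by
  rw [fourier_apply, Circle.norm_coe]

lemma LOne.summable_synth {a : ℤ → ℂ} (ha : LOne a) (x : Torus L) :
    Summable fun l => a l * fourier l x :=
  Summable.of_norm (by simpa only [norm_mul, norm_fourier_apply, mul_one, LOne] using ha)

lemma LOne.continuous_synth {a : ℤ → ℂ} (ha : LOne a) : Continuous (synth a : Torus L → ℂ) := by
  refine continuous_tsum (fun l => ?_) ha fun l x => ?_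
  · exact continuous_const.mul (fourier l).continuous
  · rw [norm_mul, norm_fourier_apply, mul_one]

lemma integrable_of_continuous {f : Torus L → ℂ} (hf : Continuous f) :
    Integrable f AddCircle.haarAddCircle :=
  hf.integrable_of_hasCompactSupport (HasCompactSupport.of_compactSpace f)

/-- Absolute convergence permits termwise integration, and orthogonality of the characters leaves a
single term. -/
lemma LOne.fourierCoeff_synth {a : ℤ → ℂ} (ha : LOne a) :
    fourierCoeff (synth a : Torus L → ℂ) = a := by
  funext n
  have hF : ∀ l, Integrable (fun t : Torus L => fourier (-n) t • (a l * fourier l t))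
      AddCircle.haarAddCircle := fun l =>
    integrable_of_continuous (by fun_prop)
  have hn : ∀ l (t : Torus L), ‖fourier (-n) t • (a l * fourier l t)‖ = ‖a l‖ := fun l t => by
    rw [norm_smul, norm_mul, norm_fourier_apply, norm_fourier_apply, one_mul, mul_one]
  have h := hasSum_integral_of_summable_integral_norm hF (by
    simp only [hn]
    simpa [LOne] using ha)
  have h1 : ∀ l, ∫ t : Torus L, fourier (-n) t • (a l * fourier l t) ∂AddCircle.haarAddCircle
      = if l = n then a l else 0 := fun l => by
    have := congrFun (fourierCoeff_fourier (T := 2 * L) l) n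
    have h2 := fourierCoeff.const_mul (fourier l : Torus L → ℂ) (a l) n
    rw [this] at h2
    unfold fourierCoeff at h2
    rw [h2]
    by_cases hl : l = n
    · subst hl; simp
    · simp [hl, Ne.symm hl]
  simp only [h1] at h
  have h3 := h.unique (show HasSum (fun x => if x = n then a x else 0) (a n) by
    simpa using hasSum_single (f := fun x => if x = n then a x else 0) n
      (fun x hx => if_neg hx))
  rw [← h3]
  unfold fourierCoeff synth
  refine integral_congr_ae (ae_of_all _ fun t => ?_)
  simp only [smul_eq_mul, ← tsum_mul_left]

lemma LOne.memLp_synth {a : ℤ → ℂ} (ha : LOne a) :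
    MemLp (synth a : Torus L → ℂ) 2 AddCircle.haarAddCircle :=
  ha.continuous_synth.memLp_of_hasCompactSupport (HasCompactSupport.of_compactSpace _)

lemma LOne.synth_conv {a b : ℤ → ℂ} (ha : LOne a) (hb : LOne b) (x : Torus L) :
    synth (DNLS.conv a b) x = synth a x * synth b x := by
  have hf : Summable fun l => ‖a l * fourier l x‖ := (ha.summable_synth x).norm
  have hg : Summable fun l => ‖b l * fourier l x‖ := (hb.summable_synth x).norm
  have hp := summable_mul_of_summable_norm hf hg
  -- Reindexes the Cauchy product by (output frequency, first frequency).
  let e : ℤ × ℤ ≃ ℤ × ℤ :=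
    { toFun := fun q => (q.2, q.1 - q.2)
      invFun := fun q => (q.1 + q.2, q.1)
      left_inv := fun q => by simp
      right_inv := fun q => by simp }
  have hp' := e.summable_iff.mpr hp
  unfold synth
  rw [tsum_mul_tsum_of_summable_norm hf hg, ← e.tsum_eq, Summable.tsum_prod (f := fun c : ℤ × ℤ =>
    a (e c).1 * fourier (e c).1 x * (b (e c).2 * fourier (e c).2 x)) hp']
  refine tsum_congr fun l => ?_
  simp only [DNLS.conv, DNLS.bil, ← tsum_mul_right]
  refine tsum_congr fun k => ?_
  have : fourier l x = fourier k x * fourier (l - k) x := by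
    rw [← fourier_add, add_sub_cancel]
  simp only [e, Equiv.coe_fn_mk, this]
  ring

lemma synth_cj (a : ℤ → ℂ) (x : Torus L) : synth (cj a) x = conj (synth a x) := by
  unfold synth
  rw [Complex.conj_tsum, ← (Equiv.neg ℤ).tsum_eq]
  exact tsum_congr fun l => by simp [cj, -fourier_apply, fourier_neg]

lemma LOne.synth_add {a b : ℤ → ℂ} (ha : LOne a) (hb : LOne b) (x : Torus L) :
    synth (a + b) x = synth a x + synth b x := by
  unfold synth
  rw [← (ha.summable_synth x).tsum_add (hb.summable_synth x)]
  exact tsum_congr fun l => by simp only [Pi.add_apply]; ring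

lemma synth_smul (c : ℂ) (a : ℤ → ℂ) (x : Torus L) : synth (c • a) x = c * synth a x := by
  unfold synth
  rw [← tsum_mul_left]
  exact tsum_congr fun l => by simp only [Pi.smul_apply, smul_eq_mul]; ring

lemma synth_single (c : ℂ) (x : Torus L) : synth (Pi.single 0 c) x = c := by
  unfold synth
  rw [tsum_eq_single 0]
  · simp
  · intro l hl; simp [hl]

/-- `f` is represented by the absolutely convergent Fourier series with coefficients `a`. -/
def HasCoeff (f : Torus L → ℂ) (a : ℤ → ℂ) : Prop :=
  LOne a ∧ f =ᵐ[AddCircle.haarAddCircle] synth a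

namespace HasCoeff

variable {f g : Torus L → ℂ} {a b : ℤ → ℂ}

lemma fourierCoeff_eq (h : HasCoeff f a) : fourierCoeff f = a := by
  rw [fourierCoeff_congr_ae h.2, h.1.fourierCoeff_synth]

lemma memLp (h : HasCoeff f a) : MemLp f 2 AddCircle.haarAddCircle :=
  (memLp_congr_ae h.2).mpr h.1.memLp_synth

lemma add (hf : HasCoeff f a) (hg : HasCoeff g b) : HasCoeff (fun x => f x + g x) (a + b) := by
  refine ⟨hf.1.add hg.1, ?_⟩
  filter_upwards [hf.2, hg.2] with x h1 h2
  rw [h1, h2, hf.1.synth_add hg.1]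

lemma const_mul (hf : HasCoeff f a) (c : ℂ) : HasCoeff (fun x => c * f x) (c • a) := by
  refine ⟨hf.1.smul c, ?_⟩
  filter_upwards [hf.2] with x h1
  rw [h1, synth_smul]

lemma sub (hf : HasCoeff f a) (hg : HasCoeff g b) : HasCoeff (fun x => f x - g x) (a - b) := by
  have := hf.add (hg.const_mul (-1))
  simpa [sub_eq_add_neg] using this

lemma mul (hf : HasCoeff f a) (hg : HasCoeff g b) : HasCoeff (fun x => f x * g x) (conv a b) := by
  refine ⟨hf.1.conv hg.1, ?_⟩
  filter_upwards [hf.2, hg.2] with x h1 h2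
  rw [h1, h2, hf.1.synth_conv hg.1]

lemma conjugate (hf : HasCoeff f a) : HasCoeff (fun x => conj (f x)) (cj a) := by
  refine ⟨hf.1.cj, ?_⟩
  filter_upwards [hf.2] with x h1
  rw [h1, synth_cj]

lemma const (c : ℂ) : HasCoeff (fun _ : Torus L => c) (Pi.single 0 c) :=
  ⟨lOne_single c, ae_of_all _ fun x => (synth_single c x).symm⟩

lemma multiplier (hf : HasCoeff f a) {σ : ℂ → ℂ} {C : ℝ}
    (hσ : ∀ l, ‖σ (Complex.I * freq L l)‖ ≤ C) :
    HasCoeff (multiplier σ f) fun l => σ (Complex.I * freq L l) * a l := by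
  refine ⟨hf.1.mul_of_bound hσ, ae_of_all _ fun x => ?_⟩
  rw [DNLS.multiplier, hf.fourierCoeff_eq, synth]

lemma congr {a' : ℤ → ℂ} (hf : HasCoeff f a) (h : ∀ l, a l = a' l) : HasCoeff f a' :=
  funext h ▸ hf

lemma congr_ae (hf : HasCoeff f a) (h : g =ᵐ[AddCircle.haarAddCircle] f) : HasCoeff g a :=
  ⟨hf.1, h.trans hf.2⟩

end HasCoeff

lemma hasCoeff_synth {a : ℤ → ℂ} (ha : LOne a) : HasCoeff (synth a : Torus L → ℂ) a :=
  ⟨ha, Filter.EventuallyEq.rfl⟩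

/-- Both functions have the same coordinates in the Fourier Hilbert basis of L². -/
lemma hasCoeff_of_memLp {f : Torus L → ℂ} (hf : MemLp f 2 AddCircle.haarAddCircle)
    (h : LOne (fourierCoeff f)) : HasCoeff f (fourierCoeff f) := by
  refine ⟨h, ?_⟩
  have hg : MemLp (synth (fourierCoeff f) : Torus L → ℂ) 2 AddCircle.haarAddCircle :=
    h.memLp_synth
  have heq : hf.toLp = hg.toLp := by
    apply fourierBasis.repr.injective
    ext i
    rw [fourierBasis_repr, fourierBasis_repr, fourierCoeff_congr_ae hf.coeFn_toLp,
      fourierCoeff_congr_ae hg.coeFn_toLp, h.fourierCoeff_synth]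
  exact (MemLp.toLp_eq_toLp_iff hf hg).mp heq

lemma hasSum_sq_fourierCoeff_of_memLp {f : Torus L → ℂ}
    (hf : MemLp f 2 AddCircle.haarAddCircle) :
    HasSum (fun l => ‖fourierCoeff f l‖ ^ 2) (∫ x, ‖f x‖ ^ 2 ∂AddCircle.haarAddCircle) := by
  have h := hasSum_sq_fourierCoeff hf.toLp
  rw [fourierCoeff_congr_ae hf.coeFn_toLp] at h
  convert h using 1
  refine integral_congr_ae ?_
  filter_upwards [hf.coeFn_toLp] with x hx
  rw [hx]

/-- Allows an identity between nested convolutions to be checked pointwise, as a polynomial identity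
in function values. -/
lemma LOne.ext_synth {a b : ℤ → ℂ} (ha : LOne a) (hb : LOne b)
    (h : ∀ x : Torus L, synth a x = synth b x) : a = b := by
  rw [← ha.fourierCoeff_synth (L := L), ← hb.fourierCoeff_synth (L := L)]
  congr 1
  funext x
  exact h x

end

open Complex (I)
section

/-! ### The integrator on the level of Fourier coefficients -/

/-- `∫₀^τ exp(i ρ y) dρ`. -/
def phi (τ y : ℝ) : ℂ := ∫ ρ in (0 : ℝ)..τ, Complex.exp (I * ρ * y)

lemma norm_exp_I_mul (x y : ℝ) : ‖Complex.exp (I * x * y)‖ = 1 := by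
  rw [mul_assoc, ← Complex.ofReal_mul, mul_comm, Complex.norm_exp_ofReal_mul_I]

lemma norm_phi_le {τ : ℝ} (hτ : 0 ≤ τ) (y : ℝ) : ‖phi τ y‖ ≤ τ := by
  have := intervalIntegral.norm_integral_le_of_norm_le_const (a := 0) (b := τ) (C := 1)
    (f := fun ρ : ℝ => Complex.exp (I * ρ * y)) (fun ρ _ => (norm_exp_I_mul ρ y).le)
  simpa [phi, abs_of_nonneg hτ] using this

lemma phi_zero (τ : ℝ) : phi τ 0 = τ := by simp [phi]

lemma phi_of_ne (τ : ℝ) {y : ℝ} (hy : y ≠ 0) :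
    phi τ y = (Complex.exp (I * τ * y) - 1) / (I * y) := by
  have hc : I * (y : ℂ) ≠ 0 := mul_ne_zero Complex.I_ne_zero (by exact_mod_cast hy)
  have := integral_exp_mul_complex (a := 0) (b := τ) hc
  simp only [Complex.ofReal_zero, mul_zero, Complex.exp_zero] at this
  rw [show I * (τ : ℂ) * y = I * y * τ by ring, ← this, phi]
  congr 1
  funext ρ
  ring_nf

/-- `2 μ_k (μ_k + μ_j)`. -/
def alpha (L : ℝ) (k j : ℤ) : ℝ := 2 * freq L k * (freq L k + freq L j)

/-- `2 μ_k μ_j`. -/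
def beta (L : ℝ) (k j : ℤ) : ℝ := 2 * freq L k * freq L j

/-- `(μ_k + μ_j)² - μ_j²`. -/
def eta (L : ℝ) (k j : ℤ) : ℝ := freq L k ^ 2 + 2 * freq L k * freq L j

/-- The filtered approximation of `exp(i ρ ((μ_k + μ_j)² - μ_j²))` used by the integrator. -/
def psi (L τ ρ : ℝ) (k j : ℤ) : ℂ :=
  Complex.exp (I * ρ * (freq L k ^ 2 : ℝ)) *
    (1 + 2 * I * (ρ / τ) * freq L k * Real.sin (τ * freq L j))

/-- `∫₀^τ ρ exp(i ρ y) dρ`. -/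
def phi' (τ y : ℝ) : ℂ := ∫ ρ in (0 : ℝ)..τ, ρ * Complex.exp (I * ρ * y)

lemma phi'_of_ne (τ : ℝ) {y : ℝ} (hy : y ≠ 0) :
    phi' τ y = τ * Complex.exp (I * τ * y) / (I * y) + (Complex.exp (I * τ * y) - 1) / y ^ 2 := by
  have hyc : (y : ℂ) ≠ 0 := by exact_mod_cast hy
  -- The antiderivative produced by one integration by parts.
  have hd : ∀ ρ : ℝ, HasDerivAt (fun ρ : ℝ => (ρ : ℂ) * Complex.exp (I * ρ * y) / (I * y) +
      Complex.exp (I * ρ * y) / y ^ 2) (ρ * Complex.exp (I * ρ * y)) ρ := by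
    intro ρ
    have h1 : HasDerivAt (fun ρ : ℝ => (ρ : ℂ)) 1 ρ := Complex.ofRealCLM.hasDerivAt
    have h2 : HasDerivAt (fun ρ : ℝ => Complex.exp (I * ρ * y))
        (Complex.exp (I * ρ * y) * (I * 1 * y)) ρ := ((h1.const_mul I).mul_const (y : ℂ)).cexp
    refine (((h1.mul h2).div_const (I * y)).add (h2.div_const ((y : ℂ) ^ 2))).congr_deriv ?_
    have hI : I ^ 2 = -1 := Complex.I_sq
    field_simp
    linear_combination hI
  have h := intervalIntegral.integral_eq_sub_of_hasDerivAt (a := 0) (b := τ)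
    (fun ρ _ => hd ρ) (Continuous.intervalIntegrable (by fun_prop) _ _)
  rw [phi', h]
  simp
  ring

/-- `∫₀^τ ψ_ρ dρ`. -/
def psiI (L τ : ℝ) (k j : ℤ) : ℂ := ∫ ρ in (0 : ℝ)..τ, psi L τ ρ k j

lemma psiI_eq (L τ : ℝ) (k j : ℤ) : psiI L τ k j = phi τ (freq L k ^ 2) +
    2 * I / τ * freq L k * Real.sin (τ * freq L j) * phi' τ (freq L k ^ 2) := by
  unfold psiI psi phi phi'
  rw [← intervalIntegral.integral_const_mul, ← intervalIntegral.integral_add]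
  · congr 1
    funext ρ
    ring
  · exact Continuous.intervalIntegrable (by fun_prop) _ _
  · exact Continuous.intervalIntegrable (by fun_prop) _ _

/-- The coefficients of `|w|^(2m) w`. -/
def cub (a : ℤ → ℂ) : ℕ → ℤ → ℂ
  | 0 => a
  | m + 1 => conv (cj a) (conv a (cub a m))

/-- The coefficients of `exp(z |w|²) w`. -/
def expc (z : ℂ) (a : ℤ → ℂ) (l : ℤ) : ℂ := ∑' m : ℕ, z ^ m / m.factorial * cub a m l

lemma LOne.cub {a : ℤ → ℂ} (ha : LOne a) (m : ℕ) : LOne (cub a m) := by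
  induction m with
  | zero => exact ha
  | succ m ih => exact ha.cj.conv (ha.conv ih)

lemma tsum_enorm_cub_le (a : ℤ → ℂ) (m : ℕ) :
    ∑' l, ‖cub a m l‖ₑ ≤ ((∑' l, ‖a l‖ₑ) ^ 2) ^ m * ∑' l, ‖a l‖ₑ := by
  induction m with
  | zero => simp [cub]
  | succ m ih =>
    have h1 : ∑' l, ‖cj a l‖ₑ = ∑' l, ‖a l‖ₑ := by
      rw [← (Equiv.neg ℤ).tsum_eq]
      exact tsum_congr fun l => by simp [cj]
    calc ∑' l, ‖cub a (m + 1) l‖ₑ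
        ≤ ∑' l, ((fun l => ‖cj a l‖ₑ) ⊛ (fun l => ‖a l‖ₑ) ⊛ fun l => ‖cub a m l‖ₑ) l :=
          ENNReal.tsum_le_tsum fun l => enorm_conv_le (fun _ => le_rfl)
            (enorm_conv_le (fun _ => le_rfl) fun _ => le_rfl) l
      _ = (∑' l, ‖a l‖ₑ) * ((∑' l, ‖a l‖ₑ) * ∑' l, ‖cub a m l‖ₑ) := by
          rw [tsum_cv, tsum_cv, h1]
      _ ≤ (∑' l, ‖a l‖ₑ) * ((∑' l, ‖a l‖ₑ) * (((∑' l, ‖a l‖ₑ) ^ 2) ^ m * ∑' l, ‖a l‖ₑ)) := by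
          gcongr
      _ = _ := by ring

lemma tsum_pow_div_factorial_ne_top {x : ℝ≥0∞} (hx : x ≠ ⊤) :
    ∑' m : ℕ, x ^ m / (m.factorial : ℝ≥0∞) ≠ ⊤ := by
  have h := (Real.summable_pow_div_factorial x.toReal).tsum_ofReal_ne_top
  convert h using 3 with m
  rw [ENNReal.ofReal_div_of_pos (by positivity), ENNReal.ofReal_pow ENNReal.toReal_nonneg,
    ENNReal.ofReal_toReal hx, ENNReal.ofReal_natCast]

lemma enorm_pow_div_factorial (z : ℂ) (m : ℕ) :
    ‖z ^ m / (m.factorial : ℂ)‖ₑ = ‖z‖ₑ ^ m / (m.factorial : ℝ≥0∞) := by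
  rw [← ofReal_norm, norm_div, norm_pow, Complex.norm_natCast,
    ENNReal.ofReal_div_of_pos (by positivity), ENNReal.ofReal_pow (norm_nonneg _), ofReal_norm,
    ENNReal.ofReal_natCast]

/-- The double sum is dominated by R exp(‖z‖R²) with R the ℓ¹ norm of a, because ℓ¹ is a convolution
algebra. It justifies exchanging the sums over m and l. -/
lemma tsum_tsum_enorm_expc_ne_top (z : ℂ) {a : ℤ → ℂ} (ha : LOne a) :
    ∑' m : ℕ, ∑' l, ‖z ^ m / m.factorial * cub a m l‖ₑ ≠ ⊤ := by
  have hR := lOne_iff.mp ha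
  set R := ∑' l, ‖a l‖ₑ with hRdef
  have hfin : (∑' m : ℕ, (‖z‖ₑ * R ^ 2) ^ m / (m.factorial : ℝ≥0∞)) * R ≠ ⊤ :=
    ENNReal.mul_ne_top (tsum_pow_div_factorial_ne_top
      (ENNReal.mul_ne_top enorm_ne_top (ENNReal.pow_ne_top hR))) hR
  refine ne_top_of_le_ne_top hfin ?_
  rw [← ENNReal.tsum_mul_right]
  refine ENNReal.tsum_le_tsum fun m => ?_
  simp only [enorm_mul, ENNReal.tsum_mul_left]
  rw [enorm_pow_div_factorial]
  calc _ ≤ ‖z‖ₑ ^ m / (m.factorial : ℝ≥0∞) * ((R ^ 2) ^ m * R) := by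
        gcongr
        exact tsum_enorm_cub_le a m
    _ = _ := by rw [mul_pow, ENNReal.div_eq_inv_mul, ENNReal.div_eq_inv_mul]; ring

lemma LOne.expc {a : ℤ → ℂ} (ha : LOne a) (z : ℂ) : LOne (expc z a) := by
  rw [lOne_iff]
  refine ne_top_of_le_ne_top (tsum_tsum_enorm_expc_ne_top z ha) ?_
  rw [ENNReal.tsum_comm]
  exact ENNReal.tsum_le_tsum fun l => enorm_tsum_le' _

/-- The term in brackets of one step of the integrator, on the level of Fourier coefficients. -/
def stepc (L lam τ : ℝ) (x a : ℤ → ℂ) : ℤ → ℂ :=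
  expc (I * lam * τ) a
    + (-I * lam) • bil (fun k j => phi τ (alpha L k j)) (cj a) (conv a a)
    + (-I * lam) • conv (cj a) (bil (fun k j => phi τ (beta L k j)) a a)
    - ((lam : ℂ) * τ ^ 2) • conv x (conv (cj a) (conv a a))
    - ((τ : ℂ) ^ 2 / 2) • conv x (conv x a)
    + (-I) • bil (psiI L τ) x a

variable {L : ℝ} [Fact (0 < 2 * L)]

lemma pos_L (L : ℝ) [h : Fact (0 < 2 * L)] : 0 < L := by linarith [h.out]

lemma freq_ne_zero {l : ℤ} (hl : l ≠ 0) : freq L l ≠ 0 := by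
  have := pos_L L
  unfold freq
  positivity

lemma le_abs_freq {l : ℤ} (hl : l ≠ 0) : Real.pi / L ≤ |freq L l| := by
  have hL := pos_L L
  have h1 : (1 : ℝ) ≤ |(l : ℝ)| := by exact_mod_cast Int.one_le_abs hl
  rw [freq, abs_div, abs_mul, abs_of_pos hL, abs_of_pos Real.pi_pos]
  gcongr
  nlinarith [Real.pi_pos]

lemma LOne.synth_cub {a : ℤ → ℂ} (ha : LOne a) (m : ℕ) (x : Torus L) :
    synth (DNLS.cub a m) x = ((‖synth a x‖ : ℂ) ^ 2) ^ m * synth a x := by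
  induction m with
  | zero => simp [DNLS.cub]
  | succ m ih =>
    rw [DNLS.cub, ha.cj.synth_conv (ha.conv (ha.cub m)), ha.synth_conv (ha.cub m), ih, synth_cj,
      pow_succ _ m, ← Complex.conj_mul']
    ring

namespace HasCoeff

variable {w : Torus L → ℂ} {a : ℤ → ℂ}

lemma exp_mul (hw : HasCoeff w a) (z : ℂ) :
    HasCoeff (fun x => Complex.exp (z * (‖w x‖ : ℂ) ^ 2) * w x) (expc z a) := by
  refine ⟨hw.1.expc z, ?_⟩
  filter_upwards [hw.2] with x hx
  rw [hx]
  have hs : Summable (Function.uncurry fun (l : ℤ) (m : ℕ) =>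
      z ^ m / m.factorial * cub a m l * fourier l x) := by
    refine Summable.of_norm ?_
    have h := tsum_tsum_enorm_expc_ne_top z hw.1
    rw [ENNReal.tsum_comm, ← ENNReal.tsum_prod (f := fun (l : ℤ) (m : ℕ) =>
      ‖z ^ m / m.factorial * cub a m l‖ₑ)] at h
    have h' := ENNReal.summable_toReal h
    refine h'.congr fun q => ?_
    simp [Function.uncurry, -fourier_apply, norm_fourier_apply]
  have h1 : synth (expc z a) x =
      ∑' (l : ℤ) (m : ℕ), z ^ m / m.factorial * cub a m l * fourier l x := by
    simp only [synth, expc, ← tsum_mul_right]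
  -- Summing over l first turns each convolution power into a power of function values; the
  -- remaining sum over m is the exponential series.
  rw [h1, ← hs.tsum_comm]
  have h2 : ∀ m : ℕ, ∑' l : ℤ, z ^ m / m.factorial * cub a m l * fourier l x =
      (z * (‖synth a x‖ : ℂ) ^ 2) ^ m / m.factorial * synth a x := fun m => by
    simp only [mul_assoc, tsum_mul_left]
    have := hw.1.synth_cub m x
    rw [synth] at this
    rw [this, mul_pow]
    ring
  simp only [h2, tsum_mul_right]
  rw [Complex.exp_eq_exp_ℂ, NormedSpace.exp_eq_tsum_div]

lemma norm_sq_mul (hw : HasCoeff w a) :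
    HasCoeff (fun x => (‖w x‖ : ℂ) ^ 2 * w x) (conv (cj a) (conv a a)) :=
  (hw.conjugate.mul (hw.mul hw)).congr_ae (ae_of_all _ fun x => by
    simp only [← Complex.conj_mul']; ring)

lemma sq (hw : HasCoeff w a) : HasCoeff (fun x => w x ^ 2) (conv a a) :=
  (hw.mul hw).congr_ae (ae_of_all _ fun x => by ring)

lemma freeFlow (hw : HasCoeff w a) (t : ℝ) :
    HasCoeff (freeFlow t w) fun l => Complex.exp (-I * t * freq L l ^ 2) * a l := by
  have h : ∀ l : ℤ, Complex.exp (I * t * (I * freq L l) ^ 2) =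
      Complex.exp (-I * t * freq L l ^ 2) := fun l => by
    congr 1
    rw [mul_pow, Complex.I_sq]
    ring
  refine (hw.multiplier (C := 1) fun l => ?_).congr fun l => by rw [h]
  rw [h, show -I * (t : ℂ) * freq L l ^ 2 = I * t * ((-(freq L l) ^ 2 : ℝ) : ℂ) by push_cast; ring,
    norm_exp_I_mul]

/-- The nonzero frequencies stay at distance π/L from 0, and the zero mode is dropped by 0⁻¹ = 0. -/
lemma norm_inv_freq_le (l : ℤ) : ‖(I * (freq L l : ℂ))⁻¹‖ ≤ L / Real.pi := by
  have hL := pos_L L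
  by_cases hl : l = 0
  · subst hl
    simp only [freq_zero, Complex.ofReal_zero, mul_zero, inv_zero, norm_zero]
    positivity
  · rw [norm_inv, norm_mul, Complex.norm_I, one_mul, Complex.norm_real, Real.norm_eq_abs,
      ← inv_div]
    exact inv_anti₀ (by positivity) (le_abs_freq hl)

lemma invDeriv (hw : HasCoeff w a) :
    HasCoeff (invDeriv w) fun l => (I * (freq L l : ℂ))⁻¹ * a l :=
  hw.multiplier (σ := fun d => d⁻¹) norm_inv_freq_le

lemma sinFilter (hw : HasCoeff w a) (τ : ℝ) :
    HasCoeff (sinFilter τ w) fun l => (Real.sin (τ * freq L l) : ℂ) * a l := by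
  have h : ∀ l : ℤ, Complex.sin (-I * τ * (I * freq L l)) = (Real.sin (τ * freq L l) : ℂ) :=
    fun l => by
      push_cast
      congr 1
      linear_combination (-(τ : ℂ) * freq L l) * Complex.I_sq
  refine (hw.multiplier (C := 1) fun l => ?_).congr fun l => by rw [h]
  rw [h, Complex.norm_real]
  exact Real.abs_sin_le_one _

lemma mean_eq (hw : HasCoeff w a) : mean w = a 0 := by rw [mean, hw.fourierCoeff_eq]

end HasCoeff

end

/-! ### The integrator as multilinear operators: resonant phases of J₁, J₂ and the potentials. -/

section

variable {L : ℝ} [Fact (0 < 2 * L)]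

lemma conv_mul_mul (m m' a b : ℤ → ℂ) :
    conv (fun l => m l * a l) (fun l => m' l * b l) = bil (fun k j => m k * m' j) a b := by
  funext l
  exact tsum_congr fun k => by ring

lemma conv_mul_left (m a b : ℤ → ℂ) :
    conv (fun l => m l * a l) b = bil (fun k _ => m k) a b := by
  funext l
  exact tsum_congr fun k => by ring

lemma mul_bil (m : ℤ → ℂ) (σ : ℤ → ℤ → ℂ) (a b : ℤ → ℂ) (l : ℤ) :
    m l * bil σ a b l = bil (fun k j => m (k + j) * σ k j) a b l := by
  unfold bil
  rw [← tsum_mul_left]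
  exact tsum_congr fun k => by simp only [add_sub_cancel]; ring

/-- Writes a product with the mean as a bilinear operator, so that the mean corrections in the
integrator merge with the nonresonant symbols. -/
lemma bil_single (a b : ℤ → ℂ) (l : ℤ) :
    bil (fun k _ => if k = 0 then 1 else 0) a b l = a 0 * b l := by
  unfold bil
  rw [tsum_eq_single 0]
  · simp
  · intro k hk; simp [hk]

lemma BilSummable.sub {σ σ' : ℤ → ℤ → ℂ} {a b : ℤ → ℂ} {l : ℤ} (h : BilSummable σ a b l)
    (h' : BilSummable σ' a b l) : BilSummable (fun k j => σ k j - σ' k j) a b l :=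
  (Summable.sub h h').congr fun k => by ring

lemma BilSummable.const_mul {σ : ℤ → ℤ → ℂ} {a b : ℤ → ℂ} {l : ℤ} (h : BilSummable σ a b l)
    (c : ℂ) : BilSummable (fun k j => c * σ k j) a b l :=
  (Summable.mul_left c h).congr fun k => by ring

lemma norm_exp_neg_I_mul_sq (t : ℝ) (y : ℝ) : ‖Complex.exp (-I * t * (y : ℂ) ^ 2)‖ = 1 := by
  rw [show -I * (t : ℂ) * (y : ℂ) ^ 2 = I * t * ((-y ^ 2 : ℝ) : ℂ) by push_cast; ring,
    norm_exp_I_mul]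

lemma bil_congr {σ σ' : ℤ → ℤ → ℂ} {a b : ℤ → ℂ} {l : ℤ}
    (h : ∀ k, σ k (l - k) = σ' k (l - k)) : bil σ a b l = bil σ' a b l :=
  tsum_congr fun k => by rw [h]

/-- Resonant symbols of the form `(exp(iτy) - 1) / (iy)` arise from `∂ₓ⁻¹` on each side. -/
lemma half_mul_symbol (lam τ μ ν : ℝ) (hμ : μ ≠ 0) (hν : ν ≠ 0) :
    (lam : ℂ) / 2 * ((I * μ)⁻¹ * (I * ν)⁻¹ * (Complex.exp (I * τ * (2 * μ * ν : ℝ)) - 1)) =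
      -I * lam * phi τ (2 * μ * ν) := by
  have h1 : (μ : ℂ) ≠ 0 := by exact_mod_cast hμ
  have h2 : (ν : ℂ) ≠ 0 := by exact_mod_cast hν
  rw [phi_of_ne τ (by positivity)]
  push_cast
  have hI : I ^ 2 = -1 := Complex.I_sq
  field_simp
  ring_nf
  rw [hI]
  ring

namespace HasCoeff

variable {w : Torus L → ℂ} {a : ℤ → ℂ}

lemma norm_inv_freq_mul_le (k j : ℤ) :
    ‖(I * (freq L k : ℂ))⁻¹‖ * ‖(I * (freq L j : ℂ))⁻¹‖ ≤ L / Real.pi * (L / Real.pi) :=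
  mul_le_mul (norm_inv_freq_le k) (norm_inv_freq_le j) (norm_nonneg _)
    ((norm_nonneg _).trans (norm_inv_freq_le 0))

/-- For l = k + j one has 2μ_kμ_l = μ_l² + μ_k² - μ_j², so the exponential of the phase factors into
free flows, and dividing by the phase is two applications of ∂ₓ⁻¹. The resonances k = 0 and l = 0,
where the integral is τ, give the terms with means. -/
lemma J₁ (hw : HasCoeff w a) (lam τ : ℝ) : HasCoeff (J₁ lam τ w)
    ((-I * lam) • bil (fun k j => phi τ (alpha L k j)) (cj a) (conv a a)) := by
  have hc := hw.conjugate
  have h1 := ((hc.invDeriv.freeFlow (-τ)).mul (hw.sq.freeFlow τ)).invDeriv.freeFlow (-τ)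
  have h2 := (hc.invDeriv.mul hw.sq).invDeriv
  have h3 := (hw.sq.sub (const (mean fun z => w z ^ 2))).const_mul (mean fun z => conj (w z))
  have h4 := h3.add (const (mean fun z => (‖w z‖ : ℂ) ^ 2 * w z))
  have h5 := ((h1.sub h2).const_mul (lam / 2 : ℂ)).sub (h4.const_mul (I * lam * τ))
  refine h5.congr fun l => ?_
  rw [hc.mean_eq, hw.sq.mean_eq, hw.norm_sq_mul.mean_eq]
  simp only [Pi.sub_apply, Pi.smul_apply, Pi.add_apply, smul_eq_mul]
  -- At l = 0 the phase vanishes for every k, so the sum is τ times the mean of |w|²w.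
  by_cases hl : l = 0
  · subst hl
    simp only [freq_zero, Complex.ofReal_zero, mul_zero, inv_zero, zero_mul,
      Pi.single_eq_same, sub_self, zero_add, zero_sub]
    rw [bil_congr (σ' := fun k j => (τ : ℂ) * 1), bil_smul_symbol, conv]
    · ring
    · intro k
      rw [alpha, ← freq_add, add_sub_cancel, freq_zero, mul_zero, phi_zero, mul_one]
  · simp only [Pi.single_eq_of_ne hl, sub_zero, add_zero]
    have hs1 : BilSummable (fun k j => Complex.exp (-I * ((-τ : ℝ) : ℂ) * freq L (k + j) ^ 2) *
        (I * (freq L (k + j) : ℂ))⁻¹ * (Complex.exp (-I * ((-τ : ℝ) : ℂ) * freq L k ^ 2) *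
        (I * (freq L k : ℂ))⁻¹ * Complex.exp (-I * τ * freq L j ^ 2))) (cj a) (conv a a) l := by
      refine hc.1.bilSummable (C := L / Real.pi * (L / Real.pi)) (fun k j => ?_)
        (hw.1.conv hw.1) l
      simp only [norm_mul, norm_exp_neg_I_mul_sq, one_mul, mul_one]
      exact norm_inv_freq_mul_le _ _
    have hs2 : BilSummable (fun k j => (I * (freq L (k + j) : ℂ))⁻¹ * (I * (freq L k : ℂ))⁻¹)
        (cj a) (conv a a) l := by
      refine hc.1.bilSummable (C := L / Real.pi * (L / Real.pi)) (fun k j => ?_)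
        (hw.1.conv hw.1) l
      rw [norm_mul]
      exact norm_inv_freq_mul_le _ _
    have hs3 : BilSummable (fun k _ => if k = 0 then 1 else 0) (cj a) (conv a a) l := by
      refine hc.1.bilSummable (C := 1) (fun k j => ?_) (hw.1.conv hw.1) l
      split_ifs <;> simp
    have e1 : ∀ k : ℤ, (fun l => Complex.exp (-I * ((-τ : ℝ) : ℂ) * freq L l ^ 2) *
        ((I * (freq L l : ℂ))⁻¹ * cj a l)) k = (fun l => Complex.exp (-I * ((-τ : ℝ) : ℂ) *
        freq L l ^ 2) * (I * (freq L l : ℂ))⁻¹) k * cj a k := fun k => by ring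
    rw [funext e1, conv_mul_mul, conv_mul_left, ← mul_assoc, mul_bil (fun l =>
      Complex.exp (-I * ((-τ : ℝ) : ℂ) * freq L l ^ 2) * (I * (freq L l : ℂ))⁻¹),
      mul_bil (fun l => (I * (freq L l : ℂ))⁻¹), ← bil_single (cj a), ← bil_sub_symbol hs1 hs2,
      ← bil_smul_symbol, ← bil_smul_symbol,
      ← bil_sub_symbol ((hs1.sub hs2).const_mul _) (hs3.const_mul _), ← bil_smul_symbol]
    · refine bil_congr fun k => ?_
      by_cases hk : k = 0
      · subst hk
        simp [alpha, phi_zero]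
      · have hk' := freq_ne_zero (L := L) hk
        have hl' := freq_ne_zero (L := L) hl
        simp only [hk, if_false, mul_zero, sub_zero]
        rw [alpha, ← freq_add, add_sub_cancel, ← half_mul_symbol _ _ _ _ hk' hl']
        have h6 : Complex.exp (I * τ * (2 * freq L k * freq L l : ℝ)) =
            Complex.exp (-I * ((-τ : ℝ) : ℂ) * freq L l ^ 2) *
            Complex.exp (-I * ((-τ : ℝ) : ℂ) * freq L k ^ 2) *
            Complex.exp (-I * τ * freq L (l - k) ^ 2) := by
          rw [← Complex.exp_add, ← Complex.exp_add]
          congr 1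
          rw [sub_eq_add_neg, freq_add, freq_neg]
          push_cast
          ring
        rw [h6]
        ring

/-- Here the phase is 2μ_kμ_j = μ_l² - μ_k² - μ_j² with l = k + j. Its resonances are k = 0 and j =
0. -/
lemma J₂ (hw : HasCoeff w a) (lam τ : ℝ) : HasCoeff (J₂ lam τ w)
    ((-I * lam) • conv (cj a) (bil (fun k j => phi τ (beta L k j)) a a)) := by
  have h1 := (hw.freeFlow τ).invDeriv.sq.freeFlow (-τ)
  have h2 := ((h1.sub hw.invDeriv.sq).const_mul (lam / 2 : ℂ)).sub
    ((((hw.const_mul 2).sub (const (mean w))).const_mul (mean w)).const_mul (I * lam * τ))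
  have h3 := hw.conjugate.mul h2
  have key : (lam / 2 : ℂ) • ((fun l => Complex.exp (-I * ((-τ : ℝ) : ℂ) * freq L l ^ 2) *
      conv (fun l => (I * (freq L l : ℂ))⁻¹ * (Complex.exp (-I * τ * freq L l ^ 2) * a l))
        (fun l => (I * (freq L l : ℂ))⁻¹ * (Complex.exp (-I * τ * freq L l ^ 2) * a l)) l) -
      conv (fun l => (I * (freq L l : ℂ))⁻¹ * a l) (fun l => (I * (freq L l : ℂ))⁻¹ * a l)) -
      (I * lam * τ) • mean w • ((2 : ℂ) • a - Pi.single 0 (mean w)) =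
      (-I * lam) • bil (fun k j => phi τ (beta L k j)) a a := by
    funext l
    rw [hw.mean_eq]
    simp only [Pi.sub_apply, Pi.smul_apply, smul_eq_mul]
    have e1 : ∀ k : ℤ, (fun l => (I * (freq L l : ℂ))⁻¹ * (Complex.exp (-I * τ * freq L l ^ 2) *
        a l)) k = (fun l => (I * (freq L l : ℂ))⁻¹ * Complex.exp (-I * τ * freq L l ^ 2)) k * a k :=
      fun k => by ring
    -- Inclusion–exclusion: the pair k = j = 0 belongs to both resonant lines and must be counted
    -- once.
    have e2 : a 0 * (2 * a l - (Pi.single 0 (a 0) : ℤ → ℂ) l) =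
        bil (fun k j => (if k = 0 then 1 else 0) + if j = 0 then (if k = 0 then 0 else 1) else 0)
          a a l := by
      have hs : ∀ σ : ℤ → ℤ → ℂ, (∀ k j, ‖σ k j‖ ≤ 1) → BilSummable σ a a l :=
        fun σ hσ => hw.1.bilSummable hσ hw.1 l
      rw [bil_add_symbol (hs _ fun k j => by split_ifs <;> simp)
        (hs _ fun k j => by split_ifs <;> simp), bil_single, bil, tsum_eq_single l]
      · by_cases hl : l = 0
        · subst hl; simp [two_mul]
        · simp [hl]; ring
      · intro k hk
        simp [sub_eq_zero, hk.symm]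
    have hs1 : BilSummable (fun k j => Complex.exp (-I * ((-τ : ℝ) : ℂ) * freq L (k + j) ^ 2) *
        ((I * (freq L k : ℂ))⁻¹ * Complex.exp (-I * τ * freq L k ^ 2) *
        ((I * (freq L j : ℂ))⁻¹ * Complex.exp (-I * τ * freq L j ^ 2)))) a a l := by
      refine hw.1.bilSummable (C := L / Real.pi * (L / Real.pi)) (fun k j => ?_) hw.1 l
      simp only [norm_mul, norm_exp_neg_I_mul_sq, one_mul, mul_one]
      exact norm_inv_freq_mul_le _ _
    have hs2 : BilSummable (fun k j => (I * (freq L k : ℂ))⁻¹ * (I * (freq L j : ℂ))⁻¹)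
        a a l := by
      refine hw.1.bilSummable (C := L / Real.pi * (L / Real.pi)) (fun k j => ?_) hw.1 l
      rw [norm_mul]
      exact norm_inv_freq_mul_le _ _
    have hs3 : BilSummable (fun k j => (if k = 0 then 1 else 0) +
        if j = 0 then (if k = 0 then 0 else 1) else 0) a a l := by
      refine hw.1.bilSummable (C := 1) (fun k j => ?_) hw.1 l
      split_ifs <;> simp
    rw [funext e1, conv_mul_mul, conv_mul_mul, mul_bil (fun l =>
      Complex.exp (-I * ((-τ : ℝ) : ℂ) * freq L l ^ 2)), e2, ← bil_sub_symbol hs1 hs2,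
      ← bil_smul_symbol, ← bil_smul_symbol,
      ← bil_sub_symbol ((hs1.sub hs2).const_mul _) (hs3.const_mul _), ← bil_smul_symbol]
    · refine bil_congr fun k => ?_
      generalize l - k = j
      by_cases hk : k = 0
      · subst hk
        simp [beta, phi_zero]
      by_cases hj : j = 0
      · subst hj
        simp [beta, phi_zero, hk]
      · have hk' := freq_ne_zero (L := L) hk
        have hj' := freq_ne_zero (L := L) hj
        simp only [hk, hj, if_false, add_zero, mul_zero, sub_zero]
        rw [beta, ← half_mul_symbol _ _ _ _ hk' hj']
        have h6 : Complex.exp (I * τ * (2 * freq L k * freq L j : ℝ)) =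
            Complex.exp (-I * ((-τ : ℝ) : ℂ) * freq L (k + j) ^ 2) *
            Complex.exp (-I * τ * freq L k ^ 2) *
            Complex.exp (-I * τ * freq L j ^ 2) := by
          rw [← Complex.exp_add, ← Complex.exp_add]
          congr 1
          rw [freq_add]
          push_cast
          ring
        rw [h6]
        ring
  rw [key] at h3
  rw [conv, bil_smul_right] at h3
  refine h3.congr_ae (ae_of_all _ fun x => ?_)
  simp only [DNLS.J₂]
  ring

/-- The `if` is the mode dropped by the convention a / 0 = 0; the term -iτ ξ̂₀ of the step puts it
back. -/
lemma potential₁_symbol (τ : ℝ) (l : ℤ) :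
    (Complex.exp (-I * τ * (I * freq L l) ^ 2) - 1) / (I * freq L l) ^ 2 =
      -I * (phi τ (freq L l ^ 2) - if l = 0 then (τ : ℂ) else 0) := by
  by_cases hl : l = 0
  · subst hl; simp [phi_zero]
  · have h := freq_ne_zero (L := L) hl
    have h' : (freq L l : ℂ) ≠ 0 := by exact_mod_cast h
    rw [phi_of_ne τ (pow_ne_zero 2 h), if_neg hl, mul_pow, Complex.I_sq, sub_zero]
    push_cast
    rw [show -I * (τ : ℂ) * (-1 * freq L l ^ 2) = I * τ * freq L l ^ 2 by ring]
    field_simp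

/-- No zero-mode correction arises, because of the factor μ_l on the right. -/
lemma potential₂_symbol {τ : ℝ} (hτ : τ ≠ 0) (l : ℤ) :
    (Complex.exp (-I * τ * (I * freq L l) ^ 2) * (I - τ * (I * freq L l) ^ 2) - I) /
      (τ * (I * freq L l) ^ 3) = -(freq L l / τ * phi' τ (freq L l ^ 2)) := by
  by_cases hl : l = 0
  · subst hl; simp
  · have h := freq_ne_zero (L := L) hl
    have h' : (freq L l : ℂ) ≠ 0 := by exact_mod_cast h
    have hτ' : (τ : ℂ) ≠ 0 := by exact_mod_cast hτ
    rw [phi'_of_ne τ (pow_ne_zero 2 h), mul_pow, mul_pow, Complex.I_sq, Complex.I_pow_three]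
    push_cast
    rw [show -I * (τ : ℂ) * (-1 * freq L l ^ 2) = I * τ * freq L l ^ 2 by ring]
    field_simp
    ring_nf

/-- The closed form of `phi'` decays in the frequency. The bound degenerates once divided by τ,
which is harmless since it only serves summability at fixed τ. -/
lemma norm_freq_mul_phi'_le {τ : ℝ} (hτ : 0 ≤ τ) (l : ℤ) :
    ‖(freq L l : ℂ) * phi' τ (freq L l ^ 2)‖ ≤ τ * (L / Real.pi) + 2 * (L / Real.pi) ^ 3 := by
  have hL := pos_L L
  by_cases hl : l = 0
  · subst hl
    simp only [freq_zero, Complex.ofReal_zero, zero_mul, norm_zero]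
    positivity
  have h := freq_ne_zero (L := L) hl
  have hi : |freq L l|⁻¹ ≤ L / Real.pi := by
    have := norm_inv_freq_le (L := L) l
    rwa [norm_inv, norm_mul, Complex.norm_I, one_mul, Complex.norm_real, Real.norm_eq_abs] at this
  have hE := norm_exp_I_mul τ (freq L l ^ 2)
  have hE1 : ‖Complex.exp (I * τ * (freq L l ^ 2 : ℝ)) - 1‖ ≤ 2 :=
    (norm_sub_le _ _).trans (by rw [hE, norm_one]; norm_num)
  rw [phi'_of_ne τ (pow_ne_zero 2 h), norm_mul, Complex.norm_real, Real.norm_eq_abs]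
  have hpos : 0 < |freq L l| := abs_pos.mpr h
  calc |freq L l| * _ ≤ |freq L l| * (τ * 1 / |freq L l| ^ 2 + 2 / (|freq L l| ^ 2) ^ 2) := by
        gcongr
        refine (norm_add_le _ _).trans ?_
        rw [norm_div, norm_div, norm_mul, norm_mul, norm_pow, hE]
        simp only [Complex.norm_real, norm_pow, Real.norm_eq_abs, abs_of_nonneg hτ,
          Complex.norm_I, one_mul]
        gcongr
    _ = τ * |freq L l|⁻¹ + 2 * |freq L l|⁻¹ ^ 3 := by field_simp
    _ ≤ _ := by gcongr

/-- One step of the integrator on the level of Fourier coefficients. -/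
lemma lriStep {ξ : Torus L → ℝ} {x : ℤ → ℂ} (hw : HasCoeff w a)
    (hξ : HasCoeff (fun y => (ξ y : ℂ)) x) (lam : ℝ) {τ : ℝ} (hτ : 0 < τ) :
    HasCoeff (lriStep lam ξ τ w)
      fun l => Complex.exp (-I * τ * freq L l ^ 2) * stepc L lam τ x a l := by
  refine freeFlow ?_ τ
  have hp1 : HasCoeff (potential₁ τ ξ) _ := hξ.multiplier (C := τ + τ) fun l => by
    rw [potential₁_symbol, norm_mul, norm_neg, Complex.norm_I, one_mul]
    refine (norm_sub_le _ _).trans (add_le_add (norm_phi_le hτ.le _) ?_)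
    split_ifs
    · simp [abs_of_pos hτ]
    · simpa using hτ.le
  have hp2 : HasCoeff (potential₂ τ ξ) _ := hξ.multiplier
      (C := τ⁻¹ * (τ * (L / Real.pi) + 2 * (L / Real.pi) ^ 3)) fun l => by
    rw [potential₂_symbol hτ.ne', norm_neg, div_mul_eq_mul_div, div_eq_inv_mul, norm_mul]
    gcongr
    · simp [abs_of_pos hτ]
    · exact norm_freq_mul_phi'_le hτ.le l
  have h1 := (((hw.exp_mul (I * lam * τ)).add (hw.J₁ lam τ)).add (hw.J₂ lam τ)).sub
    ((hξ.mul hw.norm_sq_mul).const_mul (lam * τ ^ 2 : ℂ))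
  have h2 := ((h1.sub ((hξ.mul (hξ.mul hw)).const_mul (τ ^ 2 / 2 : ℂ))).add (hp1.mul hw)).sub
    ((hp2.mul (hw.sinFilter τ)).const_mul 2)
  have h3 := h2.sub (hw.const_mul (I * τ * mean (fun y => (ξ y : ℂ))))
  refine (h3.congr_ae (ae_of_all _ fun y => ?_)).congr fun l => ?_
  · ring
  · simp only [stepc, Pi.add_apply, Pi.sub_apply, Pi.smul_apply, smul_eq_mul]
    -- The three potential terms recombine into the integral of `psi` as split in `psiI_eq`: ξ₁ and
    -- the mean give the `phi` part, ξ₂ with the sine filter gives the `phi'` part.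
    have key : conv (fun l => (Complex.exp (-I * τ * (I * freq L l) ^ 2) - 1) /
          (I * freq L l) ^ 2 * x l) a l - 2 * conv (fun l => (Complex.exp (-I * τ *
          (I * freq L l) ^ 2) * (I - τ * (I * freq L l) ^ 2) - I) / (τ * (I * freq L l) ^ 3) *
          x l) (fun l => (Real.sin (τ * freq L l) : ℂ) * a l) l
          - I * τ * mean (fun y => (ξ y : ℂ)) * a l = -I * bil (psiI L τ) x a l := by
      simp only [potential₁_symbol, potential₂_symbol hτ.ne']
      have hs1 : BilSummable (fun k (_ : ℤ) => -I * (phi τ (freq L k ^ 2) -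
          if k = 0 then (τ : ℂ) else 0)) x a l := by
        refine hξ.1.bilSummable (C := τ + τ) (fun k j => ?_) hw.1 l
        rw [norm_mul, norm_neg, Complex.norm_I, one_mul]
        refine (norm_sub_le _ _).trans (add_le_add (norm_phi_le hτ.le _) ?_)
        split_ifs
        · simp [abs_of_pos hτ]
        · simpa using hτ.le
      have hs3 : BilSummable (fun k (_ : ℤ) => if k = 0 then 1 else 0) x a l := by
        refine hξ.1.bilSummable (C := 1) (fun k j => ?_) hw.1 l
        split_ifs <;> simp
      have hs2 : BilSummable (fun k j => -(freq L k / τ * phi' τ (freq L k ^ 2)) *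
          (Real.sin (τ * freq L j) : ℂ)) x a l := by
        refine hξ.1.bilSummable (C := τ⁻¹ * (τ * (L / Real.pi) + 2 * (L / Real.pi) ^ 3) * 1)
          (fun k j => ?_) hw.1 l
        rw [norm_mul, norm_neg, div_mul_eq_mul_div, div_eq_inv_mul, norm_mul]
        have hL := pos_L L
        gcongr
        · simp [abs_of_pos hτ]
        · exact norm_freq_mul_phi'_le hτ.le k
        · rw [Complex.norm_real]
          exact Real.abs_sin_le_one _
      rw [conv_mul_left, conv_mul_mul, hξ.mean_eq, mul_assoc (I * τ), ← bil_single x a,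
        ← bil_smul_symbol, ← bil_smul_symbol, ← bil_sub_symbol hs1 (hs2.const_mul _),
        ← bil_sub_symbol (hs1.sub (hs2.const_mul _)) (hs3.const_mul _), ← bil_smul_symbol]
      refine bil_congr fun k => ?_
      rw [psiI_eq]
      by_cases hk : k = 0
      · subst hk
        simp
        ring
      · simp only [hk, if_false]
        linear_combination ((2 * freq L k * Real.sin (τ * freq L (l - k)) / τ *
          phi' τ (freq L k ^ 2)) : ℂ) * Complex.I_sq
    rw [← key]
    ring

end HasCoeff

end

section

/-! ### A Gronwall inequality for weighted sums of modes -/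

lemma sq_lintegral_Ioc_le {t : ℝ} {f : ℝ → ℝ≥0∞}
    (hf : AEMeasurable f (volume.restrict (Ioc 0 t))) :
    (∫⁻ s in Ioc 0 t, f s) ^ 2 ≤ ENNReal.ofReal t * ∫⁻ s in Ioc 0 t, f s ^ 2 := by
  have h := ENNReal.lintegral_mul_le_Lp_mul_Lq (volume.restrict (Ioc 0 t))
    Real.HolderConjugate.two_two (aemeasurable_const (b := (1 : ℝ≥0∞))) hf
  simp only [Pi.mul_apply, one_mul, ENNReal.rpow_two, one_pow, lintegral_const,
    Measure.restrict_apply MeasurableSet.univ, univ_inter, Real.volume_Ioc, sub_zero] at h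
  calc _ ≤ _ := pow_le_pow_left' h 2
    _ = _ := by
      rw [mul_pow, ← ENNReal.rpow_two, ← ENNReal.rpow_two, ← ENNReal.rpow_mul, ← ENNReal.rpow_mul]
      norm_num

lemma lintegral_exp_Ioc_le {K t : ℝ} (hK : 0 < K) (ht : 0 ≤ t) :
    ∫⁻ s in Ioc 0 t, ENNReal.ofReal (Real.exp (K * s)) ≤
      ENNReal.ofReal (Real.exp (K * t) / K) := by
  rw [← ofReal_integral_eq_lintegral_ofReal]
  · refine ENNReal.ofReal_le_ofReal ?_
    rw [← intervalIntegral.integral_of_le ht, intervalIntegral.integral_comp_mul_left (fun x => Real.exp x) hK.ne',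
      integral_exp]
    simp only [mul_zero, Real.exp_zero, smul_eq_mul]
    rw [inv_mul_eq_div]
    gcongr
    linarith
  · exact (Continuous.integrableOn_Ioc (by fun_prop))
  · exact ae_of_all _ fun s => (Real.exp_pos _).le

/-- Cauchy–Schwarz in time for each mode, then exchange of sum and integral. -/
lemma n2_lintegral_le {q : ℤ → ℝ≥0∞} {t T : ℝ} (ht : t ≤ T) {F : ℝ → ℤ → ℝ≥0∞}
    (hF : ∀ l, AEMeasurable (fun s => F s l) (volume.restrict (Ioc 0 t))) :
    n2 q (fun l => ∫⁻ s in Ioc 0 t, F s l) ≤ ENNReal.ofReal T * ∫⁻ s in Ioc 0 t, n2 q (F s) := by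
  unfold n2
  rw [lintegral_tsum (fun l => ((hF l).const_mul _).pow_const _), ← ENNReal.tsum_mul_left]
  refine ENNReal.tsum_le_tsum fun l => ?_
  simp only [mul_pow]
  rw [lintegral_const_mul'' _ ((hF l).pow_const 2)]
  calc q l ^ 2 * (∫⁻ s in Ioc 0 t, F s l) ^ 2
      ≤ q l ^ 2 * (ENNReal.ofReal T * ∫⁻ s in Ioc 0 t, F s l ^ 2) := by
        gcongr
        refine (sq_lintegral_Ioc_le (hF l)).trans ?_
        gcongr
    _ = _ := by ring

/-- Works with the supremum of the norm divided by e^{Kt}, so neither measurability nor continuity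
of the norm in time is required. The a priori bound Y only makes this supremum finite, so that half
of it can be absorbed; Y is absent from the conclusion, which is what permits Gronwall for truncated
weights. -/
lemma gronwall_modes {T : ℝ} (hT : 0 < T) {q a₀ : ℤ → ℝ≥0∞} {a F : ℝ → ℤ → ℝ≥0∞} {C D Y : ℝ≥0∞}
    (hC : C ≠ ⊤) (hY : Y ≠ ⊤)
    (hF : ∀ l, AEMeasurable (fun s => F s l) (volume.restrict (Ioc 0 T)))
    (ha : ∀ t ∈ Icc 0 T, ∀ l, a t l ≤ a₀ l + ∫⁻ s in Ioc 0 t, F s l)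
    (hb : ∀ t ∈ Icc 0 T, n2 q (a t) ≤ Y)
    (hFa : ∀ t ∈ Icc 0 T, n2 q (F t) ≤ C * (n2 q (a t) + D)) :
    ∀ t ∈ Icc 0 T, n2 q (a t) ≤ 2 * (2 * n2 q a₀ + 2 * ENNReal.ofReal T ^ 2 * C * D) *
      ENNReal.ofReal (Real.exp ((4 * T * C.toReal + 1) * T)) := by
  -- Chosen so that 2TC/K ≤ 1/2; the +1 keeps K positive when C = 0.
  set K : ℝ := 4 * T * C.toReal + 1 with hKdef
  have hK : 0 < K := by positivity
  set e : ℝ → ℝ≥0∞ := fun t => ENNReal.ofReal (Real.exp (K * t)) with he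
  have he0 : ∀ t, e t ≠ 0 := fun t => (ENNReal.ofReal_pos.mpr (Real.exp_pos _)).ne'
  have het : ∀ t, e t ≠ ⊤ := fun t => ENNReal.ofReal_ne_top
  set S : ℝ≥0∞ := ⨆ t ∈ Icc 0 T, n2 q (a t) / e t with hS
  have hSt : S ≠ ⊤ := by
    refine ne_top_of_le_ne_top hY (iSup₂_le fun t ht => ?_)
    refine (ENNReal.div_le_of_le_mul ?_)
    calc n2 q (a t) ≤ Y := hb t ht
      _ = Y * 1 := (mul_one _).symm
      _ ≤ Y * e t := by
        gcongr
        rw [he, ← ENNReal.ofReal_one]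
        exact ENNReal.ofReal_le_ofReal (Real.one_le_exp (mul_nonneg hK.le ht.1))
  have hy : ∀ t ∈ Icc 0 T, n2 q (a t) ≤ S * e t := fun t ht =>
    (ENNReal.div_le_iff_le_mul (Or.inl (he0 t)) (Or.inl (het t))).mp
      (le_iSup₂ (f := fun t (_ : t ∈ Icc 0 T) => n2 q (a t) / e t) t ht)
  set A' : ℝ≥0∞ := 2 * n2 q a₀ + 2 * ENNReal.ofReal T ^ 2 * C * D with hA'
  have key : ∀ t ∈ Icc 0 T, n2 q (a t) ≤ A' + S / 2 * e t := by
    intro t ht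
    have hFt : ∀ l, AEMeasurable (fun s => F s l) (volume.restrict (Ioc 0 t)) := fun l =>
      (hF l).mono_measure (Measure.restrict_mono (Ioc_subset_Ioc_right ht.2) le_rfl)
    have h1 : n2 q (a t) ≤ 2 * n2 q a₀ + 2 * n2 q (fun l => ∫⁻ s in Ioc 0 t, F s l) :=
      (n2_mono (ha t ht)).trans (n2_add_le _ _ _)
    have h2 := (n2_lintegral_le (q := q) ht.2 hFt)
    have h3 : ∫⁻ s in Ioc 0 t, n2 q (F s) ≤
        C * (S * (ENNReal.ofReal (Real.exp (K * t) / K)) + D * ENNReal.ofReal T) := by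
      calc ∫⁻ s in Ioc 0 t, n2 q (F s) ≤ ∫⁻ s in Ioc 0 t, C * (S * e s + D) := by
            refine setLIntegral_mono (by fun_prop) fun s hs => ?_
            have hs' : s ∈ Icc 0 T := ⟨hs.1.le, hs.2.trans ht.2⟩
            refine (hFa s hs').trans ?_
            gcongr
            exact hy s hs'
        _ = C * (S * (∫⁻ s in Ioc 0 t, e s) + D * ENNReal.ofReal t) := by
            rw [lintegral_const_mul _ (by fun_prop), lintegral_add_left (by fun_prop),
              lintegral_const_mul _ (by fun_prop)]
            simp
        _ ≤ _ := by
            gcongr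
            · exact lintegral_exp_Ioc_le hK ht.1
            · exact ht.2
    have h4 : 2 * (ENNReal.ofReal T * (C * (S * ENNReal.ofReal (Real.exp (K * t) / K)))) ≤
        S / 2 * e t := by
      have : 2 * ENNReal.ofReal T * C * ENNReal.ofReal (Real.exp (K * t) / K) ≤
          2⁻¹ * e t := by
        rw [← ENNReal.ofReal_toReal hC]
        rw [show (2 : ℝ≥0∞) = ENNReal.ofReal 2 by simp,
          ← ENNReal.ofReal_inv_of_pos (by norm_num), ← ENNReal.ofReal_mul (by norm_num),
          ← ENNReal.ofReal_mul (by positivity), ← ENNReal.ofReal_mul (by positivity),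
          ← ENNReal.ofReal_mul (by positivity)]
        refine ENNReal.ofReal_le_ofReal ?_
        rw [mul_div_assoc', div_le_iff₀ hK, hKdef]
        have := Real.exp_pos ((4 * T * C.toReal + 1) * t)
        nlinarith
      calc _ = S * (2 * ENNReal.ofReal T * C * ENNReal.ofReal (Real.exp (K * t) / K)) := by ring
        _ ≤ S * (2⁻¹ * e t) := by gcongr
        _ = _ := by rw [ENNReal.div_eq_inv_mul]; ring
    calc n2 q (a t) ≤ 2 * n2 q a₀ + 2 * (ENNReal.ofReal T * (C * (S * (ENNReal.ofReal
          (Real.exp (K * t) / K)) + D * ENNReal.ofReal T))) :=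
          h1.trans (by gcongr; exact h2.trans (by gcongr))
      _ = A' + 2 * (ENNReal.ofReal T * (C * (S * ENNReal.ofReal (Real.exp (K * t) / K)))) := by
          rw [hA']; ring
      _ ≤ _ := by gcongr
  have hSle : S ≤ A' + S / 2 := by
    refine iSup₂_le fun t ht => ENNReal.div_le_of_le_mul ((key t ht).trans ?_)
    rw [add_mul]
    gcongr
    have : 1 ≤ e t := by
      rw [he, ← ENNReal.ofReal_one]
      exact ENNReal.ofReal_le_ofReal (Real.one_le_exp (mul_nonneg hK.le ht.1))
    simpa using mul_le_mul' (le_refl A') this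
  have hS2 : S ≤ 2 * A' := by
    have h5 : S / 2 + S / 2 ≤ A' + S / 2 := by rwa [ENNReal.add_halves]
    -- Cancelling S/2 is where finiteness of the supremum enters.
    have h6 := (ENNReal.add_le_add_iff_right (ENNReal.div_ne_top hSt (by norm_num))).mp h5
    calc S = 2 * (S / 2) := by rw [two_mul, ENNReal.add_halves]
      _ ≤ _ := by gcongr
  intro t ht
  refine (hy t ht).trans ?_
  gcongr
  exact ENNReal.ofReal_le_ofReal (Real.exp_le_exp.mpr (by
    have := ht.2
    gcongr))

end

section

/-! ### Regularity of the solution -/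

variable {L : ℝ} [Fact (0 < 2 * L)]

/-- The right-hand side of the equation, with the potential given by its coefficients. -/
def nonl (lam : ℝ) (x : ℤ → ℂ) (v : Torus L → ℂ) (y : Torus L) : ℂ :=
  (synth x y + lam * (‖v y‖ : ℂ) ^ 2) * v y

lemma memLp_of_continuous {f : Torus L → ℂ} (hf : Continuous f) :
    MemLp f 2 AddCircle.haarAddCircle :=
  hf.memLp_of_hasCompactSupport (HasCompactSupport.of_compactSpace _)

lemma fourierCoeff_sub' {f g : Torus L → ℂ} (hf : MemLp f 2 AddCircle.haarAddCircle)
    (hg : MemLp g 2 AddCircle.haarAddCircle) (l : ℤ) :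
    fourierCoeff (f - g) l = fourierCoeff f l - fourierCoeff g l := by
  have h1 := hf.integrable one_le_two
  have h2 := hg.integrable one_le_two
  simpa [fourierCoeff, -fourier_apply, mul_sub] using
    integral_sub (h1.fourier_smul (-l)) (h2.fourier_smul (-l))

lemma fourierCoeff_translate (f : Torus L → ℂ) (h : Torus L) (l : ℤ) :
    fourierCoeff (fun y => f (y + h)) l = fourier l h * fourierCoeff f l := by
  unfold fourierCoeff
  rw [← integral_const_mul, ← integral_add_right_eq_self
    (fun y => fourier l h * fourier (-l) y • f y) h]
  refine integral_congr_ae (ae_of_all _ fun y => ?_)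
  have h1 : fourier l h * fourier (-l) (y + h) = fourier (-l) y := by
    have h2 : fourier (-l) (y + h) = fourier (-l) y * fourier (-l) h := by
      simp [fourier_apply, AddCircle.toCircle_add, smul_add]
    have h3 : fourier l h * fourier (-l) h = 1 := by
      rw [← fourier_add, add_neg_cancel, fourier_zero]
    rw [h2]
    linear_combination (fourier (-l) y) * h3
  simp only [smul_eq_mul]
  rw [← h1]
  ring

/-- The increments of `f` in `L²`, in terms of its Fourier coefficients. -/
lemma n2_translate {f : Torus L → ℂ} (hf : Continuous f) (h : Torus L) :
    n2 (fun l => ‖fourier l h - 1‖ₑ) (fun l => ‖fourierCoeff f l‖ₑ) =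
      ENNReal.ofReal (∫ y, ‖f (y + h) - f y‖ ^ 2 ∂AddCircle.haarAddCircle) := by
  have hf' : Continuous fun y => f (y + h) := by fun_prop
  have hs := hasSum_sq_fourierCoeff_of_memLp (memLp_of_continuous (hf'.sub hf))
  have he : ∀ l, fourierCoeff ((fun y => f (y + h)) - f) l =
      (fourier l h - 1) * fourierCoeff f l := fun l => by
    rw [fourierCoeff_sub' (memLp_of_continuous hf') (memLp_of_continuous hf),
      fourierCoeff_translate]
    ring
  have hs' : HasSum (fun l => ‖(fourier l h - 1) * fourierCoeff f l‖ ^ 2)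
      (∫ y, ‖f (y + h) - f y‖ ^ 2 ∂AddCircle.haarAddCircle) := by
    simp only [← he]
    exact hs
  rw [← hs'.tsum_eq, ENNReal.ofReal_tsum_of_nonneg (fun _ => by positivity) hs'.summable, n2]
  refine tsum_congr fun l => ?_
  rw [ENNReal.ofReal_pow (norm_nonneg _), ofReal_norm, enorm_mul]

section sol

variable {lam : ℝ} {ξ : Torus L → ℝ} {u₀ : Torus L → ℂ} {T : ℝ} {u : ℝ → Torus L → ℂ} {x : ℤ → ℂ}

lemma IsSolution.continuous (hu : IsSolution lam ξ u₀ T u) {t : ℝ} (ht : t ∈ Icc 0 T) :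
    Continuous (u t) := by
  have h := hu.continuousOn.comp_continuous (f := fun y : Torus L => (t, y)) (by fun_prop)
    (fun y => ⟨ht, mem_univ _⟩)
  exact h

lemma IsSolution.bounded (hu : IsSolution lam ξ u₀ T u) :
    ∃ B : ℝ, 0 ≤ B ∧ ∀ t ∈ Icc 0 T, ∀ y, ‖u t y‖ ≤ B := by
  obtain ⟨B, hB⟩ := (isCompact_Icc.prod isCompact_univ).exists_bound_of_continuousOn
    hu.continuousOn
  exact ⟨max B 0, le_max_right _ _, fun t ht y =>
    (hB (t, y) ⟨ht, mem_univ _⟩).trans (le_max_left _ _)⟩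

lemma continuous_nonl (lam : ℝ) (hx : LOne x) {v : Torus L → ℂ} (hv : Continuous v) :
    Continuous (nonl lam x v) := by
  have := hx.continuous_synth (L := L)
  unfold nonl
  fun_prop

lemma fourierCoeff_nonl (hξ : HasCoeff (fun y => (ξ y : ℂ)) x) (v : Torus L → ℂ) :
    fourierCoeff (fun y => (ξ y + lam * (‖v y‖ : ℂ) ^ 2) * v y) = fourierCoeff (nonl lam x v) := by
  refine fourierCoeff_congr_ae ?_
  filter_upwards [hξ.2] with y hy
  rw [nonl, hy]

lemma norm_synth_le (hx : LOne x) (y : Torus L) : ‖synth x y‖ ≤ ∑' l, ‖x l‖ := by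
  unfold synth
  refine (norm_tsum_le_tsum_norm (hx.summable_synth y).norm).trans (le_of_eq ?_)
  exact tsum_congr fun l => by rw [norm_mul, norm_fourier_apply, mul_one]

lemma IsSolution.continuousOn_coeff (hu : IsSolution lam ξ u₀ T u) (hx : LOne x) (l : ℤ) :
    ContinuousOn (fun s => fourierCoeff (nonl lam x (u s)) l) (Icc 0 T) := by
  obtain ⟨B, hB0, hB⟩ := hu.bounded
  unfold fourierCoeff
  refine continuousOn_of_dominated (bound := fun _ => (∑' l, ‖x l‖ + |lam| * B ^ 2) * B)
    (fun s hs => ?_) (fun s hs => ae_of_all _ fun y => ?_) (integrable_const _)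
    (ae_of_all _ fun y => ?_)
  · have := continuous_nonl lam hx (hu.continuous hs)
    exact (by fun_prop : Continuous fun y => fourier (-l) y • nonl lam x (u s) y).aestronglyMeasurable
  · rw [norm_smul, norm_fourier_apply, one_mul, nonl, norm_mul]
    have h1 := hB s hs y
    gcongr
    refine (norm_add_le _ _).trans ?_
    gcongr
    · exact norm_synth_le hx y
    · simp only [norm_mul, Complex.norm_real, norm_pow, Real.norm_eq_abs, abs_norm]
      gcongr
  · have h := hu.continuousOn.comp (f := fun s : ℝ => (s, y)) (s := Icc 0 T)
      (by fun_prop) (fun s hs => ⟨hs, mem_univ _⟩)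
    have h' : ContinuousOn (fun s => u s y) (Icc 0 T) := h
    unfold nonl
    fun_prop

/-- The free group is unimodular on each mode, so Duhamel's formula becomes an inequality without
oscillation. -/
lemma IsSolution.enorm_coeff_le (hu : IsSolution lam ξ u₀ T u)
    (hξ : HasCoeff (fun y => (ξ y : ℂ)) x) {t : ℝ} (ht : t ∈ Icc 0 T) (l : ℤ) :
    ‖fourierCoeff (u t) l‖ₑ ≤ ‖fourierCoeff u₀ l‖ₑ +
      ∫⁻ s in Ioc 0 t, ‖fourierCoeff (nonl lam x (u s)) l‖ₑ := by
  rw [hu.duhamel t ht l]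
  simp only [fourierCoeff_nonl hξ]
  have hI : ‖I‖ₑ = 1 := by rw [← ofReal_norm, Complex.norm_I, ENNReal.ofReal_one]
  refine enorm_sub_le.trans (add_le_add ?_ ?_)
  · rw [enorm_mul, ← ofReal_norm, norm_exp_neg_I_mul_sq, ENNReal.ofReal_one, one_mul]
  · rw [enorm_mul, hI, one_mul, intervalIntegral.integral_of_le ht.1]
    refine (enorm_integral_le_lintegral_enorm _).trans (le_of_eq ?_)
    congr 1
    funext s
    rw [enorm_mul, ← Complex.ofReal_sub, ← ofReal_norm (Complex.exp _), norm_exp_neg_I_mul_sq,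
      ENNReal.ofReal_one, one_mul]

lemma IsSolution.aemeasurable_coeff (hu : IsSolution lam ξ u₀ T u) (hx : LOne x) (l : ℤ) :
    AEMeasurable (fun s => ‖fourierCoeff (nonl lam x (u s)) l‖ₑ) (volume.restrict (Ioc 0 T)) :=
  (((hu.continuousOn_coeff hx l).mono Ioc_subset_Icc_self).aemeasurable measurableSet_Ioc).enorm

end sol

end

/-! ### An H¹ bound for a continuous mild solution, by finite differences in space. -/

section

variable {L : ℝ} [Fact (0 < 2 * L)]

lemma fourier_coe_eq (l : ℤ) (ε : ℝ) :
    fourier l ((ε : ℝ) : Torus L) = Complex.exp (I * (freq L l * ε : ℝ)) := by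
  have hL : (L : ℂ) ≠ 0 := by exact_mod_cast (pos_L L).ne'
  rw [fourier_coe_apply, freq]
  congr 1
  push_cast
  field_simp

lemma enorm_fourier_sub_one_le {ε : ℝ} (hε : 0 ≤ ε) (l : ℤ) :
    ‖fourier l ((ε : ℝ) : Torus L) - 1‖ₑ ≤ ENNReal.ofReal ε * om L l := by
  rw [fourier_coe_eq, ← ofReal_norm, om, ← ENNReal.ofReal_mul hε]
  refine ENNReal.ofReal_le_ofReal ((Real.norm_exp_I_mul_ofReal_sub_one_le).trans ?_)
  rw [Real.norm_eq_abs, abs_mul, abs_of_nonneg hε]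
  nlinarith [abs_nonneg (freq L l)]

/-- Jordan's inequality |sin y| ≥ 2|y|/π for |y| ≤ π/2, with the constant simplified by π ≤ 4. -/
lemma le_enorm_fourier_sub_one {ε : ℝ} (hε : 0 ≤ ε) {l : ℤ} (h : |freq L l| * ε ≤ Real.pi) :
    ENNReal.ofReal (ε * |freq L l|) ≤ 2 * ‖fourier l ((ε : ℝ) : Torus L) - 1‖ₑ := by
  rw [fourier_coe_eq, ← ofReal_norm, show (2 : ℝ≥0∞) = ENNReal.ofReal 2 by simp,
    ← ENNReal.ofReal_mul (by norm_num), Complex.norm_exp_I_mul_ofReal_sub_one]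
  refine ENNReal.ofReal_le_ofReal ?_
  have habs : |freq L l * ε / 2| = |freq L l| * ε / 2 := by
    rw [abs_div, abs_mul, abs_of_nonneg hε, abs_of_pos (two_pos (α := ℝ))]
  have h1 := Real.mul_abs_le_abs_sin (x := freq L l * ε / 2) (by rw [habs]; linarith)
  rw [habs] at h1
  rw [norm_mul, Real.norm_eq_abs, Real.norm_eq_abs, abs_of_pos (two_pos (α := ℝ))]
  have h2 : (1 : ℝ) / 2 ≤ 2 / Real.pi := by
    rw [div_le_div_iff₀ (by norm_num) Real.pi_pos]
    linarith [Real.pi_le_four]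
  have h3 : (0 : ℝ) ≤ |freq L l| * ε / 2 := by positivity
  nlinarith [mul_le_mul_of_nonneg_right h2 h3]

section sol

variable {lam : ℝ} {ξ : Torus L → ℝ} {u₀ : Torus L → ℂ} {T : ℝ} {u : ℝ → Torus L → ℂ} {x : ℤ → ℂ}

/-- At this stage only a sup bound on the solution is known, so no algebra norm is available.
Spatial increments are used because a locally Lipschitz nonlinearity acts on them pointwise. -/
lemma norm_nonl_sub_le {X B : ℝ} (hx : ∀ y : Torus L, ‖synth x y‖ ≤ X) {v : Torus L → ℂ}
    (hv : ∀ y, ‖v y‖ ≤ B) (y z : Torus L) :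
    ‖nonl lam x v y - nonl lam x v z‖ ≤
      (X + 3 * |lam| * B ^ 2) * ‖v y - v z‖ + B * ‖synth x y - synth x z‖ := by
  have e : nonl lam x v y - nonl lam x v z = (synth x y - synth x z) * v z +
      synth x y * (v y - v z) +
      lam * ((‖v y‖ : ℂ) ^ 2 * (v y - v z) + ((‖v y‖ : ℂ) ^ 2 - (‖v z‖ : ℂ) ^ 2) * v z) := by
    unfold nonl; ring
  have hB : 0 ≤ B := (norm_nonneg _).trans (hv y)
  have h1 : ‖(‖v y‖ : ℂ) ^ 2 - (‖v z‖ : ℂ) ^ 2‖ ≤ 2 * B * ‖v y - v z‖ := by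
    rw [sq_sub_sq, norm_mul, ← Complex.ofReal_add, ← Complex.ofReal_sub, Complex.norm_real,
      Complex.norm_real, Real.norm_eq_abs, Real.norm_eq_abs, abs_of_nonneg (by positivity)]
    have := abs_norm_sub_norm_le (v y) (v z)
    have h3 := hv y
    have h4 := hv z
    gcongr
    linarith
  rw [e]
  refine (norm_add_le _ _).trans ?_
  have h5 : ‖(lam : ℂ) * ((‖v y‖ : ℂ) ^ 2 * (v y - v z) +
      ((‖v y‖ : ℂ) ^ 2 - (‖v z‖ : ℂ) ^ 2) * v z)‖ ≤
      |lam| * (B ^ 2 * ‖v y - v z‖ + 2 * B * ‖v y - v z‖ * B) := by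
    rw [norm_mul, Complex.norm_real, Real.norm_eq_abs]
    gcongr
    refine (norm_add_le _ _).trans ?_
    rw [norm_mul, norm_mul]
    gcongr
    · rw [norm_pow, Complex.norm_real, norm_norm]
      exact pow_le_pow_left₀ (norm_nonneg _) (hv y) 2
    · exact hv z
  have h6 : ‖(synth x y - synth x z) * v z + synth x y * (v y - v z)‖ ≤
      ‖synth x y - synth x z‖ * B + X * ‖v y - v z‖ := by
    refine (norm_add_le _ _).trans ?_
    rw [norm_mul, norm_mul]
    gcongr
    · exact hv z
    · exact hx y
  nlinarith

lemma n2_translate_nonl_le {X B : ℝ} (hX : LOne x) (hx : ∀ y : Torus L, ‖synth x y‖ ≤ X)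
    {v : Torus L → ℂ} (hvc : Continuous v) (hv : ∀ y, ‖v y‖ ≤ B) (h : Torus L) :
    n2 (fun l => ‖fourier l h - 1‖ₑ) (fun l => ‖fourierCoeff (nonl lam x v) l‖ₑ) ≤
      ENNReal.ofReal (2 * (X + 3 * |lam| * B ^ 2) ^ 2 + 2 * B ^ 2) *
      (n2 (fun l => ‖fourier l h - 1‖ₑ) (fun l => ‖fourierCoeff v l‖ₑ) +
        n2 (fun l => ‖fourier l h - 1‖ₑ) (fun l => ‖x l‖ₑ)) := by
  have hxc := hX.continuous_synth (L := L)
  have hn := continuous_nonl (L := L) lam hX hvc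
  have hxe := n2_translate hxc h
  rw [hX.fourierCoeff_synth] at hxe
  rw [n2_translate hn, n2_translate hvc, hxe, ← ENNReal.ofReal_add (by positivity) (by positivity),
    ← ENNReal.ofReal_mul (by positivity)]
  refine ENNReal.ofReal_le_ofReal ?_
  have hintegrable : ∀ {f : Torus L → ℂ}, Continuous f →
      Integrable (fun y => ‖f (y + h) - f y‖ ^ 2) AddCircle.haarAddCircle := fun {f} hf =>
    (by fun_prop : Continuous fun y => ‖f (y + h) - f y‖ ^ 2).integrable_of_hasCompactSupport
      (HasCompactSupport.of_compactSpace _)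
  rw [← integral_add (hintegrable hvc) (hintegrable hxc), ← integral_const_mul]
  refine integral_mono (hintegrable hn) (((hintegrable hvc).add (hintegrable hxc)).const_mul _) fun y => ?_
  have h1 := norm_nonl_sub_le (lam := lam) hx hv (y + h) y
  have h2 := norm_nonneg (nonl lam x v (y + h) - nonl lam x v y)
  set p := ‖v (y + h) - v y‖
  set r := ‖synth x (y + h) - synth x y‖
  set P := X + 3 * |lam| * B ^ 2
  calc ‖nonl lam x v (y + h) - nonl lam x v y‖ ^ 2 ≤ (P * p + B * r) ^ 2 :=
        pow_le_pow_left₀ h2 h1 2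
    _ ≤ (2 * P ^ 2 + 2 * B ^ 2) * (p ^ 2 + r ^ 2) := by
        nlinarith [sq_nonneg (P * p - B * r), sq_nonneg (P * r), sq_nonneg (B * p)]

/-- The solution is bounded in `H¹`. -/
lemma IsSolution.exists_n2_om_le (hT : 0 < T) (hu : IsSolution lam ξ u₀ T u)
    (hξ : HasCoeff (fun y => (ξ y : ℂ)) x)
    (hx1 : n2 (om L) (fun l => ‖x l‖ₑ) ≠ ⊤)
    (hu1 : n2 (om L) (fun l => ‖fourierCoeff u₀ l‖ₑ) ≠ ⊤) :
    ∃ R : ℝ≥0∞, R ≠ ⊤ ∧ ∀ t ∈ Icc 0 T, n2 (om L) (fun l => ‖fourierCoeff (u t) l‖ₑ) ≤ R := by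
  obtain ⟨B, hB0, hB⟩ := hu.bounded
  set X := ∑' l, ‖x l‖
  set C : ℝ≥0∞ := ENNReal.ofReal (2 * (X + 3 * |lam| * B ^ 2) ^ 2 + 2 * B ^ 2) with hC
  set K : ℝ≥0∞ := 2 * (2 * n2 (om L) (fun l => ‖fourierCoeff u₀ l‖ₑ) +
    2 * ENNReal.ofReal T ^ 2 * C * n2 (om L) (fun l => ‖x l‖ₑ)) *
      ENNReal.ofReal (Real.exp ((4 * T * C.toReal + 1) * T)) with hK
  have hKt : K ≠ ⊤ := by finiteness
  have hscale : ∀ ε : ℝ, 0 ≤ ε → ∀ A : ℤ → ℝ≥0∞,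
      n2 (fun l => ‖fourier l ((ε : ℝ) : Torus L) - 1‖ₑ) A ≤
        ENNReal.ofReal ε ^ 2 * n2 (om L) A := by
    intro ε hε A
    unfold n2
    rw [← ENNReal.tsum_mul_left]
    refine ENNReal.tsum_le_tsum fun l => ?_
    rw [← mul_pow, ← mul_assoc]
    gcongr
    exact enorm_fourier_sub_one_le hε l
  -- The increments are bounded by 2B for free, which supplies the a priori bound of Gronwall. Both
  -- data terms are O(ε²), and K does not depend on ε.
  have hinc : ∀ ε : ℝ, 0 ≤ ε → ∀ t ∈ Icc 0 T, n2 (fun l => ‖fourier l ((ε : ℝ) : Torus L) - 1‖ₑ)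
      (fun l => ‖fourierCoeff (u t) l‖ₑ) ≤ ENNReal.ofReal ε ^ 2 * K := by
    intro ε hε t ht
    have hg := gronwall_modes hT (q := fun l => ‖fourier l ((ε : ℝ) : Torus L) - 1‖ₑ)
      (a := fun t l => ‖fourierCoeff (u t) l‖ₑ) (a₀ := fun l => ‖fourierCoeff u₀ l‖ₑ)
      (F := fun s l => ‖fourierCoeff (nonl lam x (u s)) l‖ₑ) (C := C)
      (D := n2 (fun l => ‖fourier l ((ε : ℝ) : Torus L) - 1‖ₑ) (fun l => ‖x l‖ₑ))
      (Y := ENNReal.ofReal ((2 * B) ^ 2))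
      ENNReal.ofReal_ne_top ENNReal.ofReal_ne_top (hu.aemeasurable_coeff hξ.1)
      (fun t ht l => hu.enorm_coeff_le hξ ht l)
      (fun t ht => by
        rw [n2_translate (hu.continuous ht)]
        refine ENNReal.ofReal_le_ofReal ?_
        have := norm_integral_le_of_norm_le_const (μ := AddCircle.haarAddCircle)
          (f := fun y : Torus L => ‖u t (y + (ε : Torus L)) - u t y‖ ^ 2) (C := (2 * B) ^ 2)
          (ae_of_all _ fun y => by
            rw [norm_pow, norm_norm]
            refine pow_le_pow_left₀ (norm_nonneg _) ((norm_sub_le _ _).trans ?_) 2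
            linarith [hB t ht y, hB t ht (y + (ε : Torus L))])
        simp only [probReal_univ, mul_one] at this
        exact (le_abs_self _).trans this)
      (fun t ht => n2_translate_nonl_le hξ.1 (norm_synth_le hξ.1) (hu.continuous ht) (hB t ht) _)
      t ht
    refine hg.trans ?_
    calc _ ≤ 2 * (2 * (ENNReal.ofReal ε ^ 2 * n2 (om L) (fun l => ‖fourierCoeff u₀ l‖ₑ)) +
          2 * ENNReal.ofReal T ^ 2 * C * (ENNReal.ofReal ε ^ 2 * n2 (om L) (fun l => ‖x l‖ₑ))) *
          ENNReal.ofReal (Real.exp ((4 * T * C.toReal + 1) * T)) := by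
          gcongr <;> exact hscale ε hε _
      _ = _ := by rw [hK]; ring
  have hderiv : ∀ t ∈ Icc 0 T, n2 (fun l => ENNReal.ofReal |freq L l|)
      (fun l => ‖fourierCoeff (u t) l‖ₑ) ≤ 4 * K := by
    intro t ht
    unfold n2
    rw [ENNReal.tsum_eq_iSup_sum]
    refine iSup_le fun E => ?_
    obtain ⟨m, hm⟩ : ∃ m : ℝ, ∀ l ∈ E, |freq L l| ≤ m := by
      obtain ⟨m, hm⟩ := (E.image fun l => |freq L l|).exists_le
      exact ⟨m, fun l hl => hm _ (Finset.mem_image_of_mem _ hl)⟩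
    -- On a finite set of frequencies ε can be taken so small that the increment weight is
    -- comparable to ε|μ_l|; then ε² cancels and the bound is independent of the set.
    set ε : ℝ := Real.pi / (1 + |m|) with hεd
    have hε : 0 < ε := by positivity
    have hεm : ∀ l ∈ E, |freq L l| * ε ≤ Real.pi := fun l hl => by
      rw [hεd, mul_div_assoc', div_le_iff₀ (by positivity)]
      nlinarith [hm l hl, le_abs_self m, Real.pi_pos]
    have hε' : ENNReal.ofReal ε ^ 2 ≠ 0 := by
      simpa using hε
    have hmain : ENNReal.ofReal ε ^ 2 * ∑ l ∈ E, (ENNReal.ofReal |freq L l| *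
        ‖fourierCoeff (u t) l‖ₑ) ^ 2 ≤ ENNReal.ofReal ε ^ 2 * (4 * K) := by
      rw [Finset.mul_sum]
      calc _ ≤ ∑ l ∈ E, 4 * (‖fourier l ((ε : ℝ) : Torus L) - 1‖ₑ *
            ‖fourierCoeff (u t) l‖ₑ) ^ 2 := by
            refine Finset.sum_le_sum fun l hl => ?_
            have h1 := le_enorm_fourier_sub_one (L := L) hε.le (hεm l hl)
            rw [ENNReal.ofReal_mul hε.le] at h1
            calc _ = (ENNReal.ofReal ε * ENNReal.ofReal |freq L l| *
                  ‖fourierCoeff (u t) l‖ₑ) ^ 2 := by ring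
              _ ≤ (2 * ‖fourier l ((ε : ℝ) : Torus L) - 1‖ₑ * ‖fourierCoeff (u t) l‖ₑ) ^ 2 := by
                gcongr
              _ = _ := by ring
        _ = 4 * ∑ l ∈ E, (‖fourier l ((ε : ℝ) : Torus L) - 1‖ₑ *
            ‖fourierCoeff (u t) l‖ₑ) ^ 2 := by rw [Finset.mul_sum]
        _ ≤ 4 * (ENNReal.ofReal ε ^ 2 * K) := by
            gcongr
            exact (ENNReal.sum_le_tsum E).trans (hinc ε hε.le t ht)
        _ = _ := by ring
    exact (ENNReal.mul_le_mul_iff_right hε' (by finiteness)).mp hmain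
  refine ⟨2 * ENNReal.ofReal (B ^ 2) + 2 * (4 * K), by finiteness, fun t ht => ?_⟩
  have hL2 : ∑' l, ‖fourierCoeff (u t) l‖ₑ ^ 2 ≤ ENNReal.ofReal (B ^ 2) := by
    have hs := hasSum_sq_fourierCoeff_of_memLp (memLp_of_continuous (hu.continuous ht))
    have h1 : ∑' l, ‖fourierCoeff (u t) l‖ₑ ^ 2 =
        ENNReal.ofReal (∫ y, ‖u t y‖ ^ 2 ∂AddCircle.haarAddCircle) := by
      rw [← hs.tsum_eq, ENNReal.ofReal_tsum_of_nonneg (fun _ => by positivity) hs.summable]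
      exact tsum_congr fun l => by rw [ENNReal.ofReal_pow (norm_nonneg _), ofReal_norm]
    rw [h1]
    refine ENNReal.ofReal_le_ofReal ?_
    have := norm_integral_le_of_norm_le_const (μ := AddCircle.haarAddCircle)
      (f := fun y : Torus L => ‖u t y‖ ^ 2) (C := B ^ 2)
      (ae_of_all _ fun y => by
        rw [norm_pow, norm_norm]
        exact pow_le_pow_left₀ (norm_nonneg _) (hB t ht y) 2)
    simp only [probReal_univ, mul_one] at this
    exact (le_abs_self _).trans this
  calc n2 (om L) (fun l => ‖fourierCoeff (u t) l‖ₑ)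
      ≤ ∑' l, (2 * ‖fourierCoeff (u t) l‖ₑ ^ 2 +
        2 * (ENNReal.ofReal |freq L l| * ‖fourierCoeff (u t) l‖ₑ) ^ 2) := by
        refine ENNReal.tsum_le_tsum fun l => ?_
        rw [om, ENNReal.ofReal_add (by norm_num) (abs_nonneg _), ENNReal.ofReal_one, add_mul,
          one_mul]
        exact ennreal_add_sq_le _ _
    _ = 2 * ∑' l, ‖fourierCoeff (u t) l‖ₑ ^ 2 + 2 * n2 (fun l => ENNReal.ofReal |freq L l|)
      (fun l => ‖fourierCoeff (u t) l‖ₑ) := by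
        rw [ENNReal.tsum_add, ENNReal.tsum_mul_left, ENNReal.tsum_mul_left]; rfl
    _ ≤ _ := by
        gcongr
        exact hderiv t ht

end sol

end

/-! ### Tame estimates, propagation of higher Sobolev regularity, and the majorant. -/

section

/-- A weight that is subadditive up to the constant `c`. -/
def Quasiadd (c : ℝ≥0∞) (q : ℤ → ℝ≥0∞) : Prop := ∀ k j, q (k + j) ≤ c * (q k + q j)

/-- The weight falls on one factor and the other is measured in unweighted ℓ¹. The bound is thus
linear in the high norm, and Gronwall's constant depends only on the ℓ¹ size. -/
lemma Quasiadd.n2_cv_le {c : ℝ≥0∞} {q : ℤ → ℝ≥0∞} (hq : Quasiadd c q) (A B : ℤ → ℝ≥0∞) :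
    n2 q (A ⊛ B) ≤ 2 * c ^ 2 * ((∑' l, B l) ^ 2 * n2 q A + (∑' l, A l) ^ 2 * n2 q B) := by
  have h1 : ∀ l, q l * (A ⊛ B) l ≤ c * ((B ⊛ (q * A)) l + (A ⊛ (q * B)) l) := by
    intro l
    rw [cv_comm B]
    simp only [cv, Pi.mul_apply, ← ENNReal.tsum_mul_left, ← ENNReal.tsum_add]
    refine ENNReal.tsum_le_tsum fun k => ?_
    calc q l * (A k * B (l - k)) ≤ (c * (q k + q (l - k))) * (A k * B (l - k)) := by
          gcongr
          simpa using hq k (l - k)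
      _ = _ := by ring
  calc n2 q (A ⊛ B) ≤ ∑' l, c ^ 2 * (2 * (B ⊛ (q * A)) l ^ 2 + 2 * (A ⊛ (q * B)) l ^ 2) := by
        refine ENNReal.tsum_le_tsum fun l => ?_
        refine (pow_le_pow_left' (h1 l) 2).trans ?_
        rw [mul_pow]
        gcongr
        exact ennreal_add_sq_le _ _
    _ = c ^ 2 * (2 * ∑' l, (B ⊛ (q * A)) l ^ 2 + 2 * ∑' l, (A ⊛ (q * B)) l ^ 2) := by
        rw [ENNReal.tsum_mul_left, ENNReal.tsum_add, ENNReal.tsum_mul_left, ENNReal.tsum_mul_left]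
    _ ≤ c ^ 2 * (2 * ((∑' l, B l) ^ 2 * n2 q A) + 2 * ((∑' l, A l) ^ 2 * n2 q B)) := by
        gcongr <;> exact tsum_cv_sq_le _ _
    _ = _ := by ring

lemma quasiadd_om_rpow (L : ℝ) {s : ℝ} (hs : 0 ≤ s) :
    Quasiadd (2 ^ s) fun l => om L l ^ s := by
  intro k j
  rcases le_total (om L k) (om L j) with h | h
  · calc om L (k + j) ^ s ≤ (2 * om L j) ^ s := by
          refine ENNReal.rpow_le_rpow ((om_add_le L k j).trans ?_) hs
          rw [two_mul]; gcongr
      _ = 2 ^ s * om L j ^ s := ENNReal.mul_rpow_of_nonneg _ _ hs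
      _ ≤ _ := by gcongr; exact le_add_self
  · calc om L (k + j) ^ s ≤ (2 * om L k) ^ s := by
          refine ENNReal.rpow_le_rpow ((om_add_le L k j).trans ?_) hs
          rw [two_mul]; gcongr
      _ = 2 ^ s * om L k ^ s := ENNReal.mul_rpow_of_nonneg _ _ hs
      _ ≤ _ := by gcongr; exact le_self_add

/-- Truncated weights keep the same constant c for every N, so the tame estimate is uniform in the
truncation. -/
lemma Quasiadd.min {c : ℝ≥0∞} {q : ℤ → ℝ≥0∞} (hq : Quasiadd c q) (hc : 1 ≤ c) (N : ℝ≥0∞) :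
    Quasiadd c fun l => min (q l) N := by
  intro k j
  have hN : N ≤ c * N := by simpa using mul_le_mul' hc (le_refl N)
  simp only
  rcases le_total N (q k) with h | h
  · refine (min_le_right _ _).trans (hN.trans ?_)
    gcongr
    rw [min_eq_right h]
    exact le_self_add
  rcases le_total N (q j) with h' | h'
  · refine (min_le_right _ _).trans (hN.trans ?_)
    gcongr
    rw [min_eq_right h']
    exact le_add_self
  · rw [min_eq_left h, min_eq_left h']
    exact (min_le_left _ _).trans (hq k j)

lemma tsum_sq_le_n2_om (L : ℝ) (A : ℤ → ℝ≥0∞) :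
    (∑' l, A l) ^ 2 ≤ (∑' l : ℤ, ((om L l)⁻¹) ^ 2) * n2 (om L) A := by
  refine le_trans (le_of_eq ?_) (tsum_mul_sq_le _ _)
  congr 1
  refine tsum_congr fun l => ?_
  rw [← mul_assoc, ENNReal.inv_mul_cancel (zero_lt_one.trans_le (one_le_om L l)).ne'
    (om_ne_top L l), one_mul]

variable {L : ℝ} [Fact (0 < 2 * L)]

lemma hasCoeff_nonl (lam : ℝ) {x a : ℤ → ℂ} (hx : LOne x) {v : Torus L → ℂ} (hv : HasCoeff v a) :
    HasCoeff (nonl lam x v) (conv x a + (lam : ℂ) • conv (cj a) (conv a a)) :=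
  (((hasCoeff_synth hx).mul hv).add (hv.norm_sq_mul.const_mul lam)).congr_ae
    (ae_of_all _ fun y => by unfold nonl; ring)

/-- The tame estimate for the right-hand side of the equation. -/
lemma n2_nonl_le {c R : ℝ≥0∞} {q : ℤ → ℝ≥0∞} (hq : Quasiadd c q) (hqe : ∀ l, q (-l) = q l)
    (lam : ℝ) {x a : ℤ → ℂ} (hxR : ∑' l, ‖x l‖ₑ ≤ R) (haR : ∑' l, ‖a l‖ₑ ≤ R) :
    n2 q (fun l => ‖(conv x a + (lam : ℂ) • conv (cj a) (conv a a)) l‖ₑ) ≤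
      (4 * c ^ 2 * R ^ 2 + 2 * ‖(lam : ℂ)‖ₑ ^ 2 * (2 * c ^ 2 * (R ^ 4 + 4 * c ^ 2 * R ^ 4))) *
        (n2 q (fun l => ‖a l‖ₑ) + n2 q (fun l => ‖x l‖ₑ)) := by
  set A : ℤ → ℝ≥0∞ := fun l => ‖a l‖ₑ
  set X : ℤ → ℝ≥0∞ := fun l => ‖x l‖ₑ
  set A' : ℤ → ℝ≥0∞ := fun l => A (-l)
  have hA' : ∑' l, A' l = ∑' l, A l := (Equiv.neg ℤ).tsum_eq A
  have hA'2 : n2 q A' = n2 q A := n2_neg hqe A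
  have hle : (fun l => ‖(conv x a + (lam : ℂ) • conv (cj a) (conv a a)) l‖ₑ) ≤
      X ⊛ A + ‖(lam : ℂ)‖ₑ • (A' ⊛ A ⊛ A) := by
    intro l
    refine (enorm_add_le _ _).trans (add_le_add (enorm_conv_le (fun _ => le_rfl)
      (fun _ => le_rfl) l) ?_)
    rw [Pi.smul_apply, smul_eq_mul, enorm_mul, Pi.smul_apply, smul_eq_mul]
    gcongr
    exact enorm_conv_le (fun l => by rw [cj, enorm_conj])
      (enorm_conv_le (fun _ => le_rfl) fun _ => le_rfl) l
  refine (n2_mono hle).trans ((n2_add_le _ _ _).trans ?_)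
  rw [n2_smul]
  have h1 : n2 q (X ⊛ A) ≤ 2 * c ^ 2 * (R ^ 2 * n2 q X + R ^ 2 * n2 q A) :=
    (hq.n2_cv_le X A).trans (by gcongr)
  have h2 : n2 q (A ⊛ A) ≤ 2 * c ^ 2 * (R ^ 2 * n2 q A + R ^ 2 * n2 q A) :=
    (hq.n2_cv_le A A).trans (by gcongr)
  have h3 : n2 q (A' ⊛ A ⊛ A) ≤ 2 * c ^ 2 * ((R * R) ^ 2 * n2 q A +
      R ^ 2 * (2 * c ^ 2 * (R ^ 2 * n2 q A + R ^ 2 * n2 q A))) := by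
    refine (hq.n2_cv_le A' (A ⊛ A)).trans ?_
    rw [tsum_cv, hA', hA'2]
    gcongr
  calc _ ≤ 2 * (2 * c ^ 2 * (R ^ 2 * n2 q X + R ^ 2 * n2 q A)) + 2 * (‖(lam : ℂ)‖ₑ ^ 2 *
        (2 * c ^ 2 * ((R * R) ^ 2 * n2 q A +
          R ^ 2 * (2 * c ^ 2 * (R ^ 2 * n2 q A + R ^ 2 * n2 q A))))) := by gcongr
    _ = 4 * c ^ 2 * R ^ 2 * (n2 q A + n2 q X) + 2 * ‖(lam : ℂ)‖ₑ ^ 2 *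
        (2 * c ^ 2 * (R ^ 4 + 4 * c ^ 2 * R ^ 4)) * n2 q A := by ring
    _ ≤ 4 * c ^ 2 * R ^ 2 * (n2 q A + n2 q X) + 2 * ‖(lam : ℂ)‖ₑ ^ 2 *
        (2 * c ^ 2 * (R ^ 4 + 4 * c ^ 2 * R ^ 4)) * (n2 q A + n2 q X) := by
        gcongr
        exact le_self_add
    _ = _ := by ring

section sol

variable {lam : ℝ} {ξ : Torus L → ℝ} {u₀ : Torus L → ℂ} {T : ℝ} {u : ℝ → Torus L → ℂ} {x : ℤ → ℂ}

lemma n2_weight_mono {p q A : ℤ → ℝ≥0∞} (h : p ≤ q) : n2 p A ≤ n2 q A :=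
  ENNReal.tsum_le_tsum fun l => pow_le_pow_left' (mul_le_mul' (h l) le_rfl) 2

/-- A majorant, uniform in time, of the Fourier coefficients of the potential, the solution and
the right-hand side of the equation. -/
theorem IsSolution.exists_majorant (hT : 0 < T) (hu : IsSolution lam ξ u₀ T u)
    (hξ : HasCoeff (fun y => (ξ y : ℂ)) x) {s : ℝ} (hs : 1 ≤ s)
    (hxs : n2 (fun l => om L l ^ s) (fun l => ‖x l‖ₑ) ≠ ⊤)
    (hus : n2 (fun l => om L l ^ s) (fun l => ‖fourierCoeff u₀ l‖ₑ) ≠ ⊤) :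
    ∃ M : ℤ → ℝ≥0∞, (∀ l, M (-l) = M l) ∧ n2 (fun l => om L l ^ s) M ≠ ⊤ ∧
      (∀ l, ‖x l‖ₑ ≤ M l) ∧ ∀ t ∈ Icc 0 T, LOne (fourierCoeff (u t)) ∧
        (∀ l, ‖fourierCoeff (u t) l‖ₑ ≤ M l) ∧
        ∀ l, ‖fourierCoeff (nonl lam x (u t)) l‖ₑ ≤ M l := by
  have hs0 : 0 ≤ s := zero_le_one.trans hs
  have hL := pos_L L
  set q : ℤ → ℝ≥0∞ := fun l => om L l ^ s with hqdef
  have hqe : ∀ l, q (-l) = q l := fun l => by rw [hqdef]; simp only [om_neg]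
  have homq : om L ≤ q := fun l => by
    simpa using ENNReal.rpow_le_rpow_of_exponent_le (one_le_om L l) hs
  set Z := ∑' l : ℤ, ((om L l)⁻¹) ^ 2 with hZ
  have hZt : Z ≠ ⊤ := tsum_om_inv_sq_ne_top hL
  have hsum : ∀ A : ℤ → ℝ≥0∞, n2 q A ≠ ⊤ → ∑' l, A l ≠ ⊤ := fun A hA htop => by
    have h := (tsum_sq_le_n2_om L A).trans (mul_le_mul' le_rfl (n2_weight_mono homq))
    rw [htop] at h
    exact absurd (top_le_iff.mp (by simpa using h)) (ENNReal.mul_ne_top hZt hA)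
  obtain ⟨R₁, hR₁t, hR₁⟩ := hu.exists_n2_om_le hT hξ
    (ne_top_of_le_ne_top hxs (n2_weight_mono homq)) (ne_top_of_le_ne_top hus (n2_weight_mono homq))
  -- The summand 1 gives R ≤ R², which turns a bound on the squared ℓ¹ norm into a bound on the norm
  -- itself.
  set R : ℝ≥0∞ := 1 + Z * R₁ + ∑' l, ‖x l‖ₑ with hR
  have hRt : R ≠ ⊤ := by
    have := lOne_iff.mp hξ.1
    finiteness
  have hRu : ∀ t ∈ Icc 0 T, ∑' l, ‖fourierCoeff (u t) l‖ₑ ≤ R := fun t ht => by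
    have h1 : (∑' l, ‖fourierCoeff (u t) l‖ₑ) ^ 2 ≤ Z * R₁ :=
      (tsum_sq_le_n2_om L _).trans (by gcongr; exact hR₁ t ht)
    by_contra hcon
    push Not at hcon
    have h2 : R ≤ R ^ 2 := by
      have : 1 ≤ R := by rw [hR, add_assoc]; exact le_self_add
      calc R = R * 1 := (mul_one _).symm
        _ ≤ R * R := by gcongr
        _ = R ^ 2 := (sq _).symm
    have h3 : R ^ 2 < (∑' l, ‖fourierCoeff (u t) l‖ₑ) ^ 2 :=
      ENNReal.pow_lt_pow_left (by norm_num) hcon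
    have h4 : Z * R₁ ≤ R := by
      rw [hR, add_comm 1, add_assoc]; exact le_self_add
    exact absurd (h3.trans_le h1) (not_lt.mpr (h4.trans h2))
  have hRx : ∑' l, ‖x l‖ₑ ≤ R := by rw [hR]; exact le_add_self
  have hlone : ∀ t ∈ Icc 0 T, LOne (fourierCoeff (u t)) := fun t ht =>
    lOne_iff.mpr (ne_top_of_le_ne_top hRt (hRu t ht))
  have hcoef : ∀ t ∈ Icc 0 T, fourierCoeff (nonl lam x (u t)) = conv x (fourierCoeff (u t)) +
      (lam : ℂ) • conv (cj (fourierCoeff (u t))) (conv (fourierCoeff (u t)) (fourierCoeff (u t))) :=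
    fun t ht => (hasCoeff_nonl lam hξ.1 (hasCoeff_of_memLp
      (memLp_of_continuous (hu.continuous ht)) (hlone t ht))).fourierCoeff_eq
  set c : ℝ≥0∞ := 2 ^ s with hc
  have hct : c ≠ ⊤ := ENNReal.rpow_ne_top_of_nonneg hs0 (by norm_num)
  have hc1 : 1 ≤ c := by simpa using ENNReal.rpow_le_rpow (one_le_two (α := ℝ≥0∞)) hs0
  have hqa : Quasiadd c q := quasiadd_om_rpow L hs0
  set C : ℝ≥0∞ := 4 * c ^ 2 * R ^ 2 +
    2 * ‖(lam : ℂ)‖ₑ ^ 2 * (2 * c ^ 2 * (R ^ 4 + 4 * c ^ 2 * R ^ 4)) with hCdef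
  have hCt : C ≠ ⊤ := by finiteness
  set K : ℝ≥0∞ := 2 * (2 * n2 q (fun l => ‖fourierCoeff u₀ l‖ₑ) +
    2 * ENNReal.ofReal T ^ 2 * C * n2 q (fun l => ‖x l‖ₑ)) *
      ENNReal.ofReal (Real.exp ((4 * T * C.toReal + 1) * T)) with hK
  have hKt : K ≠ ⊤ := by finiteness
  -- The weight is at most N, so the truncated norm is finite a priori by the H¹ bound; the
  -- resulting K is free of N.
  have htrunc : ∀ N : ℕ, ∀ t ∈ Icc 0 T,
      n2 (fun l => min (q l) N) (fun l => ‖fourierCoeff (u t) l‖ₑ) ≤ K := by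
    intro N t ht
    have hqN : (fun l => min (q l) (N : ℝ≥0∞)) ≤ q := fun l => min_le_left _ _
    have hg := gronwall_modes hT (q := fun l => min (q l) N)
      (a := fun t l => ‖fourierCoeff (u t) l‖ₑ) (a₀ := fun l => ‖fourierCoeff u₀ l‖ₑ)
      (F := fun s l => ‖fourierCoeff (nonl lam x (u s)) l‖ₑ) (C := C)
      (D := n2 (fun l => min (q l) N) (fun l => ‖x l‖ₑ))
      (Y := (N : ℝ≥0∞) ^ 2 * R₁) hCt (by finiteness) (hu.aemeasurable_coeff hξ.1)
      (fun t ht l => hu.enorm_coeff_le hξ ht l)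
      (fun t ht => by
        refine le_trans ?_ (mul_le_mul' le_rfl (hR₁ t ht))
        unfold n2
        rw [← ENNReal.tsum_mul_left]
        refine ENNReal.tsum_le_tsum fun l => ?_
        rw [← mul_pow]
        gcongr
        · exact min_le_right _ _
        · exact le_om_mul L (fun l => ‖fourierCoeff (u t) l‖ₑ) l)
      (fun t ht => by
        rw [hcoef t ht]
        exact n2_nonl_le (hqa.min hc1 N) (fun l => by simp only [hqe]) lam hRx (hRu t ht))
      t ht
    refine hg.trans ?_
    rw [hK]
    gcongr <;> exact n2_weight_mono hqN
  have huK : ∀ t ∈ Icc 0 T, n2 q (fun l => ‖fourierCoeff (u t) l‖ₑ) ≤ K := by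
    intro t ht
    unfold n2
    rw [ENNReal.tsum_eq_iSup_sum]
    refine iSup_le fun E => ?_
    obtain ⟨N, hN⟩ : ∃ N : ℕ, ∀ l ∈ E, q l ≤ N := by
      obtain ⟨N, hN⟩ := ENNReal.exists_nat_gt (r := ∑ l ∈ E, q l) (ENNReal.sum_ne_top.mpr
        fun l _ => ENNReal.rpow_ne_top_of_nonneg hs0 (om_ne_top L l))
      exact ⟨N, fun l hl => (Finset.single_le_sum (fun _ _ => zero_le) hl).trans hN.le⟩
    refine le_trans (le_of_eq ?_) ((ENNReal.sum_le_tsum E).trans (htrunc N t ht))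
    refine Finset.sum_congr rfl fun l hl => ?_
    simp only [min_eq_left (hN l hl)]
  have hFK : ∀ t ∈ Icc 0 T, n2 q (fun l => ‖fourierCoeff (nonl lam x (u t)) l‖ₑ) ≤
      C * (K + n2 q (fun l => ‖x l‖ₑ)) := fun t ht => by
    rw [hcoef t ht]
    exact (n2_nonl_le hqa hqe lam hRx (hRu t ht)).trans (by gcongr; exact huK t ht)
  -- Integrating the modulus of the right-hand side over all of [0, T] dominates every time
  -- simultaneously, mode by mode, and stays in the weighted ℓ² space.
  set V : ℤ → ℝ≥0∞ := (fun l => ‖fourierCoeff u₀ l‖ₑ) +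
    fun l => ∫⁻ s in Ioc 0 T, ‖fourierCoeff (nonl lam x (u s)) l‖ₑ with hV
  have hVt : n2 q V ≠ ⊤ := by
    refine ne_top_of_le_ne_top ?_ (n2_add_le _ _ _)
    have h1 := n2_lintegral_le (q := q) (le_refl T) (hu.aemeasurable_coeff hξ.1)
    have h2 : ∫⁻ s in Ioc 0 T, n2 q (fun l => ‖fourierCoeff (nonl lam x (u s)) l‖ₑ) ≤
        C * (K + n2 q (fun l => ‖x l‖ₑ)) * ENNReal.ofReal T := by
      calc _ ≤ ∫⁻ _ in Ioc 0 T, C * (K + n2 q (fun l => ‖x l‖ₑ)) :=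
            setLIntegral_mono measurable_const fun s hs => hFK s ⟨hs.1.le, hs.2⟩
        _ = _ := by simp
    have h3 : n2 q (fun l => ∫⁻ s in Ioc 0 T, ‖fourierCoeff (nonl lam x (u s)) l‖ₑ) ≠ ⊤ :=
      ne_top_of_le_ne_top (by finiteness) (h1.trans (mul_le_mul' le_rfl h2))
    finiteness
  have huV : ∀ t ∈ Icc 0 T, ∀ l, ‖fourierCoeff (u t) l‖ₑ ≤ V l := fun t ht l => by
    refine (hu.enorm_coeff_le hξ ht l).trans ?_
    rw [hV, Pi.add_apply]
    gcongr
    exact ht.2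
  set U : ℤ → ℝ≥0∞ := (fun l => ‖x l‖ₑ) + V with hU
  have hUt : n2 q U ≠ ⊤ := ne_top_of_le_ne_top (by finiteness) (n2_add_le _ _ _)
  -- Symmetrized, since complex conjugation reflects the frequencies.
  set M₀ : ℤ → ℝ≥0∞ := U + fun l => U (-l) with hM₀
  have hM₀t : n2 q M₀ ≠ ⊤ :=
    ne_top_of_le_ne_top (by rw [n2_neg hqe]; finiteness) (n2_add_le _ _ _)
  have hM₀e : ∀ l, M₀ (-l) = M₀ l := fun l => by simp [hM₀, add_comm]
  have hxM : ∀ l, ‖x l‖ₑ ≤ M₀ l := fun l => by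
    simp only [hM₀, hU, Pi.add_apply, add_assoc]; exact le_self_add
  have huM : ∀ t ∈ Icc 0 T, ∀ l, ‖fourierCoeff (u t) l‖ₑ ≤ M₀ l := fun t ht l => by
    refine (huV t ht l).trans ?_
    simp only [hM₀, hU, Pi.add_apply]
    exact le_add_self.trans le_self_add
  have hcvt : ∀ {A B : ℤ → ℝ≥0∞}, n2 q A ≠ ⊤ → n2 q B ≠ ⊤ → n2 q (A ⊛ B) ≠ ⊤ := by
    intro A B hA hB
    have := hsum A hA
    have := hsum B hB
    exact ne_top_of_le_ne_top (by finiteness) (hqa.n2_cv_le A B)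
  -- Added to the majorant so that it also dominates the coefficients of the right-hand side.
  set H : ℤ → ℝ≥0∞ := M₀ ⊛ M₀ + ‖(lam : ℂ)‖ₑ • (M₀ ⊛ M₀ ⊛ M₀) with hH
  have hHt : n2 q H ≠ ⊤ := by
    refine ne_top_of_le_ne_top ?_ (n2_add_le _ _ _)
    rw [n2_smul]
    have h1 := hcvt hM₀t hM₀t
    have h2 := hcvt hM₀t h1
    finiteness
  have hHe : ∀ l, H (-l) = H l := fun l => by
    simp only [hH, Pi.add_apply, Pi.smul_apply]
    rw [cv_even hM₀e hM₀e, cv_even hM₀e (cv_even hM₀e hM₀e)]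
  refine ⟨M₀ + H, fun l => by simp only [Pi.add_apply, hM₀e, hHe],
    ne_top_of_le_ne_top (by finiteness) (n2_add_le _ _ _),
    fun l => (hxM l).trans le_self_add, fun t ht => ⟨hlone t ht,
      fun l => (huM t ht l).trans le_self_add, fun l => ?_⟩⟩
  rw [hcoef t ht]
  refine le_trans ?_ (le_add_self (a := H l) (b := M₀ l))
  refine (enorm_add_le _ _).trans (add_le_add (enorm_conv_le hxM (huM t ht) l) ?_)
  rw [Pi.smul_apply, smul_eq_mul, enorm_mul, Pi.smul_apply, smul_eq_mul]
  gcongr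
  exact enorm_conv_le (enorm_cj_le hM₀e (huM t ht)) (enorm_conv_le (huM t ht) (huM t ht)) l

end sol

end

section

/-! ### Estimates of the symbols -/

/-- The unimodular symbol `exp(i ρ f)`. -/
def eS (ρ : ℝ) (f : ℤ → ℤ → ℝ) (k j : ℤ) : ℂ := Complex.exp (I * ρ * f k j)

lemma norm_eS (ρ : ℝ) (f : ℤ → ℤ → ℝ) (k j : ℤ) : ‖eS ρ f k j‖ = 1 := norm_exp_I_mul _ _

lemma eS_zero (f : ℤ → ℤ → ℝ) : eS 0 f = fun _ _ => 1 := by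
  funext k j; simp [eS]

lemma norm_exp_I_mul_sub_one_le (ρ y : ℝ) : ‖Complex.exp (I * ρ * y) - 1‖ ≤ |ρ| * |y| := by
  rw [mul_assoc, ← Complex.ofReal_mul, ← abs_mul]
  exact Real.norm_exp_I_mul_ofReal_sub_one_le

lemma enorm_exp_sub_one_le {ρ τ : ℝ} (h0 : 0 ≤ ρ) (h : ρ ≤ τ) (y : ℝ) :
    ‖Complex.exp (I * ρ * y) - 1‖ₑ ≤ ENNReal.ofReal τ * ENNReal.ofReal |y| := by
  rw [← ENNReal.ofReal_mul (h0.trans h)]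
  refine enorm_le_of_norm_le ((norm_exp_I_mul_sub_one_le ρ y).trans ?_)
  rw [abs_of_nonneg h0]
  gcongr

lemma enorm_exp_sub_one_le_two (ρ y : ℝ) : ‖Complex.exp (I * ρ * y) - 1‖ₑ ≤ 2 := by
  have h : ‖Complex.exp (I * ρ * y) - 1‖ ≤ 2 :=
    (norm_sub_le _ _).trans (by rw [norm_exp_I_mul, norm_one]; norm_num)
  simpa using enorm_le_of_norm_le h

lemma ofReal_abs_freq_le (L : ℝ) (l : ℤ) : ENNReal.ofReal |freq L l| ≤ om L l :=
  ENNReal.ofReal_le_ofReal (by linarith)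

lemma om_add_le_mul (L : ℝ) (k j : ℤ) : om L k + om L j ≤ 2 * (om L k * om L j) := by
  rw [two_mul]
  gcongr
  · simpa using mul_le_mul' (le_refl (om L k)) (one_le_om L j)
  · simpa using mul_le_mul' (one_le_om L k) (le_refl (om L j))

/-- The sum ω_k + ω_j is kept for the cubic local error: there the inner form already carries one
derivative per factor, and turning the sum into a product would put ω² on two factors. -/
lemma abs_alpha_le (L : ℝ) (k j : ℤ) :
    ENNReal.ofReal |alpha L k j| ≤ 2 * (om L k * (om L k + om L j)) := by
  rw [alpha, ← freq_add, abs_mul, abs_mul, abs_two, mul_assoc, ENNReal.ofReal_mul (by norm_num),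
    ENNReal.ofReal_mul (by positivity), ENNReal.ofReal_ofNat]
  gcongr
  · exact ofReal_abs_freq_le L k
  · exact (ofReal_abs_freq_le L _).trans (om_add_le L k j)

/-- The cruder product form suffices when the inner bilinear form carries no derivative. -/
lemma abs_alpha_le' (L : ℝ) (k j : ℤ) :
    ENNReal.ofReal |alpha L k j| ≤ 4 * (om L k ^ 2 * om L j) := by
  refine (abs_alpha_le L k j).trans ?_
  calc _ ≤ 2 * (om L k * (2 * (om L k * om L j))) := by gcongr; exact om_add_le_mul L k j
    _ = _ := by ring

lemma abs_beta_le (L : ℝ) (k j : ℤ) : ENNReal.ofReal |beta L k j| ≤ 2 * (om L k * om L j) := by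
  rw [beta, abs_mul, abs_mul, abs_two, mul_assoc, ENNReal.ofReal_mul (by norm_num),
    ENNReal.ofReal_mul (by positivity), ENNReal.ofReal_ofNat]
  gcongr <;> exact ofReal_abs_freq_le L _

lemma abs_eta_le (L : ℝ) (k j : ℤ) : ENNReal.ofReal |eta L k j| ≤ 3 * (om L k ^ 2 * om L j) := by
  have h : |eta L k j| ≤ |freq L k| * |freq L k| + |beta L k j| := by
    rw [eta, beta, ← abs_mul, ← sq]; exact abs_add_le _ _
  refine (ENNReal.ofReal_le_ofReal h).trans ?_
  rw [ENNReal.ofReal_add (by positivity) (by positivity), ENNReal.ofReal_mul (by positivity)]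
  have h1 : om L k * om L k ≤ om L k ^ 2 * om L j := by
    rw [← sq]; simpa using mul_le_mul' (le_refl (om L k ^ 2)) (one_le_om L j)
  have h2 : om L k * om L j ≤ om L k ^ 2 * om L j := by
    gcongr
    rw [sq]; simpa using mul_le_mul' (le_refl (om L k)) (one_le_om L k)
  calc _ ≤ om L k * om L k + 2 * (om L k * om L j) := by
        gcongr
        · exact ofReal_abs_freq_le L k
        · exact ofReal_abs_freq_le L k
        · exact abs_beta_le L k j
    _ ≤ om L k ^ 2 * om L j + 2 * (om L k ^ 2 * om L j) := by gcongr
    _ = _ := by ring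

/-- The trilinear form `T_ρ(c, a, b)`. -/
def tri (L ρ : ℝ) (c a b : ℤ → ℂ) : ℤ → ℂ :=
  bil (eS ρ (alpha L)) c (bil (eS ρ (beta L)) a b)

/-- The right-hand side of the equation in the interaction picture. -/
def Gs (L lam ρ : ℝ) (x a : ℤ → ℂ) : ℤ → ℂ :=
  bil (eS ρ (eta L)) x a + (lam : ℂ) • tri L ρ (cj a) a a

lemma tri_zero (L : ℝ) (c a b : ℤ → ℂ) : tri L 0 c a b = conv c (conv a b) := by
  simp only [tri, eS_zero]; rfl

lemma enorm_bil_le_add {σ : ℤ → ℤ → ℂ} {a b : ℤ → ℂ} {A B A' B' : ℤ → ℝ≥0∞}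
    (h : ∀ k j, ‖σ k j‖ₑ * ‖a k‖ₑ * ‖b j‖ₑ ≤ A k * B j + A' k * B' j) (l : ℤ) :
    ‖bil σ a b l‖ₑ ≤ (A ⊛ B) l + (A' ⊛ B') l := by
  refine (enorm_tsum_le' _).trans ?_
  unfold cv
  rw [← ENNReal.tsum_add]
  refine ENNReal.tsum_le_tsum fun k => ?_
  simpa [enorm_mul] using h k (l - k)

section bounds

variable {L lam ρ τ : ℝ} {M : ℤ → ℝ≥0∞}

lemma LOne.bil_eS {a b : ℤ → ℂ} (ha : LOne a) (hb : LOne b) (ρ : ℝ) (f : ℤ → ℤ → ℝ) :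
    LOne (DNLS.bil (eS ρ f) a b) :=
  LOne.bil (C := 1) (fun k j => (norm_eS ρ f k j).le) ha hb

lemma LOne.bilSummable_eS {a b : ℤ → ℂ} (ha : LOne a) (hb : LOne b) (ρ : ℝ) (f : ℤ → ℤ → ℝ)
    (l : ℤ) : BilSummable (eS ρ f) a b l :=
  LOne.bilSummable (C := 1) (fun k j => (norm_eS ρ f k j).le) ha hb l

lemma LOne.bilSummable_one {a b : ℤ → ℂ} (ha : LOne a) (hb : LOne b) (l : ℤ) :
    BilSummable (fun _ _ => 1) a b l :=
  LOne.bilSummable (C := 1) (by simp) ha hb l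

lemma LOne.bilSummable_eS_sub {a b : ℤ → ℂ} (ha : LOne a) (hb : LOne b) (ρ : ℝ)
    (f : ℤ → ℤ → ℝ) (l : ℤ) : BilSummable (fun k j => eS ρ f k j - 1) a b l :=
  (ha.bilSummable_eS hb ρ f l).sub (ha.bilSummable_one hb l)

lemma LOne.tri {c a b : ℤ → ℂ} (hc : LOne c) (ha : LOne a) (hb : LOne b) (ρ : ℝ) :
    LOne (DNLS.tri L ρ c a b) := hc.bil_eS (ha.bil_eS hb _ _) _ _

lemma bil_sub_one {a b : ℤ → ℂ} (ha : LOne a) (hb : LOne b) (f : ℤ → ℤ → ℝ) (l : ℤ) :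
    bil (eS ρ f) a b l = bil (fun k j => eS ρ f k j - 1) a b l + conv a b l := by
  rw [bil_sub_symbol (ha.bilSummable_eS hb ρ f l) (ha.bilSummable_one hb l), conv]
  ring

lemma conv_sub_left {a a' b : ℤ → ℂ} (ha : LOne a) (ha' : LOne a') (hb : LOne b) :
    conv (a - a') b = conv a b - conv a' b :=
  funext fun l => bil_sub_left (ha.bilSummable_one hb l) (ha'.bilSummable_one hb l)

lemma conv_sub_right {a b b' : ℤ → ℂ} (ha : LOne a) (hb : LOne b) (hb' : LOne b') :
    conv a (b - b') = conv a b - conv a b' :=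
  funext fun l => bil_sub_right (ha.bilSummable_one hb l) (ha.bilSummable_one hb' l)

/-- Replacing the symbol of `tri` by `1` costs two derivatives. -/
lemma enorm_tri_sub_tri_zero_le (h0 : 0 ≤ ρ) (hρ : ρ ≤ τ) {c a b : ℤ → ℂ} {κ₁ κ₂ κ₃ : ℝ≥0∞}
    (hlc : LOne c) (hla : LOne a) (hlb : LOne b)
    (hc : ∀ l, ‖c l‖ₑ ≤ κ₁ * M l) (ha : ∀ l, ‖a l‖ₑ ≤ κ₂ * M l) (hb : ∀ l, ‖b l‖ₑ ≤ κ₃ * M l)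
    (l : ℤ) :
    ‖tri L ρ c a b l - tri L 0 c a b l‖ₑ ≤ 6 * ENNReal.ofReal τ * (κ₁ * κ₂ * κ₃) *
      ((om L ^ 2 * M) ⊛ (om L * M) ⊛ (om L * M)) l := by
  set t := ENNReal.ofReal τ
  set Q : ℤ → ℝ≥0∞ := (om L ^ 2 * M) ⊛ (om L * M) ⊛ (om L * M) with hQ
  have hMM2 : M ≤ om L ^ 2 * M := fun l => by
    simpa using mul_le_mul' (one_le_pow₀ (one_le_om L l) (n := 2)) (le_refl (M l))
  -- The splitting e^{iρα}e^{iρβ} - 1 = (e^{iρα} - 1)e^{iρβ} + (e^{iρβ} - 1).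
  have e : tri L ρ c a b l - tri L 0 c a b l =
      bil (fun k j => eS ρ (alpha L) k j - 1) c (bil (eS ρ (beta L)) a b) l +
      conv c (bil (fun k j => eS ρ (beta L) k j - 1) a b) l := by
    have h1 : (bil (fun k j => eS ρ (beta L) k j - 1) a b) =
        bil (eS ρ (beta L)) a b - conv a b := by
      funext j
      rw [Pi.sub_apply, bil_sub_one hla hlb]; ring
    rw [tri_zero, h1, conv_sub_right hlc (hla.bil_eS hlb _ _) (hla.conv hlb), tri,
      bil_sub_one hlc (hla.bil_eS hlb _ _), Pi.sub_apply]
    ring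
  rw [e]
  have b1 : ‖bil (fun k j => eS ρ (alpha L) k j - 1) c (bil (eS ρ (beta L)) a b) l‖ₑ ≤
      4 * t * (κ₁ * κ₂ * κ₃) * Q l := by
    have hin : ∀ j, ‖bil (eS ρ (beta L)) a b j‖ₑ ≤ κ₂ * κ₃ * (M ⊛ M) j := fun j => by
      have := enorm_bil_le_of_norm_le_one (A := κ₂ • M) (B := κ₃ • M)
        (fun k j => (norm_eS ρ (beta L) k j).le) (fun l => ha l) (fun l => hb l) j
      rwa [cv_smul_left, cv_smul_right, smul_smul] at this
    have h := enorm_bil_le (σ := fun k j => eS ρ (alpha L) k j - 1) (a := c)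
      (b := bil (eS ρ (beta L)) a b)
      (A := (4 * t * κ₁) • (om L ^ 2 * M)) (B := (κ₂ * κ₃) • (om L * (M ⊛ M)))
      (fun k j => by
        simp only [Pi.smul_apply, Pi.mul_apply, Pi.pow_apply, smul_eq_mul]
        calc _ ≤ (t * (4 * (om L k ^ 2 * om L j))) * (κ₁ * M k) * (κ₂ * κ₃ * (M ⊛ M) j) := by
              gcongr
              · exact (enorm_exp_sub_one_le h0 hρ _).trans (by gcongr; exact abs_alpha_le' L k j)
              · exact hc k
              · exact hin j
          _ = _ := by ring) l
    refine h.trans ?_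
    rw [cv_smul_left, cv_smul_right, smul_smul, Pi.smul_apply, smul_eq_mul]
    refine (mul_le_mul' le_rfl (cv_mono le_rfl (om_mul_cv_le L M M) l)).trans (le_of_eq ?_)
    ring
  have b2 : ‖conv c (bil (fun k j => eS ρ (beta L) k j - 1) a b) l‖ₑ ≤
      2 * t * (κ₁ * κ₂ * κ₃) * Q l := by
    have hin : ∀ j, ‖bil (fun k j => eS ρ (beta L) k j - 1) a b j‖ₑ ≤
        ((2 * t * (κ₂ * κ₃)) • ((om L * M) ⊛ (om L * M))) j := fun j => by
      have h := enorm_bil_le (σ := fun k j => eS ρ (beta L) k j - 1) (a := a) (b := b)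
        (A := (2 * t * κ₂) • (om L * M)) (B := κ₃ • (om L * M))
        (fun k j => by
          simp only [Pi.smul_apply, Pi.mul_apply, smul_eq_mul]
          calc _ ≤ (t * (2 * (om L k * om L j))) * (κ₂ * M k) * (κ₃ * M j) := by
                gcongr
                · exact (enorm_exp_sub_one_le h0 hρ _).trans (by gcongr; exact abs_beta_le L k j)
                · exact ha k
                · exact hb j
            _ = _ := by ring) j
      rw [cv_smul_left, cv_smul_right, smul_smul] at h
      refine h.trans (le_of_eq ?_)
      simp only [Pi.smul_apply, smul_eq_mul]
      ring
    have h := enorm_conv_le (a := c) (A := κ₁ • M) hc hin l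
    rw [cv_smul_left, cv_smul_right, smul_smul, Pi.smul_apply, smul_eq_mul] at h
    refine h.trans ((mul_le_mul' le_rfl (cv_mono hMM2 le_rfl l)).trans (le_of_eq ?_))
    ring
  calc _ ≤ _ := enorm_add_le _ _
    _ ≤ 4 * t * (κ₁ * κ₂ * κ₃) * Q l + 2 * t * (κ₁ * κ₂ * κ₃) * Q l := add_le_add b1 b2
    _ = _ := by ring

lemma conv_conv_sub {c a b c' a' b' : ℤ → ℂ} (hc : LOne c) (ha : LOne a) (hb : LOne b)
    (hc' : LOne c') (ha' : LOne a') (hb' : LOne b') (l : ℤ) :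
    conv c (conv a b) l - conv c' (conv a' b') l = conv (c - c') (conv a b) l +
      conv c' (conv (a - a') b) l + conv c' (conv a' (b - b')) l := by
  rw [conv_sub_left ha ha' hb, conv_sub_right ha' hb hb', conv_sub_left hc hc' (ha.conv hb),
    conv_sub_right hc' (ha.conv hb) (ha'.conv hb), conv_sub_right hc' (ha'.conv hb) (ha'.conv hb')]
  simp only [Pi.sub_apply]
  ring

/-- Comparison of the trilinear forms at times `ρ` and `0`. -/
lemma enorm_tri_sub_tri_le (h0 : 0 ≤ ρ) (hρ : ρ ≤ τ) {c a b c' a' b' : ℤ → ℂ}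
    {κ₁ κ₂ κ₃ : ℝ≥0∞} {D₁ D₂ D₃ : ℤ → ℝ≥0∞}
    (hlc : LOne c) (hla : LOne a) (hlb : LOne b)
    (hlc' : LOne c') (hla' : LOne a') (hlb' : LOne b')
    (hc : ∀ l, ‖c l‖ₑ ≤ κ₁ * M l) (ha : ∀ l, ‖a l‖ₑ ≤ κ₂ * M l) (hb : ∀ l, ‖b l‖ₑ ≤ κ₃ * M l)
    (hc' : ∀ l, ‖c' l‖ₑ ≤ κ₁ * M l) (ha' : ∀ l, ‖a' l‖ₑ ≤ κ₂ * M l)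
    (h₁ : ∀ l, ‖c l - c' l‖ₑ ≤ D₁ l) (h₂ : ∀ l, ‖a l - a' l‖ₑ ≤ D₂ l)
    (h₃ : ∀ l, ‖b l - b' l‖ₑ ≤ D₃ l) (l : ℤ) :
    ‖tri L ρ c a b l - tri L 0 c' a' b' l‖ₑ ≤ 6 * ENNReal.ofReal τ * (κ₁ * κ₂ * κ₃) *
      ((om L ^ 2 * M) ⊛ (om L * M) ⊛ (om L * M)) l + (κ₂ * κ₃ * (D₁ ⊛ M ⊛ M) l +
      κ₁ * κ₃ * (D₂ ⊛ M ⊛ M) l + κ₁ * κ₂ * (D₃ ⊛ M ⊛ M) l) := by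
  have e : tri L ρ c a b l - tri L 0 c' a' b' l = (tri L ρ c a b l - tri L 0 c a b l) +
      (conv (c - c') (conv a b) l + conv c' (conv (a - a') b) l +
        conv c' (conv a' (b - b')) l) := by
    rw [← conv_conv_sub hlc hla hlb hlc' hla' hlb', tri_zero, tri_zero]
    ring
  rw [e]
  refine (enorm_add_le _ _).trans (add_le_add
    (enorm_tri_sub_tri_zero_le h0 hρ hlc hla hlb hc ha hb l) ?_)
  refine (enorm_add_le _ _).trans (add_le_add ((enorm_add_le _ _).trans (add_le_add ?_ ?_)) ?_)
  · have h := enorm_conv_le (A := D₁) h₁ (enorm_conv_le (A := κ₂ • M) (B := κ₃ • M) ha hb) l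
    rwa [cv_smul_left, cv_smul_right, cv_smul_right, cv_smul_right, smul_smul] at h
  · have h := enorm_conv_le (A := κ₁ • M) hc' (enorm_conv_le (A := D₂) (B := κ₃ • M) h₂ hb) l
    rwa [cv_smul_left, cv_smul_right, cv_smul_right, smul_smul, cv_left_comm] at h
  · have h := enorm_conv_le (A := κ₁ • M) hc' (enorm_conv_le (A := κ₂ • M) (B := D₃) ha' h₃) l
    rwa [cv_smul_left, cv_smul_left, cv_smul_right, smul_smul, cv_comm M D₃, cv_left_comm] at h

end bounds

end

section

/-! ### Integrals of bilinear forms and the exponential series -/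

lemma continuousOn_tsum_of_enorm_le {ι : Type*} {f : ι → ℝ → ℂ} {F : ι → ℝ≥0∞} {τ : ℝ}
    (hc : ∀ i, ContinuousOn (f i) (Icc 0 τ)) (hF : ∀ i, ∀ ρ ∈ Icc 0 τ, ‖f i ρ‖ₑ ≤ F i)
    (hS : ∑' i, F i ≠ ⊤) : ContinuousOn (fun ρ => ∑' i, f i ρ) (Icc 0 τ) := by
  refine continuousOn_tsum hc (ENNReal.summable_toReal hS) fun i ρ hρ => ?_
  have := ENNReal.toReal_mono (ENNReal.ne_top_of_tsum_ne_top hS i) (hF i ρ hρ)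
  simpa using this

lemma intervalIntegral_tsum_of_enorm_le {ι : Type*} [Countable ι] {f : ι → ℝ → ℂ}
    {F : ι → ℝ≥0∞} {τ : ℝ} (hτ : 0 ≤ τ)
    (hc : ∀ i, ContinuousOn (f i) (Icc 0 τ)) (hF : ∀ i, ∀ ρ ∈ Icc 0 τ, ‖f i ρ‖ₑ ≤ F i)
    (hS : ∑' i, F i ≠ ⊤) :
    ∫ ρ in (0 : ℝ)..τ, ∑' i, f i ρ = ∑' i, ∫ ρ in (0 : ℝ)..τ, f i ρ := by
  have hb : ∀ i, ∀ ρ ∈ Icc 0 τ, ‖f i ρ‖ ≤ (F i).toReal := fun i ρ hρ => by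
    have := ENNReal.toReal_mono (ENNReal.ne_top_of_tsum_ne_top hS i) (hF i ρ hρ)
    simpa using this
  have hs := ENNReal.summable_toReal hS
  refine (intervalIntegral.hasSum_integral_of_dominated_convergence
    (fun i _ => (F i).toReal) (fun i => ?_) (fun i => ae_of_all _ fun ρ hρ => ?_)
    (ae_of_all _ fun _ _ => hs) (by simp) (ae_of_all _ fun ρ hρ => ?_)).tsum_eq.symm
  · rw [uIoc_of_le hτ]
    exact ((hc i).mono Ioc_subset_Icc_self).aestronglyMeasurable measurableSet_Ioc
  · rw [uIoc_of_le hτ] at hρ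
    exact hb i ρ (Ioc_subset_Icc_self hρ)
  · rw [uIoc_of_le hτ] at hρ
    exact (Summable.of_norm_bounded hs fun i => hb i ρ (Ioc_subset_Icc_self hρ)).hasSum

section

variable {σ : ℝ → ℤ → ℤ → ℂ} {a b : ℤ → ℂ} {A B : ℤ → ℝ≥0∞} {τ : ℝ} {l : ℤ}

lemma continuousOn_bil (hσ : ∀ k j, Continuous fun ρ => σ ρ k j)
    (h : ∀ ρ ∈ Icc 0 τ, ∀ k j, ‖σ ρ k j‖ₑ * ‖a k‖ₑ * ‖b j‖ₑ ≤ A k * B j)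
    (hfin : (A ⊛ B) l ≠ ⊤) : ContinuousOn (fun ρ => bil (σ ρ) a b l) (Icc 0 τ) :=
  continuousOn_tsum_of_enorm_le (F := fun k => A k * B (l - k))
    (fun k => by have := hσ k (l - k); fun_prop)
    (fun k ρ hρ => by simpa [enorm_mul] using h ρ hρ k (l - k)) hfin

lemma integral_bil (hτ : 0 ≤ τ) (hσ : ∀ k j, Continuous fun ρ => σ ρ k j)
    (h : ∀ ρ ∈ Icc 0 τ, ∀ k j, ‖σ ρ k j‖ₑ * ‖a k‖ₑ * ‖b j‖ₑ ≤ A k * B j)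
    (hfin : (A ⊛ B) l ≠ ⊤) :
    ∫ ρ in (0 : ℝ)..τ, bil (σ ρ) a b l = bil (fun k j => ∫ ρ in (0 : ℝ)..τ, σ ρ k j) a b l := by
  unfold bil
  rw [intervalIntegral_tsum_of_enorm_le hτ (F := fun k => A k * B (l - k))
    (fun k => by have := hσ k (l - k); fun_prop)
    (fun k ρ hρ => by simpa [enorm_mul] using h ρ hρ k (l - k)) hfin]
  refine tsum_congr fun k => ?_
  rw [← intervalIntegral.integral_mul_const, ← intervalIntegral.integral_mul_const]

lemma continuousOn_conv {d : ℝ → ℤ → ℂ} (hd : ∀ j, ContinuousOn (fun ρ => d ρ j) (Icc 0 τ))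
    (ha : ∀ k, ‖a k‖ₑ ≤ A k) (h : ∀ ρ ∈ Icc 0 τ, ∀ j, ‖d ρ j‖ₑ ≤ B j)
    (hfin : (A ⊛ B) l ≠ ⊤) : ContinuousOn (fun ρ => conv a (d ρ) l) (Icc 0 τ) :=
  continuousOn_tsum_of_enorm_le (F := fun k => A k * B (l - k))
    (fun k => by have := hd (l - k); fun_prop)
    (fun k ρ hρ => by
      simpa [enorm_mul] using mul_le_mul' (ha k) (h ρ hρ (l - k))) hfin

lemma integral_conv (hτ : 0 ≤ τ) {d : ℝ → ℤ → ℂ}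
    (hd : ∀ j, ContinuousOn (fun ρ => d ρ j) (Icc 0 τ))
    (ha : ∀ k, ‖a k‖ₑ ≤ A k) (h : ∀ ρ ∈ Icc 0 τ, ∀ j, ‖d ρ j‖ₑ ≤ B j)
    (hfin : (A ⊛ B) l ≠ ⊤) :
    ∫ ρ in (0 : ℝ)..τ, conv a (d ρ) l = conv a (fun j => ∫ ρ in (0 : ℝ)..τ, d ρ j) l := by
  unfold conv bil
  rw [intervalIntegral_tsum_of_enorm_le hτ (F := fun k => A k * B (l - k))
    (fun k => by have := hd (l - k); fun_prop)
    (fun k ρ hρ => by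
      simpa [enorm_mul] using mul_le_mul' (ha k) (h ρ hρ (l - k))) hfin]
  refine tsum_congr fun k => ?_
  rw [← intervalIntegral.integral_const_mul]

end

lemma enorm_intervalIntegral_le {f : ℝ → ℂ} {τ : ℝ} (hτ : 0 < τ) {Q : ℝ≥0∞}
    (h : ∀ ρ ∈ Icc 0 τ, ‖f ρ‖ₑ ≤ Q) : ‖∫ ρ in (0 : ℝ)..τ, f ρ‖ₑ ≤ ENNReal.ofReal τ * Q := by
  rw [intervalIntegral.integral_of_le hτ.le]
  refine (enorm_integral_le_lintegral_enorm _).trans ?_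
  calc ∫⁻ ρ in Ioc 0 τ, ‖f ρ‖ₑ ≤ ∫⁻ _ in Ioc 0 τ, Q :=
        setLIntegral_mono measurable_const fun ρ hρ => h ρ (Ioc_subset_Icc_self hρ)
    _ = _ := by simp [mul_comm]

/-- The even convolution powers of a nonnegative sequence. -/
def pw (A : ℤ → ℝ≥0∞) : ℕ → ℤ → ℝ≥0∞
  | 0 => Pi.single 0 1
  | m + 1 => A ⊛ A ⊛ pw A m

lemma Submul.n1_pw_le {p : ℤ → ℝ≥0∞} (hp : Submul p) (hp0 : p 0 = 1) (A : ℤ → ℝ≥0∞) (m : ℕ) :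
    n1 p (pw A m) ≤ (n1 p A ^ 2) ^ m := by
  induction m with
  | zero =>
    rw [pow_zero, pw, n1, tsum_eq_single 0]
    · simp [hp0]
    · intro l hl; simp [hl]
  | succ m ih =>
    calc n1 p (A ⊛ A ⊛ pw A m) ≤ n1 p A * (n1 p A * n1 p (pw A m)) :=
          (hp.n1_cv_le _ _).trans (mul_le_mul' le_rfl (hp.n1_cv_le _ _))
      _ ≤ n1 p A * (n1 p A * (n1 p A ^ 2) ^ m) := by gcongr
      _ = _ := by ring

lemma enorm_cub_le {a : ℤ → ℂ} {A : ℤ → ℝ≥0∞} (hA : ∀ l, A (-l) = A l) (ha : ∀ l, ‖a l‖ₑ ≤ A l)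
    (m : ℕ) (l : ℤ) : ‖cub a m l‖ₑ ≤ (pw A m ⊛ A) l := by
  induction m generalizing l with
  | zero =>
    rw [pw, cv_single_zero]
    exact ha l
  | succ m ih =>
    refine (enorm_conv_le (enorm_cj_le hA ha) (enorm_conv_le ha ih) l).trans (le_of_eq ?_)
    rw [pw, cv_assoc, cv_assoc]

/-- A majorant for the coefficients of `exp(|λ| |w|²)`, with an additional factor `3 ^ m`. -/
def expMaj (lam : ℝ) (A : ℤ → ℝ≥0∞) (l : ℤ) : ℝ≥0∞ :=
  ∑' m : ℕ, (3 * ‖(lam : ℂ)‖ₑ) ^ m / (m.factorial : ℝ≥0∞) * pw A m l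

lemma Submul.n1_expMaj_le {p : ℤ → ℝ≥0∞} (hp : Submul p) (hp0 : p 0 = 1) (lam : ℝ)
    {A : ℤ → ℝ≥0∞} {R : ℝ≥0∞} (hR : n1 p A ≤ R) :
    n1 p (expMaj lam A) ≤
      ∑' m : ℕ, (3 * ‖(lam : ℂ)‖ₑ * R ^ 2) ^ m / (m.factorial : ℝ≥0∞) := by
  have h := n1_tsum p fun (m : ℕ) l => (3 * ‖(lam : ℂ)‖ₑ) ^ m / (m.factorial : ℝ≥0∞) * pw A m l
  refine h.le.trans (ENNReal.tsum_le_tsum fun m => ?_)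
  have h1 : n1 p (fun l => (3 * ‖(lam : ℂ)‖ₑ) ^ m / (m.factorial : ℝ≥0∞) * pw A m l) =
      (3 * ‖(lam : ℂ)‖ₑ) ^ m / (m.factorial : ℝ≥0∞) * n1 p (pw A m) := n1_smul p (pw A m) _
  rw [h1]
  calc _ ≤ (3 * ‖(lam : ℂ)‖ₑ) ^ m / (m.factorial : ℝ≥0∞) * (R ^ 2) ^ m := by
        gcongr
        exact (hp.n1_pw_le hp0 A m).trans (by gcongr)
    _ = _ := by rw [mul_pow _ (R ^ 2), ENNReal.div_eq_inv_mul, ENNReal.div_eq_inv_mul]; ring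

lemma Submul.n1_expMaj_ne_top {p : ℤ → ℝ≥0∞} (hp : Submul p) (hp0 : p 0 = 1) (lam : ℝ)
    {A : ℤ → ℝ≥0∞} (hA : n1 p A ≠ ⊤) : n1 p (expMaj lam A) ≠ ⊤ :=
  ne_top_of_le_ne_top (tsum_pow_div_factorial_ne_top (by finiteness))
    (hp.n1_expMaj_le hp0 lam le_rfl)

lemma expMaj_cv (lam : ℝ) (A B : ℤ → ℝ≥0∞) (l : ℤ) : (expMaj lam A ⊛ B) l =
    ∑' m : ℕ, (3 * ‖(lam : ℂ)‖ₑ) ^ m / (m.factorial : ℝ≥0∞) * (pw A m ⊛ B) l := by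
  simp only [cv, expMaj, ← ENNReal.tsum_mul_right, ← ENNReal.tsum_mul_left]
  rw [ENNReal.tsum_comm]
  simp only [mul_assoc]

lemma enorm_I_mul_ofReal_mul (lam : ℝ) {τ : ℝ} (hτ : 0 ≤ τ) :
    ‖I * (lam : ℂ) * (τ : ℂ)‖ₑ = ‖(lam : ℂ)‖ₑ * ENNReal.ofReal τ := by
  have hI : ‖I‖ₑ = 1 := by rw [← ofReal_norm, Complex.norm_I, ENNReal.ofReal_one]
  have ht : ‖(τ : ℂ)‖ₑ = ENNReal.ofReal τ := by
    rw [← ofReal_norm, Complex.norm_real, Real.norm_eq_abs, abs_of_nonneg hτ]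
  rw [enorm_mul, enorm_mul, hI, ht, one_mul]

/-- The remainder of the exponential series after three terms. -/
def expTail (z : ℂ) (a : ℤ → ℂ) (l : ℤ) : ℂ :=
  expc z a l - (a l + z * cub a 1 l + z ^ 2 / 2 * cub a 2 l)

lemma LOne.summable_expc {a : ℤ → ℂ} (ha : LOne a) (z : ℂ) (l : ℤ) :
    Summable fun m : ℕ => z ^ m / m.factorial * DNLS.cub a m l := by
  refine Summable.of_norm ?_
  have h : ∑' m : ℕ, ‖z ^ m / m.factorial * DNLS.cub a m l‖ₑ ≠ ⊤ :=
    ne_top_of_le_ne_top (tsum_tsum_enorm_expc_ne_top z ha)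
      (ENNReal.tsum_le_tsum fun m => ENNReal.le_tsum l)
  simpa using ENNReal.summable_toReal h

/-- Three powers of τ are pulled out and the others are bounded by τ ≤ 1. The tail is a subsum of
the full series of the majorant, which is why `expMaj` is not shifted. -/
lemma enorm_expTail_le {lam τ : ℝ} (hτ : 0 ≤ τ) (hτ1 : τ ≤ 1) {a : ℤ → ℂ} {A : ℤ → ℝ≥0∞}
    (hla : LOne a) (hA : ∀ l, A (-l) = A l) (ha : ∀ l, ‖a l‖ₑ ≤ A l) (l : ℤ) :
    ‖expTail (I * lam * τ) a l‖ₑ ≤ ENNReal.ofReal τ ^ 3 * (expMaj lam A ⊛ A) l := by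
  set z : ℂ := I * lam * τ with hz
  have h := (hla.summable_expc z l).sum_add_tsum_nat_add 3
  have e : expTail z a l = ∑' m : ℕ, z ^ (m + 3) / (m + 3).factorial * cub a (m + 3) l := by
    rw [expTail, expc, ← h]
    simp [Finset.sum_range_succ, cub]
  rw [e, expMaj_cv, ← ENNReal.tsum_mul_left]
  refine (enorm_tsum_le' _).trans ?_
  have hle : ∀ m : ℕ, ‖z ^ (m + 3) / (m + 3).factorial * cub a (m + 3) l‖ₑ ≤
      (fun m : ℕ => ENNReal.ofReal τ ^ 3 * ((3 * ‖(lam : ℂ)‖ₑ) ^ m / (m.factorial : ℝ≥0∞) *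
        (pw A m ⊛ A) l)) (m + 3) := fun m => by
    rw [enorm_mul, enorm_pow_div_factorial, hz, enorm_I_mul_ofReal_mul lam hτ]
    beta_reduce
    rw [← mul_assoc]
    have ht : ENNReal.ofReal τ ^ m ≤ 1 := pow_le_one' (by simpa using hτ1) m
    refine mul_le_mul' ?_ (enorm_cub_le hA ha _ l)
    rw [← mul_div_assoc]
    gcongr
    calc (‖(lam : ℂ)‖ₑ * ENNReal.ofReal τ) ^ (m + 3) =
          ENNReal.ofReal τ ^ 3 * (ENNReal.ofReal τ ^ m * (1 * ‖(lam : ℂ)‖ₑ) ^ (m + 3)) := by ring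
      _ ≤ ENNReal.ofReal τ ^ 3 * (1 * (3 * ‖(lam : ℂ)‖ₑ) ^ (m + 3)) := by
          gcongr
          norm_num
      _ = _ := by ring
  exact (ENNReal.tsum_le_tsum hle).trans
    (ENNReal.tsum_comp_le_tsum_of_injective (add_left_injective 3) _)

end

section

/-! ### The local error -/

/-- The second-order term `DG(0, a)[-i G(0, a)]`. -/
def secondOrder (L lam : ℝ) (x a : ℤ → ℂ) : ℤ → ℂ :=
  conv x ((-I) • Gs L lam 0 x a) + (lam : ℂ) •
    (tri L 0 (cj ((-I) • Gs L lam 0 x a)) a a + tri L 0 (cj a) ((-I) • Gs L lam 0 x a) a +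
      tri L 0 (cj a) a ((-I) • Gs L lam 0 x a))

lemma LOne.Gs {x a : ℤ → ℂ} (hx : LOne x) (ha : LOne a) (L lam ρ : ℝ) : LOne (Gs L lam ρ x a) :=
  (hx.bil_eS ha _ _).add ((ha.cj.tri ha ha ρ).smul _)

/-- At ρ = 0 no phases remain, so this is a polynomial identity in the values of ξ, w and w̄; it
uses that ξ is real. It shows that the second Duhamel iterate supplies the two τ² corrections of the
step together with the quadratic term of exp(iλτ|w|²)w. -/
lemma secondOrder_eq {L : ℝ} [Fact (0 < 2 * L)] (lam : ℝ) {x a : ℤ → ℂ} (hx : LOne x)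
    (ha : LOne a) (hxr : cj x = x) :
    (-I / 2) • secondOrder L lam x a = (-(lam : ℂ) ^ 2 / 2) • cub a 2
      - (lam : ℂ) • conv x (conv (cj a) (conv a a)) - (1 / 2 : ℂ) • conv x (conv x a) := by
  have hG : Gs L lam 0 x a = conv x a + (lam : ℂ) • conv (cj a) (conv a a) := by
    rw [Gs, tri_zero, eS_zero]; rfl
  have hGl : LOne (Gs L lam 0 x a) := hx.Gs ha L lam 0
  set g := Gs L lam 0 x a with hg
  have hs : LOne ((-I) • g) := hGl.smul _
  have hc3 : LOne (conv (cj a) (conv a a)) := ha.cj.conv (ha.conv ha)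
  have hxx : LOne (conv x (conv x a)) := hx.conv (hx.conv ha)
  have hxc : LOne (conv x (conv (cj a) (conv a a))) := hx.conv hc3
  have t1 : LOne (conv (cj ((-I) • g)) (conv a a)) := hs.cj.conv (ha.conv ha)
  have t2 : LOne (conv (cj a) (conv ((-I) • g) a)) := ha.cj.conv (hs.conv ha)
  have t3 : LOne (conv (cj a) (conv a ((-I) • g))) := ha.cj.conv (ha.conv hs)
  have hneg : ∀ b c : ℤ → ℂ, b - c = b + (-1 : ℂ) • c := fun b c => by
    simp [sub_eq_add_neg]
  rw [secondOrder, ← hg, tri_zero, tri_zero, tri_zero, hneg, hneg]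
  refine LOne.ext_synth (L := L) ((((hx.conv hs).add (((t1.add t2).add t3).smul _))).smul _)
    ((((ha.cub 2).smul _).add ((hxc.smul _).smul _)).add ((hxx.smul _).smul _)) fun y => ?_
  have hxy : conj (synth x y : ℂ) = synth x y := by rw [← synth_cj, hxr]
  have hgy : synth g y = synth x y * synth a y +
      lam * (conj (synth a y) * (synth a y * synth a y)) := by
    rw [hG, (hx.conv ha).synth_add (hc3.smul _), synth_smul, hx.synth_conv ha,
      ha.cj.synth_conv (ha.conv ha), ha.synth_conv ha, synth_cj]
  rw [synth_smul, (hx.conv hs).synth_add (((t1.add t2).add t3).smul _), synth_smul,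
    (t1.add t2).synth_add t3, t1.synth_add t2, hx.synth_conv hs, hs.cj.synth_conv (ha.conv ha),
    ha.cj.synth_conv (hs.conv ha), ha.cj.synth_conv (ha.conv hs), ha.synth_conv ha,
    hs.synth_conv ha, ha.synth_conv hs, synth_cj, synth_cj, synth_smul, hgy,
    (((ha.cub 2).smul _).add ((hxc.smul _).smul _)).synth_add ((hxx.smul _).smul _),
    ((ha.cub 2).smul _).synth_add ((hxc.smul _).smul _), synth_smul, synth_smul, synth_smul,
    synth_smul, synth_smul, hx.synth_conv hc3, ha.cj.synth_conv (ha.conv ha), ha.synth_conv ha,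
    hx.synth_conv (hx.conv ha), hx.synth_conv ha, ha.synth_cub, synth_cj,
    ← Complex.conj_mul']
  simp only [map_mul, map_add, map_neg, Complex.conj_I, Complex.conj_ofReal, Complex.conj_conj,
    hxy]
  generalize synth x y = X
  generalize synth a y = w
  generalize conj w = w'
  linear_combination (1 / 2 * X * (X * w + lam * (w' * (w * w))) + lam / 2 *
    (w' * ((X * w + lam * (w' * (w * w))) * w) + w' * (w * (X * w + lam * (w' * (w * w)))) -
      (X * w' + lam * (w * (w' * w'))) * (w * w))) * Complex.I_sq

/-- A solution of the equation in the interaction picture on `[0, τ]`, with majorant `M`. -/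
structure LocalSol (L lam τ : ℝ) (x : ℤ → ℂ) (M : ℤ → ℝ≥0∞) (v : ℝ → ℤ → ℂ) : Prop where
  bound : ∀ ρ ∈ Icc 0 τ, ∀ l, ‖v ρ l‖ₑ ≤ M l
  bound_rhs : ∀ ρ ∈ Icc 0 τ, ∀ l, ‖Gs L lam ρ x (v ρ) l‖ₑ ≤ M l
  cont : ∀ l, ContinuousOn (fun ρ => Gs L lam ρ x (v ρ) l) (Icc 0 τ)
  eq : ∀ ρ ∈ Icc 0 τ, ∀ l, v ρ l = v 0 l - I * ∫ s in (0 : ℝ)..ρ, Gs L lam s x (v s) l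

/-- The approximation of `G(ρ, v(ρ))` underlying the integrator. -/
def approx (L lam τ : ℝ) (x a : ℤ → ℂ) (ρ : ℝ) (l : ℤ) : ℂ :=
  bil (psi L τ ρ) x a l + lam * (bil (eS ρ (alpha L)) (cj a) (conv a a) l +
    conv (cj a) (bil (eS ρ (beta L)) a a) l - conv (cj a) (conv a a) l) +
    ρ * secondOrder L lam x a l

/-- Thanks to the sine, no derivative falls on the second argument. Stability depends on this,
because nothing beyond the γ-weighted norms controls the numerical solution. -/
lemma enorm_psi_le {L τ ρ : ℝ} (hτ : 0 < τ) (hρ : ρ ∈ Icc 0 τ) (k j : ℤ) :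
    ‖psi L τ ρ k j‖ₑ ≤ 3 * om L k := by
  rw [psi, enorm_mul, ← ofReal_norm (Complex.exp _), norm_exp_I_mul, ENNReal.ofReal_one, one_mul,
    om, show (3 : ℝ≥0∞) = ENNReal.ofReal 3 by simp, ← ENNReal.ofReal_mul (by norm_num)]
  refine enorm_le_of_norm_le ((norm_add_le _ _).trans ?_)
  have h1 : ‖((ρ : ℂ) / τ)‖ ≤ 1 := by
    rw [← Complex.ofReal_div, Complex.norm_real, Real.norm_eq_abs, abs_of_nonneg
      (div_nonneg hρ.1 hτ.le), div_le_one hτ]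
    exact hρ.2
  have h2 : ‖((Real.sin (τ * freq L j) : ℝ) : ℂ)‖ ≤ 1 := by
    rw [Complex.norm_real]; exact Real.abs_sin_le_one _
  rw [norm_one, norm_mul, norm_mul, norm_mul, norm_mul, Complex.norm_I, Complex.norm_two,
    Complex.norm_real, Real.norm_eq_abs]
  have h3 : 2 * 1 * ‖((ρ : ℂ) / τ)‖ * |freq L k| * ‖((Real.sin (τ * freq L j) : ℝ) : ℂ)‖ ≤
      2 * 1 * 1 * |freq L k| * 1 := by gcongr
  linarith [abs_nonneg (freq L k)]

lemma continuous_psi (L τ : ℝ) (k j : ℤ) : Continuous fun ρ => psi L τ ρ k j := by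
  unfold psi; fun_prop

lemma continuous_eS (f : ℤ → ℤ → ℝ) (k j : ℤ) : Continuous fun ρ => eS ρ f k j := by
  unfold eS; fun_prop

section localError

variable {L lam τ : ℝ} {x : ℤ → ℂ} {M : ℤ → ℝ≥0∞} {v : ℝ → ℤ → ℂ}

lemma eS_bound {a b : ℤ → ℂ} {A B : ℤ → ℝ≥0∞} (ha : ∀ k, ‖a k‖ₑ ≤ A k) (hb : ∀ k, ‖b k‖ₑ ≤ B k)
    (ρ : ℝ) (f : ℤ → ℤ → ℝ) (k j : ℤ) : ‖eS ρ f k j‖ₑ * ‖a k‖ₑ * ‖b j‖ₑ ≤ A k * B j := by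
  rw [← ofReal_norm (eS ρ f k j), norm_eS, ENNReal.ofReal_one, one_mul]
  exact mul_le_mul' (ha k) (hb j)

lemma cv_ne_top {A B : ℤ → ℝ≥0∞} (hA : ∑' l, A l ≠ ⊤) (hB : ∑' l, B l ≠ ⊤) (l : ℤ) :
    (A ⊛ B) l ≠ ⊤ :=
  ne_top_of_le_ne_top (by rw [tsum_cv]; finiteness) (ENNReal.le_tsum (f := A ⊛ B) l)

lemma tsum_cv_ne_top {A B : ℤ → ℝ≥0∞} (hA : ∑' l, A l ≠ ⊤) (hB : ∑' l, B l ≠ ⊤) :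
    ∑' l, (A ⊛ B) l ≠ ⊤ := by
  rw [tsum_cv]; finiteness

/-- The integrated approximation is the integrator up to the tail of the exponential. -/
lemma integral_approx [Fact (0 < 2 * L)] (hτ : 0 < τ) (hxr : cj x = x) {a : ℤ → ℂ}
    (hM : ∀ l, M (-l) = M l) (hN : ∑' l, (om L * M) l ≠ ⊤) (hx : ∀ l, ‖x l‖ₑ ≤ M l)
    (ha : ∀ l, ‖a l‖ₑ ≤ M l) (l : ℤ) :
    (∀ l, ContinuousOn (fun ρ => approx L lam τ x a ρ l) (Icc 0 τ)) ∧
    a l - I * ∫ ρ in (0 : ℝ)..τ, approx L lam τ x a ρ l =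
      stepc L lam τ x a l - expTail (I * lam * τ) a l := by
  have hMt : ∑' l, M l ≠ ⊤ :=
    ne_top_of_le_ne_top hN (ENNReal.tsum_le_tsum (le_om_mul L M))
  have hMM := tsum_cv_ne_top hMt hMt
  have hla : LOne a := lOne_of_le ha hMt
  have hlx : LOne x := lOne_of_le hx hMt
  have hca := enorm_cj_le hM ha
  have haa : ∀ l, ‖conv a a l‖ₑ ≤ (M ⊛ M) l := enorm_conv_le ha ha
  have hpsi : ∀ ρ ∈ Icc 0 τ, ∀ k j, ‖psi L τ ρ k j‖ₑ * ‖x k‖ₑ * ‖a j‖ₑ ≤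
      ((3 : ℝ≥0∞) • (om L * M)) k * M j := fun ρ hρ k j => by
    simp only [Pi.smul_apply, Pi.mul_apply, smul_eq_mul]
    calc _ ≤ (3 * om L k) * M k * M j := by
          gcongr
          exacts [enorm_psi_le hτ hρ k j, hx k, ha j]
      _ = _ := by ring
  have h3N : ∑' l, ((3 : ℝ≥0∞) • (om L * M)) l ≠ ⊤ := by
    simp only [Pi.smul_apply, smul_eq_mul, ENNReal.tsum_mul_left]
    finiteness
  have c1 : ∀ l, ContinuousOn (fun ρ => bil (psi L τ ρ) x a l) (Icc 0 τ) := fun l =>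
    continuousOn_bil (continuous_psi L τ) hpsi (cv_ne_top h3N hMt l)
  have c2 : ∀ l, ContinuousOn (fun ρ => bil (eS ρ (alpha L)) (cj a) (conv a a) l) (Icc 0 τ) :=
    fun l => continuousOn_bil (continuous_eS _) (fun ρ _ => eS_bound hca haa ρ _)
      (cv_ne_top hMt hMM l)
  have c3 : ∀ l, ContinuousOn (fun ρ => bil (eS ρ (beta L)) a a l) (Icc 0 τ) :=
    fun l => continuousOn_bil (continuous_eS _) (fun ρ _ => eS_bound ha ha ρ _)
      (cv_ne_top hMt hMt l)
  have hb3 : ∀ ρ ∈ Icc 0 τ, ∀ j, ‖bil (eS ρ (beta L)) a a j‖ₑ ≤ (M ⊛ M) j := fun ρ _ =>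
    enorm_bil_le_of_norm_le_one (fun k j => (norm_eS _ _ _ _).le) ha ha
  have c4 : ∀ l, ContinuousOn (fun ρ => conv (cj a) (bil (eS ρ (beta L)) a a) l) (Icc 0 τ) :=
    fun l => continuousOn_conv c3 hca hb3 (cv_ne_top hMt hMM l)
  have c5 : ∀ l, ContinuousOn (fun ρ : ℝ => (ρ : ℂ) * secondOrder L lam x a l) (Icc 0 τ) :=
    fun l => by fun_prop
  have c6 : ∀ l, ContinuousOn (fun ρ : ℝ => (lam : ℂ) * (bil (eS ρ (alpha L)) (cj a) (conv a a) l +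
      conv (cj a) (bil (eS ρ (beta L)) a a) l - conv (cj a) (conv a a) l)) (Icc 0 τ) := fun l =>
    continuousOn_const.mul (((c2 l).add (c4 l)).sub continuousOn_const)
  refine ⟨fun l => ((c1 l).add (c6 l)).add (c5 l), ?_⟩
  have hii : ∀ {f : ℝ → ℂ}, ContinuousOn f (Icc 0 τ) → IntervalIntegrable f volume 0 τ :=
    fun hf => ContinuousOn.intervalIntegrable (by rwa [uIcc_of_le hτ.le])
  have i1 : ∫ ρ in (0 : ℝ)..τ, bil (psi L τ ρ) x a l = bil (psiI L τ) x a l :=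
    integral_bil hτ.le (continuous_psi L τ) hpsi (cv_ne_top h3N hMt l)
  have i2 : ∫ ρ in (0 : ℝ)..τ, bil (eS ρ (alpha L)) (cj a) (conv a a) l =
      bil (fun k j => phi τ (alpha L k j)) (cj a) (conv a a) l :=
    integral_bil hτ.le (continuous_eS _) (fun ρ _ => eS_bound hca haa ρ _) (cv_ne_top hMt hMM l)
  have i3 : ∫ ρ in (0 : ℝ)..τ, conv (cj a) (bil (eS ρ (beta L)) a a) l =
      conv (cj a) (bil (fun k j => phi τ (beta L k j)) a a) l := by
    rw [integral_conv hτ.le c3 hca hb3 (cv_ne_top hMt hMM l)]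
    congr 1
    funext j
    exact integral_bil hτ.le (continuous_eS _) (fun ρ _ => eS_bound ha ha ρ _)
      (cv_ne_top hMt hMt j)
  have i4 : ∫ ρ in (0 : ℝ)..τ, (ρ : ℂ) = (τ : ℂ) ^ 2 / 2 := by
    rw [intervalIntegral.integral_ofReal, integral_id]; push_cast; ring
  have c16 : ContinuousOn (fun ρ : ℝ => bil (psi L τ ρ) x a l +
      (lam : ℂ) * (bil (eS ρ (alpha L)) (cj a) (conv a a) l +
      conv (cj a) (bil (eS ρ (beta L)) a a) l - conv (cj a) (conv a a) l)) (Icc 0 τ) :=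
    (c1 l).add (c6 l)
  have c24 : ContinuousOn (fun ρ : ℝ => bil (eS ρ (alpha L)) (cj a) (conv a a) l +
      conv (cj a) (bil (eS ρ (beta L)) a a) l) (Icc 0 τ) := (c2 l).add (c4 l)
  unfold approx
  rw [intervalIntegral.integral_add (hii c16) (hii (c5 l)),
    intervalIntegral.integral_add (hii (c1 l)) (hii (c6 l)), intervalIntegral.integral_const_mul,
    intervalIntegral.integral_sub (hii c24) (by simp),
    intervalIntegral.integral_add (hii (c2 l)) (hii (c4 l)), i1, i2, i3,
    intervalIntegral.integral_mul_const, i4, intervalIntegral.integral_const]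
  -- The subtracted product, integrated over [0, τ], is the linear term of the exponential series
  -- and `secondOrder` contains the quadratic one, so only the tail is left over.
  have hS := congrFun (secondOrder_eq (L := L) lam hlx hla hxr) l
  simp only [Pi.smul_apply, Pi.sub_apply, smul_eq_mul] at hS
  simp only [stepc, expTail, Pi.add_apply, Pi.sub_apply, Pi.smul_apply, smul_eq_mul, cub,
    sub_zero, Complex.real_smul]
  simp only [cub] at hS
  linear_combination (τ ^ 2 : ℂ) * hS - (lam ^ 2 * τ ^ 2 / 2 *
    conv (cj a) (conv a (conv (cj a) (conv a a))) l : ℂ) * Complex.I_sq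

end localError

end

section

/-! ### Bounds for the local error -/

section localError

variable {L lam τ : ℝ} {x : ℤ → ℂ} {M : ℤ → ℝ≥0∞} {v : ℝ → ℤ → ℂ}

/-- The majorant `(ω² M) * (ω M) * (ω M)` of a trilinear form with two derivatives. -/
def triMaj (L : ℝ) (M : ℤ → ℝ≥0∞) : ℤ → ℝ≥0∞ := (om L ^ 2 * M) ⊛ (om L * M) ⊛ (om L * M)

/-- A majorant of the derivative in time of the right-hand side. -/
def rhsMaj (L lam : ℝ) (M : ℤ → ℝ≥0∞) : ℤ → ℝ≥0∞ :=
  (3 : ℝ≥0∞) • ((om L ^ 2 * M) ⊛ (om L * M)) + M ⊛ M +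
    ‖(lam : ℂ)‖ₑ • ((6 : ℝ≥0∞) • triMaj L M + (3 : ℝ≥0∞) • (M ⊛ M ⊛ M))

lemma enorm_bil_eta_sub_one_le {ρ : ℝ} (h0 : 0 ≤ ρ) (hρ : ρ ≤ τ) {d : ℤ → ℂ} {c : ℝ≥0∞}
    (hx : ∀ l, ‖x l‖ₑ ≤ M l) (hd : ∀ l, ‖d l‖ₑ ≤ c * M l) (l : ℤ) :
    ‖bil (fun k j => eS ρ (eta L) k j - 1) x d l‖ₑ ≤
      3 * ENNReal.ofReal τ * c * ((om L ^ 2 * M) ⊛ (om L * M)) l := by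
  have h := enorm_bil_le (σ := fun k j => eS ρ (eta L) k j - 1) (a := x) (b := d)
    (A := (3 * ENNReal.ofReal τ * c) • (om L ^ 2 * M)) (B := om L * M)
    (fun k j => by
      simp only [Pi.smul_apply, Pi.mul_apply, Pi.pow_apply, smul_eq_mul]
      calc _ ≤ (ENNReal.ofReal τ * (3 * (om L k ^ 2 * om L j))) * M k * (c * M j) := by
            gcongr
            · exact (enorm_exp_sub_one_le h0 hρ _).trans (by gcongr; exact abs_eta_le L k j)
            · exact hx k
            · exact hd j
        _ = _ := by ring) l
  rwa [cv_smul_left] at h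

lemma LocalSol.enorm_sub_le (h : LocalSol L lam τ x M v) {ρ : ℝ} (hρ : ρ ∈ Icc 0 τ) (l : ℤ) :
    ‖v ρ l - v 0 l‖ₑ ≤ ENNReal.ofReal τ * M l := by
  have e : v ρ l - v 0 l = -I * ∫ s in (0 : ℝ)..ρ, Gs L lam s x (v s) l := by
    rw [h.eq ρ hρ l]; ring
  have hI : ‖-I‖ₑ = 1 := by rw [← ofReal_norm, norm_neg, Complex.norm_I, ENNReal.ofReal_one]
  rcases hρ.1.eq_or_lt with h0 | h0
  · simp [← h0]
  · rw [e, enorm_mul, hI, one_mul]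
    refine (enorm_intervalIntegral_le h0 fun s hs =>
      h.bound_rhs s ⟨hs.1, hs.2.trans hρ.2⟩ l).trans ?_
    gcongr
    exact hρ.2

lemma enorm_smul_ofReal {ρ : ℝ} (h0 : 0 ≤ ρ) (hρ : ρ ≤ τ) {z : ℂ} {C : ℝ≥0∞} (hz : ‖z‖ₑ ≤ C) :
    ‖(ρ : ℂ) * z‖ₑ ≤ ENNReal.ofReal τ * C := by
  rw [enorm_mul]
  gcongr
  refine enorm_le_of_norm_le ?_
  rwa [Complex.norm_real, Real.norm_eq_abs, abs_of_nonneg h0]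

lemma cj_smul_ofReal (ρ : ℝ) (a : ℤ → ℂ) : cj ((ρ : ℂ) • a) = (ρ : ℂ) • cj a := by
  funext l; simp [cj]

lemma enorm_neg_I : ‖-I‖ₑ = 1 := by
  rw [← ofReal_norm, norm_neg, Complex.norm_I, ENNReal.ofReal_one]

/-- Phases and solution both move by O(τ) within a step. Moving a phase costs two derivatives on one
factor and at most one on the others, which is admissible. -/
lemma LocalSol.enorm_rhs_sub_le
    (h : LocalSol L lam τ x M v) (hM : ∀ l, M (-l) = M l) (hN : ∑' l, (om L * M) l ≠ ⊤)
    (hx : ∀ l, ‖x l‖ₑ ≤ M l) {ρ : ℝ} (hρ : ρ ∈ Icc 0 τ) (l : ℤ) :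
    ‖Gs L lam ρ x (v ρ) l - Gs L lam 0 x (v 0) l‖ₑ ≤ ENNReal.ofReal τ * rhsMaj L lam M l := by
  have hMt : ∑' l, M l ≠ ⊤ := ne_top_of_le_ne_top hN (ENNReal.tsum_le_tsum (le_om_mul L M))
  have h0 : (0 : ℝ) ∈ Icc 0 τ := ⟨le_rfl, hρ.1.trans hρ.2⟩
  have hlx : LOne x := lOne_of_le hx hMt
  have hlv : LOne (v ρ) := lOne_of_le (h.bound ρ hρ) hMt
  have hla : LOne (v 0) := lOne_of_le (h.bound 0 h0) hMt
  set t := ENNReal.ofReal τ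
  have hv : ∀ l, ‖v ρ l‖ₑ ≤ 1 * M l := by simpa using h.bound ρ hρ
  have ha : ∀ l, ‖v 0 l‖ₑ ≤ 1 * M l := by simpa using h.bound 0 h0
  have hcv := enorm_cj_le (A := fun l => 1 * M l) (by simpa using hM) hv
  have hca := enorm_cj_le (A := fun l => 1 * M l) (by simpa using hM) ha
  have hd : ∀ l, ‖v ρ l - v 0 l‖ₑ ≤ (t • M) l := h.enorm_sub_le hρ
  have hcd : ∀ l, ‖cj (v ρ) l - cj (v 0) l‖ₑ ≤ (t • M) l := fun l => by
    have := enorm_cj_le (a := v ρ - v 0) (A := t • M) (by simpa using fun l => by rw [hM]) hd l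
    rwa [cj_sub] at this
  have e : Gs L lam ρ x (v ρ) l - Gs L lam 0 x (v 0) l =
      bil (fun k j => eS ρ (eta L) k j - 1) x (v ρ) l + conv x (v ρ - v 0) l +
      lam * (tri L ρ (cj (v ρ)) (v ρ) (v ρ) l - tri L 0 (cj (v 0)) (v 0) (v 0) l) := by
    have h1 : bil (eS 0 (eta L)) x (v 0) = conv x (v 0) := by rw [eS_zero]; rfl
    rw [Gs, Gs, h1, conv_sub_right hlx hlv hla]
    simp only [Pi.add_apply, Pi.sub_apply, Pi.smul_apply, smul_eq_mul]
    rw [bil_sub_one hlx hlv]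
    ring
  have b1 := enorm_bil_eta_sub_one_le (L := L) hρ.1 hρ.2 hx hv l
  have b2 := enorm_conv_le (b := v ρ - v 0) hx hd l
  have b3 := enorm_tri_sub_tri_le (L := L) hρ.1 hρ.2 hlv.cj hlv hlv hla.cj hla hla hcv hv hv
    hca ha hcd hd hd l
  rw [e]
  refine (enorm_add_le _ _).trans ((add_le_add ((enorm_add_le _ _).trans (add_le_add b1 b2))
    ((enorm_mul _ _).le.trans (mul_le_mul' le_rfl b3))).trans (le_of_eq ?_))
  simp only [rhsMaj, triMaj, cv_smul_left, cv_smul_right, Pi.add_apply, Pi.smul_apply, smul_eq_mul]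
  ring

/-- Integrating the previous bound: the first-order Taylor expansion of the solution within a step.
-/
lemma LocalSol.enorm_sub_sub_le
    (h : LocalSol L lam τ x M v) (hM : ∀ l, M (-l) = M l) (hN : ∑' l, (om L * M) l ≠ ⊤)
    (hx : ∀ l, ‖x l‖ₑ ≤ M l) {ρ : ℝ} (hρ : ρ ∈ Icc 0 τ) (l : ℤ) :
    ‖v ρ l - v 0 l - ρ * ((-I) • Gs L lam 0 x (v 0)) l‖ₑ ≤
      ENNReal.ofReal τ ^ 2 * rhsMaj L lam M l := by
  rcases hρ.1.eq_or_lt with h0 | h0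
  · simp [← h0]
  have hc : ContinuousOn (fun s => Gs L lam s x (v s) l) (uIcc 0 ρ) := by
    rw [uIcc_of_le h0.le]
    exact (h.cont l).mono (Icc_subset_Icc_right hρ.2)
  have e : v ρ l - v 0 l - ρ * ((-I) • Gs L lam 0 x (v 0)) l =
      -I * ∫ s in (0 : ℝ)..ρ, (Gs L lam s x (v s) l - Gs L lam 0 x (v 0) l) := by
    rw [intervalIntegral.integral_sub hc.intervalIntegrable (by simp),
      intervalIntegral.integral_const, h.eq ρ hρ l]
    simp only [Pi.smul_apply, smul_eq_mul, sub_zero, Complex.real_smul]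
    ring
  rw [e, enorm_mul, enorm_neg_I, one_mul, sq, mul_assoc]
  refine (enorm_intervalIntegral_le h0 fun s hs => h.enorm_rhs_sub_le hM hN hx
    ⟨hs.1, hs.2.trans hρ.2⟩ l).trans ?_
  gcongr
  exact hρ.2

end localError

end

/-! ### Second-order Taylor remainder of the right-hand side. -/

section

section remainder

variable {L lam τ : ℝ} {x : ℤ → ℂ} {M : ℤ → ℝ≥0∞} {v : ℝ → ℤ → ℂ}

lemma tri_sub_tri {c a b c' a' b' : ℤ → ℂ} (hc : LOne c) (ha : LOne a) (hb : LOne b)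
    (hc' : LOne c') (ha' : LOne a') (hb' : LOne b') (ρ : ℝ) (l : ℤ) :
    tri L ρ c a b l - tri L ρ c' a' b' l = tri L ρ (c - c') a b l +
      tri L ρ c' (a - a') b l + tri L ρ c' a' (b - b') l := by
  have e1 : bil (eS ρ (beta L)) (a - a') b = bil (eS ρ (beta L)) a b - bil (eS ρ (beta L)) a' b :=
    funext fun l => bil_sub_left (ha.bilSummable_eS hb _ _ l) (ha'.bilSummable_eS hb _ _ l)
  have e2 : bil (eS ρ (beta L)) a' (b - b') =
      bil (eS ρ (beta L)) a' b - bil (eS ρ (beta L)) a' b' :=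
    funext fun l => bil_sub_right (ha'.bilSummable_eS hb _ _ l) (ha'.bilSummable_eS hb' _ _ l)
  unfold tri
  rw [e1, e2, bil_sub_left (hc.bilSummable_eS (ha.bil_eS hb _ _) _ _ l)
      (hc'.bilSummable_eS (ha.bil_eS hb _ _) _ _ l),
    bil_sub_right (hc'.bilSummable_eS (ha.bil_eS hb _ _) _ _ l)
      (hc'.bilSummable_eS (ha'.bil_eS hb _ _) _ _ l),
    bil_sub_right (hc'.bilSummable_eS (ha'.bil_eS hb _ _) _ _ l)
      (hc'.bilSummable_eS (ha'.bil_eS hb' _ _) _ _ l)]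
  ring

lemma enorm_tri_le {c a b : ℤ → ℂ} {A B C : ℤ → ℝ≥0∞} (hc : ∀ l, ‖c l‖ₑ ≤ C l)
    (ha : ∀ l, ‖a l‖ₑ ≤ A l) (hb : ∀ l, ‖b l‖ₑ ≤ B l) (ρ : ℝ) (l : ℤ) :
    ‖tri L ρ c a b l‖ₑ ≤ (C ⊛ A ⊛ B) l :=
  enorm_bil_le_of_norm_le_one (fun _ _ => (norm_eS _ _ _ _).le) hc
    (enorm_bil_le_of_norm_le_one (fun _ _ => (norm_eS _ _ _ _).le) ha hb) l

lemma even_weight_mul (hM : ∀ l, M (-l) = M l) (n : ℕ) (l : ℤ) :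
    (om L ^ n * M) (-l) = (om L ^ n * M) l := by
  simp [om_neg, hM]

lemma triMaj_even (hM : ∀ l, M (-l) = M l) (l : ℤ) : triMaj L M (-l) = triMaj L M l := by
  have h1 : ∀ l, (om L * M) (-l) = (om L * M) l := fun l => by simp [om_neg, hM]
  exact cv_even (even_weight_mul hM 2) (cv_even h1 h1) l

lemma rhsMaj_even (hM : ∀ l, M (-l) = M l) (l : ℤ) : rhsMaj L lam M (-l) = rhsMaj L lam M l := by
  have h1 : ∀ l, (om L * M) (-l) = (om L * M) l := fun l => by simp [om_neg, hM]
  simp only [rhsMaj, Pi.add_apply, Pi.smul_apply, triMaj_even hM, cv_even hM hM,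
    cv_even hM (cv_even hM hM), cv_even (even_weight_mul hM 2) h1]

/-- A majorant of the second-order remainder of the right-hand side. -/
def remMaj (L lam : ℝ) (M : ℤ → ℝ≥0∞) : ℤ → ℝ≥0∞ :=
  (3 : ℝ≥0∞) • ((om L ^ 2 * M) ⊛ (om L * M)) + M ⊛ rhsMaj L lam M +
    ‖(lam : ℂ)‖ₑ • ((18 : ℝ≥0∞) • triMaj L M + (3 : ℝ≥0∞) • (rhsMaj L lam M ⊛ M ⊛ M) +
      (6 : ℝ≥0∞) • (M ⊛ M ⊛ M))

/-- Replacing v(ρ) by v(0) slot by slot leaves increments that are already O(τ). Removing a phase,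
or replacing a further v(ρ), gains a second τ, while the increment differs from its linear part by
O(τ²). -/
lemma LocalSol.enorm_remainder_le
    (h : LocalSol L lam τ x M v) (hM : ∀ l, M (-l) = M l) (hN : ∑' l, (om L * M) l ≠ ⊤)
    (hx : ∀ l, ‖x l‖ₑ ≤ M l) {ρ : ℝ} (hρ : ρ ∈ Icc 0 τ) (l : ℤ) :
    ‖Gs L lam ρ x (v ρ) l - Gs L lam ρ x (v 0) l - ρ * secondOrder L lam x (v 0) l‖ₑ ≤
      ENNReal.ofReal τ ^ 2 * remMaj L lam M l := by
  have hMt : ∑' l, M l ≠ ⊤ := ne_top_of_le_ne_top hN (ENNReal.tsum_le_tsum (le_om_mul L M))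
  have h0 : (0 : ℝ) ∈ Icc 0 τ := ⟨le_rfl, hρ.1.trans hρ.2⟩
  have hlx : LOne x := lOne_of_le hx hMt
  have hlv : LOne (v ρ) := lOne_of_le (h.bound ρ hρ) hMt
  have hla : LOne (v 0) := lOne_of_le (h.bound 0 h0) hMt
  set t := ENNReal.ofReal τ
  set K := rhsMaj L lam M
  set a := v 0
  set s : ℤ → ℂ := (-I) • Gs L lam 0 x a with hs
  have hls : LOne s := (hlx.Gs hla L lam 0).smul _
  have hd : ∀ l, ‖(v ρ - a) l‖ₑ ≤ t * M l := h.enorm_sub_le hρ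
  have hsM : ∀ l, ‖s l‖ₑ ≤ M l := fun l => by
    rw [hs, Pi.smul_apply, smul_eq_mul, enorm_mul, enorm_neg_I, one_mul]
    exact h.bound_rhs 0 h0 l
  have hrs : ∀ l, ‖((ρ : ℂ) • s) l‖ₑ ≤ t * M l := fun l => enorm_smul_ofReal hρ.1 hρ.2 (hsM l)
  have hds : ∀ l, ‖(v ρ - a) l - ((ρ : ℂ) • s) l‖ₑ ≤ (t ^ 2 • K) l :=
    h.enorm_sub_sub_le hM hN hx hρ
  have htM : ∀ l, t * M (-l) = t * M l := fun l => by rw [hM]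
  have hcd := enorm_cj_le (A := fun l => t * M l) htM hd
  have hcrs := enorm_cj_le (A := fun l => t * M l) htM hrs
  have hcds : ∀ l, ‖cj (v ρ - a) l - cj ((ρ : ℂ) • s) l‖ₑ ≤ (t ^ 2 • K) l := fun l => by
    have := enorm_cj_le (a := (v ρ - a) - (ρ : ℂ) • s) (A := t ^ 2 • K)
      (fun l => congrArg (t ^ 2 * ·) (rhsMaj_even hM l)) hds l
    rwa [cj_sub] at this
  have hv : ∀ l, ‖v ρ l‖ₑ ≤ 1 * M l := by simpa using h.bound ρ hρ
  have ha : ∀ l, ‖a l‖ₑ ≤ 1 * M l := by simpa using h.bound 0 h0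
  have hca := enorm_cj_le (A := fun l => 1 * M l) (by simpa using hM) ha
  have hd' : ∀ l, ‖v ρ l - a l‖ₑ ≤ (t • M) l := hd
  have hz : ∀ (b : ℤ → ℂ) l, ‖b l - b l‖ₑ ≤ (t • M) l := fun b l => by simp
  have hrls : LOne ((ρ : ℂ) • s) := hls.smul _
  have hld : LOne (v ρ - a) := hlv.sub hla
  have b1 := enorm_bil_eta_sub_one_le (L := L) hρ.1 hρ.2 hx hd l
  have b2 := enorm_conv_le (b := (v ρ - a) - (ρ : ℂ) • s) hx hds l
  have b3 := enorm_tri_sub_tri_le (L := L) hρ.1 hρ.2 hld.cj hlv hlv hrls.cj hla hla hcd hv hv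
    hcrs ha hcds hd' hd' l
  have b4 := enorm_tri_sub_tri_le (L := L) hρ.1 hρ.2 hla.cj hld hlv hla.cj hrls hla hca hd hv
    hca hrs (hz _) hds hd' l
  have b5 := enorm_tri_sub_tri_le (L := L) hρ.1 hρ.2 hla.cj hla hld hla.cj hla hrls hca ha hd
    hca ha (hz _) (hz _) hds l
  have e : Gs L lam ρ x (v ρ) l - Gs L lam ρ x a l - ρ * secondOrder L lam x a l =
      bil (fun k j => eS ρ (eta L) k j - 1) x (v ρ - a) l +
      conv x ((v ρ - a) - (ρ : ℂ) • s) l +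
      lam * ((tri L ρ (cj (v ρ - a)) (v ρ) (v ρ) l - tri L 0 (cj ((ρ : ℂ) • s)) a a l) +
        (tri L ρ (cj a) (v ρ - a) (v ρ) l - tri L 0 (cj a) ((ρ : ℂ) • s) a l) +
        (tri L ρ (cj a) a (v ρ - a) l - tri L 0 (cj a) a ((ρ : ℂ) • s) l)) := by
    have h1 := tri_sub_tri (L := L) hlv.cj hlv hlv hla.cj hla hla ρ l
    have h2 := bil_sub_right (hlx.bilSummable_eS hlv ρ (eta L) l)
      (hlx.bilSummable_eS hla ρ (eta L) l)
    have h3 := bil_sub_one hlx hld (ρ := ρ) (eta L) l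
    rw [← cj_sub] at h1
    have h4 : conv x ((v ρ - a) - (ρ : ℂ) • s) l = conv x (v ρ - a) l - ρ * conv x s l := by
      rw [conv_sub_right hlx hld hrls, Pi.sub_apply, conv, conv, bil_smul_right]; rfl
    rw [h4, secondOrder, ← hs, Gs, Gs, cj_smul_ofReal]
    simp only [tri, bil_smul_left, bil_smul_right, Pi.add_apply, Pi.smul_apply, smul_eq_mul] at h1 ⊢
    linear_combination lam * h1 - h2 + h3
  rw [e]
  refine (enorm_add_le _ _).trans ((add_le_add ((enorm_add_le _ _).trans (add_le_add b1 b2))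
    ((enorm_mul _ _).le.trans (mul_le_mul' le_rfl ((enorm_add_le _ _).trans (add_le_add
      ((enorm_add_le _ _).trans (add_le_add b3 b4)) b5))))).trans (le_of_eq ?_))
  simp only [remMaj, triMaj, cv_smul_left, cv_smul_right, Pi.add_apply, Pi.smul_apply, smul_eq_mul]
  ring

/-- A version with one power of τ and no derivatives. The crude error is measured in ℓ¹, where ω²M
is not available. -/
lemma LocalSol.enorm_remainder_le'
    (h : LocalSol L lam τ x M v) (hM : ∀ l, M (-l) = M l) (hN : ∑' l, (om L * M) l ≠ ⊤)
    (hx : ∀ l, ‖x l‖ₑ ≤ M l) {ρ : ℝ} (hρ : ρ ∈ Icc 0 τ) (l : ℤ) :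
    ‖Gs L lam ρ x (v ρ) l - Gs L lam ρ x (v 0) l - ρ * secondOrder L lam x (v 0) l‖ₑ ≤
      ENNReal.ofReal τ * (2 * ((M ⊛ M) l + 3 * ‖(lam : ℂ)‖ₑ * (M ⊛ M ⊛ M) l)) := by
  have hMt : ∑' l, M l ≠ ⊤ := ne_top_of_le_ne_top hN (ENNReal.tsum_le_tsum (le_om_mul L M))
  have h0 : (0 : ℝ) ∈ Icc 0 τ := ⟨le_rfl, hρ.1.trans hρ.2⟩
  have hlx : LOne x := lOne_of_le hx hMt
  have hlv : LOne (v ρ) := lOne_of_le (h.bound ρ hρ) hMt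
  have hla : LOne (v 0) := lOne_of_le (h.bound 0 h0) hMt
  set t := ENNReal.ofReal τ
  set a := v 0
  set s : ℤ → ℂ := (-I) • Gs L lam 0 x a with hs
  have hd : ∀ l, ‖(v ρ - a) l‖ₑ ≤ (t • M) l := h.enorm_sub_le hρ
  have hsM : ∀ l, ‖s l‖ₑ ≤ M l := fun l => by
    rw [hs, Pi.smul_apply, smul_eq_mul, enorm_mul, enorm_neg_I, one_mul]
    exact h.bound_rhs 0 h0 l
  have hcd := enorm_cj_le (A := t • M) (fun l => by rw [Pi.smul_apply, Pi.smul_apply, hM]) hd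
  have hcs := enorm_cj_le hM hsM
  have hv := h.bound ρ hρ
  have ha := h.bound 0 h0
  have hca := enorm_cj_le hM ha
  have b1 := enorm_bil_le_of_norm_le_one (fun k j => (norm_eS ρ (eta L) k j).le) hx hd l
  have b2 := enorm_tri_le (L := L) hcd hv hv ρ l
  have b3 := enorm_tri_le (L := L) hca hd hv ρ l
  have b4 := enorm_tri_le (L := L) hca ha hd ρ l
  have c1 := enorm_conv_le hx hsM l
  have c2 := enorm_tri_le (L := L) hcs ha ha 0 l
  have c3 := enorm_tri_le (L := L) hca hsM ha 0 l
  have c4 := enorm_tri_le (L := L) hca ha hsM 0 l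
  have e : Gs L lam ρ x (v ρ) l - Gs L lam ρ x a l = bil (eS ρ (eta L)) x (v ρ - a) l +
      lam * (tri L ρ (cj (v ρ - a)) (v ρ) (v ρ) l + tri L ρ (cj a) (v ρ - a) (v ρ) l +
        tri L ρ (cj a) a (v ρ - a) l) := by
    have h1 := tri_sub_tri (L := L) hlv.cj hlv hlv hla.cj hla hla ρ l
    have h2 := bil_sub_right (hlx.bilSummable_eS hlv ρ (eta L) l)
      (hlx.bilSummable_eS hla ρ (eta L) l)
    rw [← cj_sub] at h1
    simp only [Gs, Pi.add_apply, Pi.smul_apply, smul_eq_mul]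
    linear_combination lam * h1 - h2
  have hS : ‖secondOrder L lam x a l‖ₑ ≤ (M ⊛ M) l +
      ‖(lam : ℂ)‖ₑ * ((M ⊛ M ⊛ M) l + (M ⊛ M ⊛ M) l + (M ⊛ M ⊛ M) l) := by
    rw [secondOrder, ← hs, Pi.add_apply, Pi.smul_apply, smul_eq_mul]
    exact (enorm_add_le _ _).trans (add_le_add c1 ((enorm_mul _ _).le.trans (mul_le_mul' le_rfl
      ((enorm_add_le _ _).trans (add_le_add ((enorm_add_le _ _).trans (add_le_add c2 c3)) c4)))))
  rw [e]
  refine (_root_.enorm_sub_le).trans ((add_le_add ((enorm_add_le _ _).trans (add_le_add b1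
    ((enorm_mul _ _).le.trans (mul_le_mul' le_rfl ((enorm_add_le _ _).trans (add_le_add
      ((enorm_add_le _ _).trans (add_le_add b2 b3)) b4))))))
    (enorm_smul_ofReal hρ.1 hρ.2 hS)).trans (le_of_eq ?_))
  simp only [cv_smul_left, cv_smul_right, Pi.smul_apply, smul_eq_mul]
  ring

end remainder

end

section

/-! ### The symbol of the non-smoothing part of the local error -/

lemma norm_exp_I_sub_one_sub_le (y : ℝ) : ‖Complex.exp (I * y) - 1 - I * y‖ ≤ 2 * |y| := by
  have h1 := Real.norm_exp_I_mul_ofReal_sub_one_le (x := y)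
  refine (norm_sub_le _ _).trans ?_
  rw [norm_mul, Complex.norm_I, one_mul, Complex.norm_real]
  rw [Real.norm_eq_abs] at h1 ⊢
  linarith

lemma norm_exp_I_sub_one_sub_le_sq (y : ℝ) :
    ‖Complex.exp (I * y) - 1 - I * y‖ ≤ 2 * |y| ^ 2 := by
  rcases le_total |y| 1 with h | h
  · have hn : ‖I * (y : ℂ)‖ = |y| := by
      rw [norm_mul, Complex.norm_I, one_mul, Complex.norm_real, Real.norm_eq_abs]
    have := Complex.norm_exp_sub_one_sub_id_le (x := I * y) (by rwa [hn])
    rw [hn] at this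
    nlinarith [sq_nonneg |y|]
  · refine (norm_exp_I_sub_one_sub_le y).trans ?_
    nlinarith

/-- The imaginary part of the second-order Taylor bound of the exponential. -/
lemma abs_sub_sin_le (y : ℝ) : |y - Real.sin y| ≤ 2 * |y| ^ 2 := by
  refine le_trans ?_ (norm_exp_I_sub_one_sub_le_sq y)
  have h := Complex.abs_im_le_norm (Complex.exp (I * y) - 1 - I * y)
  rw [mul_comm I (y : ℂ)] at h ⊢
  simpa [Complex.exp_ofReal_mul_I_im, abs_sub_comm] using h

/-- The symbol of the part of the local error that is summed over the time steps. -/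
def badS (L ρ : ℝ) (k j : ℤ) : ℂ :=
  Complex.exp (I * ρ * (freq L k ^ 2 : ℝ)) *
    (Complex.exp (I * ρ * beta L k j) - 1 - I * ρ * beta L k j)

/-- The integrated symbol `-i ∫₀^τ`. -/
def kap (L τ : ℝ) (k j : ℤ) : ℂ := -I * ∫ ρ in (0 : ℝ)..τ, badS L ρ k j

lemma continuous_badS (L : ℝ) (k j : ℤ) : Continuous fun ρ => badS L ρ k j := by
  unfold badS; fun_prop

lemma norm_badS (L ρ : ℝ) (k j : ℤ) : ‖badS L ρ k j‖ =
    ‖Complex.exp (I * (ρ * beta L k j : ℝ)) - 1 - I * (ρ * beta L k j : ℝ)‖ := by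
  rw [badS, norm_mul, norm_exp_I_mul, one_mul]
  push_cast
  simp only [mul_assoc]

lemma eS_eta (L ρ : ℝ) (k j : ℤ) : eS ρ (eta L) k j =
    Complex.exp (I * ρ * (freq L k ^ 2 : ℝ)) * Complex.exp (I * ρ * beta L k j) := by
  rw [eS, ← Complex.exp_add, eta, beta]
  congr 1
  push_cast
  ring

section symbols

variable {L ρ τ : ℝ}

lemma enorm_badS_le (h0 : 0 ≤ ρ) (hρ : ρ ≤ τ) (k j : ℤ) :
    ‖badS L ρ k j‖ₑ ≤ 4 * ENNReal.ofReal τ * (om L k * om L j) := by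
  have h : ‖badS L ρ k j‖ ≤ 2 * (τ * |beta L k j|) := by
    rw [norm_badS]
    refine (norm_exp_I_sub_one_sub_le _).trans ?_
    rw [abs_mul, abs_of_nonneg h0]
    gcongr
  refine (enorm_le_of_norm_le h).trans ?_
  rw [ENNReal.ofReal_mul (by norm_num), ENNReal.ofReal_mul (h0.trans hρ), ENNReal.ofReal_ofNat]
  calc _ ≤ 2 * (ENNReal.ofReal τ * (2 * (om L k * om L j))) := by
        gcongr; exact abs_beta_le L k j
    _ = _ := by ring

/-- First order in τ with one derivative on each factor: both e^{iρβ} - 1 and its filtered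
linearization have this size, by |sin y| ≤ |y|. -/
lemma enorm_eS_eta_sub_psi_le (hτ : 0 < τ) (h0 : 0 ≤ ρ) (hρ : ρ ≤ τ) (k j : ℤ) :
    ‖eS ρ (eta L) k j - psi L τ ρ k j‖ₑ ≤ 4 * ENNReal.ofReal τ * (om L k * om L j) := by
  have e : eS ρ (eta L) k j - psi L τ ρ k j = Complex.exp (I * ρ * (freq L k ^ 2 : ℝ)) *
      ((Complex.exp (I * ρ * beta L k j) - 1) -
        I * (2 * (ρ * (freq L k * (Real.sin (τ * freq L j) / τ))) : ℝ)) := by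
    rw [eS_eta, psi]
    push_cast
    ring
  have hs : |Real.sin (τ * freq L j) / τ| ≤ |freq L j| := by
    rw [abs_div, div_le_iff₀ (by positivity)]
    refine (Real.abs_sin_le_abs).trans (le_of_eq ?_)
    rw [abs_mul, mul_comm]
  have h2 : ‖I * ((2 * (ρ * (freq L k * (Real.sin (τ * freq L j) / τ))) : ℝ) : ℂ)‖ₑ ≤
      2 * ENNReal.ofReal τ * (om L k * om L j) := by
    have h : ‖I * ((2 * (ρ * (freq L k * (Real.sin (τ * freq L j) / τ))) : ℝ) : ℂ)‖ ≤
        2 * (τ * (|freq L k| * |freq L j|)) := by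
      rw [norm_mul, Complex.norm_I, one_mul, Complex.norm_real, Real.norm_eq_abs, abs_mul, abs_two,
        abs_mul, abs_of_nonneg h0, abs_mul]
      gcongr
    refine (enorm_le_of_norm_le h).trans ?_
    rw [ENNReal.ofReal_mul (by norm_num), ENNReal.ofReal_mul hτ.le,
      ENNReal.ofReal_mul (by positivity), ENNReal.ofReal_ofNat, mul_assoc]
    gcongr <;> exact ofReal_abs_freq_le L _
  rw [e, enorm_mul, ← ofReal_norm (Complex.exp _), norm_exp_I_mul, ENNReal.ofReal_one, one_mul]
  refine enorm_sub_le.trans ?_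
  calc _ ≤ ENNReal.ofReal τ * (2 * (om L k * om L j)) +
        2 * ENNReal.ofReal τ * (om L k * om L j) := by
        refine add_le_add ((enorm_exp_sub_one_le h0 hρ _).trans ?_) h2
        gcongr
        exact abs_beta_le L k j
    _ = _ := by ring

/-- Once `badS` is removed only the filter error 2ρμ_k(μ_j - sin(τμ_j)/τ) remains. Two derivatives
fall on j but only one on k, so this part is admissible. -/
lemma enorm_eS_eta_sub_psi_sub_badS_le (hτ : 0 < τ) (h0 : 0 ≤ ρ) (hρ : ρ ≤ τ) (k j : ℤ) :
    ‖eS ρ (eta L) k j - psi L τ ρ k j - badS L ρ k j‖ₑ ≤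
      4 * ENNReal.ofReal τ ^ 2 * (om L k * om L j ^ 2) := by
  have e : eS ρ (eta L) k j - psi L τ ρ k j - badS L ρ k j =
      Complex.exp (I * ρ * (freq L k ^ 2 : ℝ)) * (I *
        (2 * (ρ * (freq L k * ((τ * freq L j - Real.sin (τ * freq L j)) / τ))) : ℝ)) := by
    have hτ' : (τ : ℂ) ≠ 0 := by exact_mod_cast hτ.ne'
    rw [eS_eta, psi, badS, beta]
    push_cast
    field_simp
    ring
  have hs : |(τ * freq L j - Real.sin (τ * freq L j)) / τ| ≤ 2 * (τ * |freq L j| ^ 2) := by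
    rw [abs_div, div_le_iff₀ (by positivity), abs_of_pos hτ]
    refine (abs_sub_sin_le _).trans (le_of_eq ?_)
    rw [abs_mul, abs_of_pos hτ]
    ring
  have h : ‖eS ρ (eta L) k j - psi L τ ρ k j - badS L ρ k j‖ ≤
      2 * (τ * (|freq L k| * (2 * (τ * |freq L j| ^ 2)))) := by
    rw [e, norm_mul, norm_exp_I_mul, one_mul, norm_mul, Complex.norm_I, one_mul, Complex.norm_real,
      Real.norm_eq_abs, abs_mul, abs_two, abs_mul, abs_of_nonneg h0, abs_mul]
    gcongr
  refine (enorm_le_of_norm_le h).trans ?_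
  rw [ENNReal.ofReal_mul (by norm_num), ENNReal.ofReal_mul hτ.le,
      ENNReal.ofReal_mul (by positivity), ENNReal.ofReal_mul (by norm_num),
      ENNReal.ofReal_mul hτ.le, ENNReal.ofReal_pow (by positivity), ENNReal.ofReal_ofNat]
  calc _ ≤ 2 * (ENNReal.ofReal τ * (om L k * (2 * (ENNReal.ofReal τ * om L j ^ 2)))) := by
        gcongr <;> exact ofReal_abs_freq_le L _
    _ = _ := by ring

end symbols

/-- Majorant of the local error, of order `τ²`. -/
def errMaj (L lam : ℝ) (M : ℤ → ℝ≥0∞) : ℤ → ℝ≥0∞ :=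
  (4 : ℝ≥0∞) • ((om L * M) ⊛ (om L * M)) +
    (4 * ‖(lam : ℂ)‖ₑ) • (M ⊛ (om L * M) ⊛ (om L * M)) +
    (2 : ℝ≥0∞) • (M ⊛ M + (3 * ‖(lam : ℂ)‖ₑ) • (M ⊛ M ⊛ M)) + expMaj lam M ⊛ M

/-- Majorant of the smoothing part of the local error, of order `τ³`. -/
def errMaj' (L lam : ℝ) (M : ℤ → ℝ≥0∞) : ℤ → ℝ≥0∞ :=
  (4 : ℝ≥0∞) • ((om L * M) ⊛ (om L ^ 2 * M)) +
    (12 * ‖(lam : ℂ)‖ₑ) • triMaj L M + remMaj L lam M + expMaj lam M ⊛ M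

/-- The Leibniz rule: subadditivity of ω puts the derivative on a single factor. -/
lemma om_mul_cv_self_le (L : ℝ) (A : ℤ → ℝ≥0∞) : om L * (A ⊛ A) ≤ (2 : ℝ≥0∞) • ((om L * A) ⊛ A) := by
  have h : om L * (A ⊛ A) ≤ (om L * A) ⊛ A + A ⊛ (om L * A) := by
    intro l
    simp only [cv, Pi.mul_apply, Pi.add_apply, ← ENNReal.tsum_mul_left, ← ENNReal.tsum_add]
    refine ENNReal.tsum_le_tsum fun k => ?_
    have := om_add_le L k (l - k)
    rw [add_sub_cancel] at this
    calc _ ≤ (om L k + om L (l - k)) * (A k * A (l - k)) := by gcongr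
      _ = _ := by ring
  refine h.trans (le_of_eq ?_)
  rw [cv_comm A, two_smul]

/-! ### Local error bounds: a crude one for ℓ¹ and a fine one, modulo `kap`, for ℓ². -/

section localError

variable {L lam τ : ℝ} {x : ℤ → ℂ} {M : ℤ → ℝ≥0∞} {v : ℝ → ℤ → ℂ}

lemma enorm_bil_beta_sub_one_le {ρ : ℝ} (h0 : 0 ≤ ρ) (hρ : ρ ≤ τ) {a b : ℤ → ℂ}
    (ha : ∀ l, ‖a l‖ₑ ≤ M l) (hb : ∀ l, ‖b l‖ₑ ≤ M l) (l : ℤ) :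
    ‖bil (fun k j => eS ρ (beta L) k j - 1) a b l‖ₑ ≤
      ((2 * ENNReal.ofReal τ) • ((om L * M) ⊛ (om L * M))) l := by
  rw [← cv_smul_left]
  refine enorm_bil_le (fun k j => ?_) l
  simp only [Pi.smul_apply, Pi.mul_apply, smul_eq_mul]
  calc _ ≤ (ENNReal.ofReal τ * (2 * (om L k * om L j))) * M k * M j := by
        gcongr
        · exact (enorm_exp_sub_one_le h0 hρ _).trans (by gcongr; exact abs_beta_le L k j)
        · exact ha k
        · exact hb j
    _ = _ := by ring

/-- The cubic part rests on e^{iρα}e^{iρβ} - (e^{iρα} + e^{iρβ} - 1) = (e^{iρα} - 1)(e^{iρβ} - 1).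
-/
lemma rhs_sub_approx {a w : ℤ → ℂ} (hlx : LOne x) (hla : LOne a) {ρ : ℝ}
    (hψ : ∀ l, BilSummable (psi L τ ρ) x a l) (l : ℤ) :
    Gs L lam ρ x w l - approx L lam τ x a ρ l =
      bil (fun k j => eS ρ (eta L) k j - psi L τ ρ k j) x a l +
      lam * bil (fun k j => eS ρ (alpha L) k j - 1) (cj a)
        (bil (fun k j => eS ρ (beta L) k j - 1) a a) l +
      (Gs L lam ρ x w l - Gs L lam ρ x a l - ρ * secondOrder L lam x a l) := by
  have h1 : bil (fun k j => eS ρ (beta L) k j - 1) a a =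
      bil (eS ρ (beta L)) a a - conv a a := by
    funext j
    rw [Pi.sub_apply, bil_sub_one hla hla]; ring
  have hb := hla.bil_eS hla ρ (beta L)
  have h2 := bil_sub_right (hla.cj.bilSummable_eS_sub hb ρ (alpha L) l)
    (hla.cj.bilSummable_eS_sub (hla.conv hla) ρ (alpha L) l)
  have h3 := bil_sub_one hla.cj hb (ρ := ρ) (alpha L) l
  have h4 := bil_sub_one hla.cj (hla.conv hla) (ρ := ρ) (alpha L) l
  have h5 := bil_sub_symbol (hlx.bilSummable_eS hla ρ (eta L) l) (hψ l)
  rw [h1, h2, h5, approx]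
  simp only [Gs, tri, Pi.add_apply, Pi.smul_apply, smul_eq_mul]
  linear_combination lam * h3 - lam * h4

variable [Fact (0 < 2 * L)]

lemma LocalSol.local_error_eq
    (hτ : 0 < τ) (h : LocalSol L lam τ x M v) (hM : ∀ l, M (-l) = M l)
    (hN : ∑' l, (om L * M) l ≠ ⊤) (hx : ∀ l, ‖x l‖ₑ ≤ M l) (hxr : cj x = x) (l : ℤ) :
    v τ l - stepc L lam τ x (v 0) l = -I * (∫ ρ in (0 : ℝ)..τ,
      (Gs L lam ρ x (v ρ) l - approx L lam τ x (v 0) ρ l)) - expTail (I * lam * τ) (v 0) l := by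
  obtain ⟨hc, he⟩ := integral_approx (lam := lam) hτ hxr hM hN hx
    (h.bound 0 ⟨le_rfl, hτ.le⟩) l
  have hii : ∀ {f : ℝ → ℂ}, ContinuousOn f (Icc 0 τ) → IntervalIntegrable f volume 0 τ :=
    fun hf => ContinuousOn.intervalIntegrable (by rwa [uIcc_of_le hτ.le])
  rw [intervalIntegral.integral_sub (hii (h.cont l)) (hii (hc l)), h.eq τ ⟨hτ.le, le_rfl⟩ l]
  linear_combination he

/-- One order is given up so that the majorant involves only ωM, which lies in the weighted Wiener
algebra. In the cubic term the factor e^{iρα} - 1 is simply bounded by 2. -/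
lemma LocalSol.enorm_local_error_le
    (hτ : 0 < τ) (h : LocalSol L lam τ x M v) (hM : ∀ l, M (-l) = M l)
    (hN : ∑' l, (om L * M) l ≠ ⊤) (hx : ∀ l, ‖x l‖ₑ ≤ M l) (hxr : cj x = x) (l : ℤ) (hτ1 : τ ≤ 1) :
    ‖v τ l - stepc L lam τ x (v 0) l‖ₑ ≤ ENNReal.ofReal τ ^ 2 * errMaj L lam M l := by
  have hMt : ∑' l, M l ≠ ⊤ := ne_top_of_le_ne_top hN (ENNReal.tsum_le_tsum (le_om_mul L M))
  have hlx : LOne x := lOne_of_le hx hMt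
  have ha := h.bound 0 ⟨le_rfl, hτ.le⟩
  have hla : LOne (v 0) := lOne_of_le ha hMt
  set t := ENNReal.ofReal τ with ht
  have ht1 : t ≤ 1 := by simpa [ht] using hτ1
  have hψ : ∀ ρ ∈ Icc 0 τ, ∀ l, BilSummable (psi L τ ρ) x (v 0) l := fun ρ hρ l =>
    bilSummable_of_le (A := (3 : ℝ≥0∞) • (om L * M)) (B := M) (fun k j => by
      simp only [Pi.smul_apply, Pi.mul_apply, smul_eq_mul]
      rw [← mul_assoc]
      gcongr
      exacts [enorm_psi_le hτ hρ k j, hx k, ha j])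
      (cv_ne_top (by simp only [Pi.smul_apply, smul_eq_mul, ENNReal.tsum_mul_left]; finiteness)
        hMt l)
  rw [h.local_error_eq hτ hM hN hx hxr l]
  have hb : ∀ ρ ∈ Icc 0 τ, ‖Gs L lam ρ x (v ρ) l - approx L lam τ x (v 0) ρ l‖ₑ ≤
      4 * t * ((om L * M) ⊛ (om L * M)) l + ‖(lam : ℂ)‖ₑ * (2 * (2 * t) *
        (M ⊛ (om L * M) ⊛ (om L * M)) l) +
        t * (2 * ((M ⊛ M) l + 3 * ‖(lam : ℂ)‖ₑ * (M ⊛ M ⊛ M) l)) := fun ρ hρ => by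
    rw [rhs_sub_approx hlx hla (hψ ρ hρ)]
    refine (enorm_add_le _ _).trans (add_le_add ((enorm_add_le _ _).trans (add_le_add ?_ ?_))
      (h.enorm_remainder_le' hM hN hx hρ l))
    · have := enorm_bil_le (A := (4 * t) • (om L * M)) (B := om L * M) (a := x) (b := v 0)
        (σ := fun k j => eS ρ (eta L) k j - psi L τ ρ k j) (fun k j => by
          simp only [Pi.smul_apply, Pi.mul_apply, smul_eq_mul]
          calc _ ≤ (4 * t * (om L k * om L j)) * M k * M j := by
                gcongr
                exacts [enorm_eS_eta_sub_psi_le hτ hρ.1 hρ.2 k j, hx k, ha j]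
            _ = _ := by ring) l
      rwa [cv_smul_left] at this
    · rw [enorm_mul]
      gcongr
      have := enorm_bil_le (A := (2 : ℝ≥0∞) • M)
        (B := (2 * t) • ((om L * M) ⊛ (om L * M)))
        (a := cj (v 0)) (b := bil (fun k j => eS ρ (beta L) k j - 1) (v 0) (v 0))
        (σ := fun k j => eS ρ (alpha L) k j - 1) (fun k j => by
          refine mul_le_mul' (mul_le_mul' (enorm_exp_sub_one_le_two _ _)
            (enorm_cj_le hM ha k)) (enorm_bil_beta_sub_one_le hρ.1 hρ.2 ha ha j)) l
      rwa [cv_smul_left, cv_smul_right, smul_smul] at this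
  refine (_root_.enorm_sub_le).trans ((add_le_add ((enorm_mul _ _).le.trans (mul_le_mul'
    enorm_neg_I.le (enorm_intervalIntegral_le hτ hb)))
    (enorm_expTail_le hτ.le hτ1 hla hM ha l)).trans ?_)
  rw [← ht, one_mul]
  calc _ ≤ t * (4 * t * ((om L * M) ⊛ (om L * M)) l + ‖(lam : ℂ)‖ₑ * (2 * (2 * t) *
        (M ⊛ (om L * M) ⊛ (om L * M)) l) +
        t * (2 * ((M ⊛ M) l + 3 * ‖(lam : ℂ)‖ₑ * (M ⊛ M ⊛ M) l))) +
        t ^ 2 * 1 * (expMaj lam M ⊛ M) l := by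
        gcongr
        rw [pow_succ]
        gcongr
    _ = _ := by
        simp only [errMaj, Pi.add_apply, Pi.smul_apply, smul_eq_mul]
        ring

/-- After subtraction of the part with symbol `kap`, every remaining convolution has at most one
factor with ω². -/
lemma LocalSol.enorm_local_error_sub_le
    (hτ : 0 < τ) (h : LocalSol L lam τ x M v) (hM : ∀ l, M (-l) = M l)
    (hN : ∑' l, (om L * M) l ≠ ⊤) (hx : ∀ l, ‖x l‖ₑ ≤ M l) (hxr : cj x = x) (l : ℤ) (hτ1 : τ ≤ 1) :
    ‖v τ l - stepc L lam τ x (v 0) l - bil (kap L τ) x (v 0) l‖ₑ ≤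
      ENNReal.ofReal τ ^ 3 * errMaj' L lam M l := by
  have hMt : ∑' l, M l ≠ ⊤ := ne_top_of_le_ne_top hN (ENNReal.tsum_le_tsum (le_om_mul L M))
  have hlx : LOne x := lOne_of_le hx hMt
  have ha := h.bound 0 ⟨le_rfl, hτ.le⟩
  have hla : LOne (v 0) := lOne_of_le ha hMt
  set t := ENNReal.ofReal τ with ht
  have hψ : ∀ ρ ∈ Icc 0 τ, ∀ l, BilSummable (psi L τ ρ) x (v 0) l := fun ρ hρ l =>
    bilSummable_of_le (A := (3 : ℝ≥0∞) • (om L * M)) (B := M) (fun k j => by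
      simp only [Pi.smul_apply, Pi.mul_apply, smul_eq_mul]
      rw [← mul_assoc]
      gcongr
      exacts [enorm_psi_le hτ hρ k j, hx k, ha j])
      (cv_ne_top (by simp only [Pi.smul_apply, smul_eq_mul, ENNReal.tsum_mul_left]; finiteness)
        hMt l)
  have hbad : ∀ ρ ∈ Icc 0 τ, ∀ k j, ‖badS L ρ k j‖ₑ * ‖x k‖ₑ * ‖v 0 j‖ₑ ≤
      ((4 * t) • (om L * M)) k * (om L * M) j := fun ρ hρ k j => by
    simp only [Pi.smul_apply, Pi.mul_apply, smul_eq_mul]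
    calc _ ≤ (4 * t * (om L k * om L j)) * M k * M j := by
          gcongr
          exacts [enorm_badS_le hρ.1 hρ.2 k j, hx k, ha j]
      _ = _ := by ring
  have htN : ∑' l, ((4 * t) • (om L * M)) l ≠ ⊤ := by
    simp only [Pi.smul_apply, smul_eq_mul, ENNReal.tsum_mul_left]; finiteness
  have hbfin : (((4 * t) • (om L * M)) ⊛ (om L * M)) l ≠ ⊤ := cv_ne_top htN hN l
  have hbs : ∀ ρ ∈ Icc 0 τ, BilSummable (badS L ρ) x (v 0) l := fun ρ hρ =>
    bilSummable_of_le (hbad ρ hρ) hbfin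
  have hkap : bil (kap L τ) x (v 0) l = -I * ∫ ρ in (0 : ℝ)..τ, bil (badS L ρ) x (v 0) l := by
    rw [integral_bil hτ.le (continuous_badS L) hbad hbfin, ← bil_smul_symbol]
    rfl
  have hbc : ContinuousOn (fun ρ => bil (badS L ρ) x (v 0) l) (Icc 0 τ) :=
    continuousOn_bil (continuous_badS L) hbad hbfin
  obtain ⟨hc, -⟩ := integral_approx (lam := lam) hτ hxr hM hN hx ha l
  have hii : ∀ {f : ℝ → ℂ}, ContinuousOn f (Icc 0 τ) → IntervalIntegrable f volume 0 τ :=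
    fun hf => ContinuousOn.intervalIntegrable (by rwa [uIcc_of_le hτ.le])
  have hGc : ContinuousOn (fun ρ => Gs L lam ρ x (v ρ) l - approx L lam τ x (v 0) ρ l) (Icc 0 τ) :=
    (h.cont l).sub (hc l)
  have e : v τ l - stepc L lam τ x (v 0) l - bil (kap L τ) x (v 0) l =
      -I * (∫ ρ in (0 : ℝ)..τ, (Gs L lam ρ x (v ρ) l - approx L lam τ x (v 0) ρ l -
        bil (badS L ρ) x (v 0) l)) - expTail (I * lam * τ) (v 0) l := by
    rw [intervalIntegral.integral_sub (hii hGc) (hii hbc), h.local_error_eq hτ hM hN hx hxr l, hkap]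
    ring
  rw [e]
  have hb : ∀ ρ ∈ Icc 0 τ, ‖Gs L lam ρ x (v ρ) l - approx L lam τ x (v 0) ρ l -
        bil (badS L ρ) x (v 0) l‖ₑ ≤
      4 * t ^ 2 * ((om L * M) ⊛ (om L ^ 2 * M)) l + ‖(lam : ℂ)‖ₑ * (12 * t ^ 2 * triMaj L M l) +
        t ^ 2 * remMaj L lam M l := fun ρ hρ => by
    have e : Gs L lam ρ x (v ρ) l - approx L lam τ x (v 0) ρ l - bil (badS L ρ) x (v 0) l =
        bil (fun k j => eS ρ (eta L) k j - psi L τ ρ k j - badS L ρ k j) x (v 0) l +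
        lam * bil (fun k j => eS ρ (alpha L) k j - 1) (cj (v 0))
          (bil (fun k j => eS ρ (beta L) k j - 1) (v 0) (v 0)) l +
        (Gs L lam ρ x (v ρ) l - Gs L lam ρ x (v 0) l - ρ * secondOrder L lam x (v 0) l) := by
      rw [rhs_sub_approx hlx hla (hψ ρ hρ), bil_sub_symbol
        ((hlx.bilSummable_eS hla ρ (eta L) l).sub (hψ ρ hρ l)) (hbs ρ hρ)]
      ring
    rw [e]
    refine (enorm_add_le _ _).trans (add_le_add ((enorm_add_le _ _).trans (add_le_add ?_ ?_))
      (h.enorm_remainder_le hM hN hx hρ l))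
    · have := enorm_bil_le (A := (4 * t ^ 2) • (om L * M)) (B := om L ^ 2 * M) (a := x) (b := v 0)
        (σ := fun k j => eS ρ (eta L) k j - psi L τ ρ k j - badS L ρ k j) (fun k j => by
          simp only [Pi.smul_apply, Pi.mul_apply, Pi.pow_apply, smul_eq_mul]
          calc _ ≤ (4 * t ^ 2 * (om L k * om L j ^ 2)) * M k * M j := by
                gcongr
                exacts [enorm_eS_eta_sub_psi_sub_badS_le hτ hρ.1 hρ.2 k j, hx k, ha j]
            _ = _ := by ring) l
      rwa [cv_smul_left] at this
    · rw [enorm_mul]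
      gcongr
      set NN := (om L * M) ⊛ (om L * M) with hNN
      have h1 := enorm_bil_le_add (σ := fun k j => eS ρ (alpha L) k j - 1) (a := cj (v 0))
        (b := bil (fun k j => eS ρ (beta L) k j - 1) (v 0) (v 0))
        (A := (4 * t ^ 2) • (om L ^ 2 * M)) (B := NN) (A' := (4 * t ^ 2) • (om L * M))
        (B' := om L * NN) (fun k j => by
          simp only [Pi.smul_apply, Pi.mul_apply, Pi.pow_apply, smul_eq_mul]
          calc _ ≤ (t * (2 * (om L k * (om L k + om L j)))) * M k * (2 * t * NN j) := by
                gcongr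
                · exact (enorm_exp_sub_one_le hρ.1 hρ.2 _).trans
                    (by gcongr; exact abs_alpha_le L k j)
                · exact enorm_cj_le hM ha k
                · exact enorm_bil_beta_sub_one_le hρ.1 hρ.2 ha ha j
            _ = _ := by ring) l
      -- The extra weight on the inner convolution goes to one of its factors by the Leibniz rule,
      -- and the factors are then reordered.
      have h2 : ((om L * M) ⊛ (om L * NN)) l ≤ 2 * triMaj L M l := by
        refine (cv_mono le_rfl (om_mul_cv_self_le L (om L * M)) l).trans (le_of_eq ?_)
        rw [cv_smul_right, Pi.smul_apply, smul_eq_mul, ← mul_assoc (om L) (om L) M, ← sq,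
          cv_left_comm]
        rfl
      rw [cv_smul_left, cv_smul_left, Pi.smul_apply, Pi.smul_apply, smul_eq_mul, smul_eq_mul] at h1
      calc _ ≤ _ := h1
        _ ≤ 4 * t ^ 2 * triMaj L M l + 4 * t ^ 2 * (2 * triMaj L M l) := by
            gcongr
            exact le_rfl
        _ = _ := by ring
  refine (_root_.enorm_sub_le).trans ((add_le_add ((enorm_mul _ _).le.trans (mul_le_mul'
    enorm_neg_I.le (enorm_intervalIntegral_le hτ hb)))
    (enorm_expTail_le hτ.le hτ1 hla hM ha l)).trans (le_of_eq ?_))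
  simp only [errMaj', Pi.add_apply, Pi.smul_apply, smul_eq_mul, ← ht]
  ring

end localError

end

section

/-! ### The solution in the interaction picture -/

/-- The symbol of `exp(-i ρ ∂ₓ²)`. -/
def tw (L ρ : ℝ) (l : ℤ) : ℂ := Complex.exp (I * ρ * (freq L l ^ 2 : ℝ))

lemma enorm_tw_mul (L ρ : ℝ) (l : ℤ) (z : ℂ) : ‖tw L ρ l * z‖ₑ = ‖z‖ₑ := by
  rw [enorm_mul, ← ofReal_norm (tw L ρ l), tw, norm_exp_I_mul, ENNReal.ofReal_one, one_mul]

lemma tw_add (L ρ σ : ℝ) (l : ℤ) : tw L (ρ + σ) l = tw L ρ l * tw L σ l := by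
  rw [tw, tw, tw, ← Complex.exp_add]
  congr 1
  push_cast
  ring

lemma tw_zero (L : ℝ) (l : ℤ) : tw L 0 l = 1 := by simp [tw]

lemma tw_neg_mul (L ρ : ℝ) (l : ℤ) : tw L (-ρ) l * tw L ρ l = 1 := by
  rw [← tw_add, neg_add_cancel, tw_zero]

lemma cj_tw_mul (L ρ : ℝ) (a : ℤ → ℂ) :
    cj (fun l => tw L ρ l * a l) = fun l => tw L (-ρ) l * cj a l := by
  funext l
  simp only [cj, tw, map_mul, ← Complex.exp_conj, Complex.conj_I, Complex.conj_ofReal, freq_neg]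
  congr 2
  push_cast
  ring

/-- The phases η, α and β are the defects of additivity of μ² under addition of frequencies, so
conjugation by the free group removes them exactly. -/
lemma Gs_tw (L lam ρ : ℝ) (x a : ℤ → ℂ) (l : ℤ) :
    Gs L lam ρ x (fun l => tw L ρ l * a l) l =
      tw L ρ l * (conv x a + (lam : ℂ) • conv (cj a) (conv a a)) l := by
  have h1 : bil (eS ρ (eta L)) x (fun l => tw L ρ l * a l) l = tw L ρ l * conv x a l := by
    rw [conv, mul_bil]
    refine tsum_congr fun k => ?_
    have : eS ρ (eta L) k (l - k) * tw L ρ (l - k) = tw L ρ (k + (l - k)) := by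
      rw [eS, tw, tw, ← Complex.exp_add, freq_add, eta]
      congr 1
      push_cast
      ring
    simp only
    rw [← this]
    ring
  have h2 : bil (eS ρ (beta L)) (fun l => tw L ρ l * a l) (fun l => tw L ρ l * a l) =
      fun l => tw L ρ l * conv a a l := by
    funext l
    rw [conv, mul_bil]
    refine tsum_congr fun k => ?_
    have : eS ρ (beta L) k (l - k) * tw L ρ k * tw L ρ (l - k) = tw L ρ (k + (l - k)) := by
      rw [eS, tw, tw, tw, ← Complex.exp_add, ← Complex.exp_add, freq_add, beta]
      congr 1
      push_cast
      ring
    simp only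
    rw [← this]
    ring
  have h3 : tri L ρ (cj fun l => tw L ρ l * a l) (fun l => tw L ρ l * a l)
      (fun l => tw L ρ l * a l) l = tw L ρ l * conv (cj a) (conv a a) l := by
    rw [tri, h2, cj_tw_mul, conv.eq_def (cj a), mul_bil]
    refine tsum_congr fun k => ?_
    have : eS ρ (alpha L) k (l - k) * tw L (-ρ) k * tw L ρ (l - k) = tw L ρ (k + (l - k)) := by
      rw [eS, tw, tw, tw, ← Complex.exp_add, ← Complex.exp_add, freq_add, alpha]
      congr 1
      push_cast
      ring
    simp only
    rw [← this]
    ring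
  rw [Gs, Pi.add_apply, Pi.smul_apply, h1, h3]
  simp only [Pi.add_apply, Pi.smul_apply, smul_eq_mul]
  ring

section sol

variable {L : ℝ} [Fact (0 < 2 * L)]
variable {lam : ℝ} {ξ : Torus L → ℝ} {u₀ : Torus L → ℂ} {T : ℝ} {u : ℝ → Torus L → ℂ} {x : ℤ → ℂ}

/-- Duhamel's formula between two times. -/
lemma IsSolution.tw_mul_sub (hu : IsSolution lam ξ u₀ T u)
    (hξ : HasCoeff (fun y => (ξ y : ℂ)) x) {s t : ℝ} (hs : 0 ≤ s) (hst : s ≤ t) (ht : t ≤ T)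
    (l : ℤ) : tw L t l * fourierCoeff (u t) l - tw L s l * fourierCoeff (u s) l =
      -I * ∫ r in s..t, tw L r l * fourierCoeff (nonl lam x (u r)) l := by
  have hc : ContinuousOn (fun r => tw L r l * fourierCoeff (nonl lam x (u r)) l) (Icc 0 T) := by
    have h1 : Continuous fun r => tw L r l := by unfold tw; fun_prop
    exact h1.continuousOn.mul (hu.continuousOn_coeff hξ.1 l)
  have key : ∀ r ∈ Icc 0 T, tw L r l * fourierCoeff (u r) l = fourierCoeff u₀ l -
      I * ∫ q in (0 : ℝ)..r, tw L q l * fourierCoeff (nonl lam x (u q)) l := fun r hr => by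
    rw [hu.duhamel r hr l]
    simp only [fourierCoeff_nonl hξ]
    have e1 : tw L r l * Complex.exp (-I * r * freq L l ^ 2) = 1 := by
      rw [tw, ← Complex.exp_add, ← Complex.exp_zero]
      congr 1
      push_cast
      ring
    have e2 : tw L r l * ∫ q in (0 : ℝ)..r, Complex.exp (-I * (r - q) * freq L l ^ 2) *
        fourierCoeff (nonl lam x (u q)) l =
        ∫ q in (0 : ℝ)..r, tw L q l * fourierCoeff (nonl lam x (u q)) l := by
      rw [← intervalIntegral.integral_const_mul]
      congr 1
      funext q
      rw [← mul_assoc, tw, ← Complex.exp_add, tw]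
      congr 2
      push_cast
      ring
    rw [← e2]
    linear_combination fourierCoeff u₀ l * e1
  have hii : ∀ {p q : ℝ}, 0 ≤ p → p ≤ q → q ≤ T → IntervalIntegrable
      (fun r => tw L r l * fourierCoeff (nonl lam x (u r)) l) volume p q := fun hp hpq hq =>
    (hc.mono (by rw [uIcc_of_le hpq]; exact Icc_subset_Icc hp hq)).intervalIntegrable
  rw [key t ⟨hs.trans hst, ht⟩, key s ⟨hs, hst.trans ht⟩,
    ← intervalIntegral.integral_add_adjacent_intervals (hii le_rfl hs (hst.trans ht))
      (hii hs hst ht)]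
  ring

variable {M : ℤ → ℝ≥0∞}

/-- Duhamel's formula restarted at time s: the twist by s is common to all terms and is cancelled by
`tw L (-s)`. -/
lemma IsSolution.localSol (hu : IsSolution lam ξ u₀ T u)
    (hξ : HasCoeff (fun y => (ξ y : ℂ)) x)
    (hM : ∀ t ∈ Icc 0 T, LOne (fourierCoeff (u t)) ∧ (∀ l, ‖fourierCoeff (u t) l‖ₑ ≤ M l) ∧
        ∀ l, ‖fourierCoeff (nonl lam x (u t)) l‖ₑ ≤ M l)
    {s τ : ℝ} (hs : 0 ≤ s) (hsT : s + τ ≤ T) :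
    LocalSol L lam τ x M fun ρ l => tw L ρ l * fourierCoeff (u (s + ρ)) l := by
  have hmem : ∀ ρ ∈ Icc 0 τ, s + ρ ∈ Icc 0 T := fun ρ hρ =>
    ⟨add_nonneg hs hρ.1, by linarith [hρ.2]⟩
  have hG : ∀ ρ ∈ Icc 0 τ, ∀ l, Gs L lam ρ x (fun l => tw L ρ l * fourierCoeff (u (s + ρ)) l) l =
      tw L ρ l * fourierCoeff (nonl lam x (u (s + ρ))) l := fun ρ hρ l => by
    have hc := hmem ρ hρ
    rw [Gs_tw, (hasCoeff_nonl lam hξ.1 (hasCoeff_of_memLp (memLp_of_continuous (hu.continuous hc))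
      (hM _ hc).1)).fourierCoeff_eq]
  refine ⟨fun ρ hρ l => ?_, fun ρ hρ l => ?_, fun l => ?_, fun ρ hρ l => ?_⟩
  · rw [enorm_tw_mul]
    exact (hM _ (hmem ρ hρ)).2.1 l
  · rw [hG ρ hρ, enorm_tw_mul]
    exact (hM _ (hmem ρ hρ)).2.2 l
  · refine ContinuousOn.congr ?_ (fun ρ hρ => hG ρ hρ l)
    have h1 : Continuous fun r => tw L r l := by unfold tw; fun_prop
    exact h1.continuousOn.mul ((hu.continuousOn_coeff hξ.1 l).comp (by fun_prop) hmem)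
  · have h1 := hu.tw_mul_sub hξ hs (le_add_of_nonneg_right hρ.1) (hmem ρ hρ).2 l
    have h2 : ∫ r in (0 : ℝ)..ρ, Gs L lam r x (fun l => tw L r l * fourierCoeff (u (s + r)) l) l =
        tw L (-s) l * ∫ r in s..(s + ρ), tw L r l * fourierCoeff (nonl lam x (u r)) l := by
      have h3 := intervalIntegral.integral_comp_add_left (a := 0) (b := ρ)
        (fun r => tw L r l * fourierCoeff (nonl lam x (u r)) l) s
      rw [add_zero] at h3
      rw [← h3, ← intervalIntegral.integral_const_mul]
      refine intervalIntegral.integral_congr fun r hr => ?_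
      rw [uIcc_of_le hρ.1] at hr
      rw [hG r ⟨hr.1, hr.2.trans hρ.2⟩, tw_add]
      linear_combination -(tw L r l * fourierCoeff (nonl lam x (u (s + r))) l) * tw_neg_mul L s l
    rw [h2]
    simp only [tw_zero, add_zero]
    rw [tw_add] at h1
    linear_combination (tw L (-s) l) * h1 - (tw L ρ l * fourierCoeff (u (s + ρ)) l -
      fourierCoeff (u s) l) * tw_neg_mul L s l

end sol

/-! ### Finiteness of the majorants -/

section finiteness

variable {p A B : ℤ → ℝ≥0∞}

lemma Submul.n1_cv_ne_top (hp : Submul p) (hA : n1 p A ≠ ⊤) (hB : n1 p B ≠ ⊤) :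
    n1 p (A ⊛ B) ≠ ⊤ :=
  ne_top_of_le_ne_top (by finiteness) (hp.n1_cv_le A B)

lemma Submul.n2_cv_ne_top (hp : Submul p) (hA : n1 p A ≠ ⊤) (hB : n2 p B ≠ ⊤) :
    n2 p (A ⊛ B) ≠ ⊤ :=
  ne_top_of_le_ne_top (by finiteness) (hp.n2_cv_le A B)

lemma n2_add_ne_top (hA : n2 p A ≠ ⊤) (hB : n2 p B ≠ ⊤) : n2 p (A + B) ≠ ⊤ :=
  ne_top_of_le_ne_top (by finiteness) (n2_add_le p A B)

lemma n2_smul_ne_top {c : ℝ≥0∞} (hc : c ≠ ⊤) (hA : n2 p A ≠ ⊤) : n2 p (c • A) ≠ ⊤ := by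
  rw [n2_smul]; finiteness

lemma n1_add_ne_top (hA : n1 p A ≠ ⊤) (hB : n1 p B ≠ ⊤) : n1 p (A + B) ≠ ⊤ := by
  rw [n1_add]; finiteness

lemma n1_smul_ne_top {c : ℝ≥0∞} (hc : c ≠ ⊤) (hA : n1 p A ≠ ⊤) : n1 p (c • A) ≠ ⊤ := by
  rw [n1_smul]; finiteness

variable {L lam : ℝ} {M : ℤ → ℝ≥0∞}

lemma n1_ne_top_of_om (hN : n1 p (om L * M) ≠ ⊤) : n1 p M ≠ ⊤ :=
  ne_top_of_le_ne_top hN (n1_mono (le_om_mul L M))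

lemma n1_errMaj_ne_top (hp : Submul p) (hp0 : p 0 = 1) (hN : n1 p (om L * M) ≠ ⊤) :
    n1 p (errMaj L lam M) ≠ ⊤ := by
  have hM := n1_ne_top_of_om hN
  have hl : ‖(lam : ℂ)‖ₑ ≠ ⊤ := enorm_ne_top
  have h1 := hp.n1_cv_ne_top hN hN
  have h2 := hp.n1_cv_ne_top hM hM
  exact n1_add_ne_top (n1_add_ne_top (n1_add_ne_top (n1_smul_ne_top (by finiteness) h1)
    (n1_smul_ne_top (by finiteness) (hp.n1_cv_ne_top hM h1)))
    (n1_smul_ne_top (by finiteness) (n1_add_ne_top h2 (n1_smul_ne_top (by finiteness)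
      (hp.n1_cv_ne_top hM h2))))) (hp.n1_cv_ne_top (hp.n1_expMaj_ne_top hp0 lam hM) hM)

/-- In each term the factor with ω² is moved to the ℓ² slot of Young's inequality; all others are in
weighted ℓ¹. -/
lemma n2_errMaj'_ne_top (hp : Submul p) (hp0 : p 0 = 1) (hN : n1 p (om L * M) ≠ ⊤)
    (hM2 : n2 p (om L ^ 2 * M) ≠ ⊤) : n2 p (errMaj' L lam M) ≠ ⊤ := by
  have hM := n1_ne_top_of_om hN
  have hMn2 : n2 p M ≠ ⊤ := ne_top_of_le_ne_top (by finiteness) (n2_le_n1_sq p M)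
  have hl : ‖(lam : ℂ)‖ₑ ≠ ⊤ := enorm_ne_top
  have h1 : n2 p ((om L * M) ⊛ (om L ^ 2 * M)) ≠ ⊤ := hp.n2_cv_ne_top hN hM2
  have h1' : n2 p ((om L ^ 2 * M) ⊛ (om L * M)) ≠ ⊤ := by rwa [cv_comm]
  have h2 : n2 p (triMaj L M) ≠ ⊤ := by
    rw [triMaj, cv_comm]
    exact hp.n2_cv_ne_top (hp.n1_cv_ne_top hN hN) hM2
  have h3 := hp.n2_cv_ne_top hM hMn2
  have h4 := hp.n2_cv_ne_top hM h3
  have h5 : n2 p (rhsMaj L lam M) ≠ ⊤ :=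
    n2_add_ne_top (n2_add_ne_top (n2_smul_ne_top (by finiteness) h1') h3)
      (n2_smul_ne_top hl (n2_add_ne_top (n2_smul_ne_top (by finiteness) h2)
        (n2_smul_ne_top (by finiteness) h4)))
  have h6 : n2 p (rhsMaj L lam M ⊛ M ⊛ M) ≠ ⊤ := by
    rw [cv_comm]
    exact hp.n2_cv_ne_top (hp.n1_cv_ne_top hM hM) h5
  have h7 : n2 p (remMaj L lam M) ≠ ⊤ :=
    n2_add_ne_top (n2_add_ne_top (n2_smul_ne_top (by finiteness) h1') (hp.n2_cv_ne_top hM h5))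
      (n2_smul_ne_top hl (n2_add_ne_top (n2_add_ne_top (n2_smul_ne_top (by finiteness) h2)
        (n2_smul_ne_top (by finiteness) h6)) (n2_smul_ne_top (by finiteness) h4)))
  exact n2_add_ne_top (n2_add_ne_top (n2_add_ne_top (n2_smul_ne_top (by finiteness) h1)
    (n2_smul_ne_top (by finiteness) h2)) h7)
    (hp.n2_cv_ne_top (hp.n1_expMaj_ne_top hp0 lam hM) hMn2)

end finiteness

end

section

/-! ### Stability of the integrator -/

section stability

lemma enorm_bil_le_of_norm_le {σ : ℤ → ℤ → ℂ} {a b : ℤ → ℂ} {A B : ℤ → ℝ≥0∞} {C : ℝ}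
    (hσ : ∀ k j, ‖σ k j‖ ≤ C) (ha : ∀ l, ‖a l‖ₑ ≤ A l) (hb : ∀ l, ‖b l‖ₑ ≤ B l) (l : ℤ) :
    ‖bil σ a b l‖ₑ ≤ (ENNReal.ofReal C • (A ⊛ B)) l := by
  rw [← cv_smul_left]
  exact enorm_bil_le (fun k j => mul_le_mul' (mul_le_mul' (enorm_le_of_norm_le (hσ k j)) (ha k))
    (hb j)) l

variable {a b : ℤ → ℂ} {A E : ℤ → ℝ≥0∞}

lemma enorm_trilinear_sub_le
    (hla : LOne a) (hlb : LOne b) (hA : ∀ l, A (-l) = A l) (hE : ∀ l, E (-l) = E l)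
    (ha : ∀ l, ‖a l‖ₑ ≤ A l) (hb : ∀ l, ‖b l‖ₑ ≤ A l) (hab : ∀ l, ‖(a - b) l‖ₑ ≤ E l) {σ σ' : ℤ → ℤ → ℂ} {C C' : ℝ} (hσ : ∀ k j, ‖σ k j‖ ≤ C)
    (hσ' : ∀ k j, ‖σ' k j‖ ≤ C') (l : ℤ) :
    ‖bil σ (cj a) (bil σ' a a) l - bil σ (cj b) (bil σ' b b) l‖ₑ ≤
      3 * (ENNReal.ofReal C * ENNReal.ofReal C') * ((A ⊛ A) ⊛ E) l := by
  have haa : LOne (bil σ' a a) := LOne.bil hσ' hla hla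
  have hba : LOne (bil σ' b a) := LOne.bil hσ' hlb hla
  have hbb : LOne (bil σ' b b) := LOne.bil hσ' hlb hlb
  have e : bil σ (cj a) (bil σ' a a) l - bil σ (cj b) (bil σ' b b) l =
      bil σ (cj (a - b)) (bil σ' a a) l + bil σ (cj b) (bil σ' (a - b) a) l +
        bil σ (cj b) (bil σ' b (a - b)) l := by
    have e1 : bil σ' (a - b) a = bil σ' a a - bil σ' b a := funext fun l =>
      bil_sub_left (LOne.bilSummable hσ' hla hla l) (LOne.bilSummable hσ' hlb hla l)
    have e2 : bil σ' b (a - b) = bil σ' b a - bil σ' b b := funext fun l =>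
      bil_sub_right (LOne.bilSummable hσ' hlb hla l) (LOne.bilSummable hσ' hlb hlb l)
    rw [e1, e2, cj_sub, bil_sub_left (LOne.bilSummable hσ hla.cj haa l)
        (LOne.bilSummable hσ hlb.cj haa l),
      bil_sub_right (LOne.bilSummable hσ hlb.cj haa l) (LOne.bilSummable hσ hlb.cj hba l),
      bil_sub_right (LOne.bilSummable hσ hlb.cj hba l) (LOne.bilSummable hσ hlb.cj hbb l)]
    ring
  have b1 := enorm_bil_le_of_norm_le hσ (enorm_cj_le hE hab) (enorm_bil_le_of_norm_le hσ' ha ha) l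
  have b2 := enorm_bil_le_of_norm_le hσ (enorm_cj_le hA hb) (enorm_bil_le_of_norm_le hσ' hab ha) l
  have b3 := enorm_bil_le_of_norm_le hσ (enorm_cj_le hA hb) (enorm_bil_le_of_norm_le hσ' hb hab) l
  have c1 : E ⊛ A ⊛ A = (A ⊛ A) ⊛ E := by ac_rfl
  have c2 : A ⊛ E ⊛ A = (A ⊛ A) ⊛ E := by ac_rfl
  have c3 : A ⊛ A ⊛ E = (A ⊛ A) ⊛ E := by ac_rfl
  rw [cv_smul_right, c1] at b1
  rw [cv_smul_right, c2] at b2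
  rw [cv_smul_right, c3] at b3
  rw [e]
  refine (enorm_add_le _ _).trans ((add_le_add ((enorm_add_le _ _).trans (add_le_add b1 b2))
    b3).trans (le_of_eq ?_))
  simp only [Pi.smul_apply, smul_eq_mul]
  ring

/-- The coefficient 2m + 1 counts the factors of |w|^{2m}w, each replaced once in the telescoping
sum. -/
lemma enorm_cub_sub_le
    (hla : LOne a) (hlb : LOne b) (hA : ∀ l, A (-l) = A l) (hE : ∀ l, E (-l) = E l)
    (ha : ∀ l, ‖a l‖ₑ ≤ A l) (hb : ∀ l, ‖b l‖ₑ ≤ A l) (hab : ∀ l, ‖(a - b) l‖ₑ ≤ E l) (m : ℕ) (l : ℤ) :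
    ‖(cub a m - cub b m) l‖ₑ ≤ ((2 * m + 1 : ℝ≥0∞) • (pw A m ⊛ E)) l := by
  induction m generalizing l with
  | zero => simpa [pw, cv_single_zero, cub] using hab l
  | succ m ih =>
    have e := conv_conv_sub hla.cj hla (hla.cub m) hlb.cj hlb (hlb.cub m) l
    have b1 := enorm_conv_le (enorm_cj_le hE hab) (enorm_conv_le ha (enorm_cub_le hA ha m)) l
    have b2 := enorm_conv_le (enorm_cj_le hA hb) (enorm_conv_le hab (enorm_cub_le hA ha m)) l
    have b3 := enorm_conv_le (enorm_cj_le hA hb) (enorm_conv_le hb ih) l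
    have c1 : E ⊛ A ⊛ pw A m ⊛ A = pw A (m + 1) ⊛ E := by rw [pw]; ac_rfl
    have c2 : A ⊛ E ⊛ pw A m ⊛ A = pw A (m + 1) ⊛ E := by rw [pw]; ac_rfl
    have c3 : A ⊛ A ⊛ pw A m ⊛ E = pw A (m + 1) ⊛ E := by rw [pw]; ac_rfl
    rw [c1] at b1
    rw [c2] at b2
    rw [cv_smul_right, cv_smul_right, c3] at b3
    rw [← cj_sub] at e
    rw [Pi.sub_apply, cub, cub, e]
    refine (enorm_add_le _ _).trans ((add_le_add ((enorm_add_le _ _).trans (add_le_add b1 b2))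
      b3).trans (le_of_eq ?_))
    simp only [Pi.smul_apply, smul_eq_mul]
    push_cast
    ring

/-- The factors 2m + 1 of the telescoping are absorbed by 2m + 1 ≤ 3^m for m ≥ 1, the reason for the
3 in `expMaj`. The zeroth term of the series is a - b, so the rest has a factor τ. -/
lemma enorm_expc_sub_le
    (hla : LOne a) (hlb : LOne b) (hA : ∀ l, A (-l) = A l) (hE : ∀ l, E (-l) = E l)
    (ha : ∀ l, ‖a l‖ₑ ≤ A l) (hb : ∀ l, ‖b l‖ₑ ≤ A l) (hab : ∀ l, ‖(a - b) l‖ₑ ≤ E l) {lam τ : ℝ} (hτ : 0 ≤ τ) (hτ1 : τ ≤ 1) (l : ℤ) :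
    ‖expc (I * lam * τ) a l - expc (I * lam * τ) b l - (a - b) l‖ₑ ≤
      ENNReal.ofReal τ * (expMaj lam A ⊛ E) l := by
  set z : ℂ := I * lam * τ with hz
  have h1 := (hla.summable_expc z l).sum_add_tsum_nat_add 1
  have h2 := (hlb.summable_expc z l).sum_add_tsum_nat_add 1
  have s1 := (summable_nat_add_iff 1).mpr (hla.summable_expc z l)
  have s2 := (summable_nat_add_iff 1).mpr (hlb.summable_expc z l)
  have e : expc z a l - expc z b l - (a - b) l =
      ∑' m : ℕ, z ^ (m + 1) / (m + 1).factorial * (cub a (m + 1) - cub b (m + 1)) l := by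
    have h3 := s1.tsum_sub s2
    simp only [Pi.sub_apply, mul_sub]
    rw [h3, expc, expc, ← h1, ← h2]
    simp [cub]
    ring
  rw [e, expMaj_cv, ← ENNReal.tsum_mul_left]
  refine (enorm_tsum_le' _).trans ?_
  have hle : ∀ m : ℕ, ‖z ^ (m + 1) / (m + 1).factorial * (cub a (m + 1) - cub b (m + 1)) l‖ₑ ≤
      (fun m : ℕ => ENNReal.ofReal τ * ((3 * ‖(lam : ℂ)‖ₑ) ^ m / (m.factorial : ℝ≥0∞) *
        (pw A m ⊛ E) l)) (m + 1) := fun m => by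
    have h3 : (2 * (m + 1 : ℕ) + 1 : ℝ≥0∞) ≤ 3 ^ (m + 1) := by
      have : 2 * (m + 1) + 1 ≤ 3 ^ (m + 1) := by
        induction m with
        | zero => norm_num
        | succ m ih => rw [pow_succ]; omega
      exact_mod_cast this
    have ht : ENNReal.ofReal τ ^ m ≤ 1 := pow_le_one' (by simpa using hτ1) m
    rw [enorm_mul, enorm_pow_div_factorial, hz, enorm_I_mul_ofReal_mul lam hτ]
    refine (mul_le_mul' le_rfl (enorm_cub_sub_le hla hlb hA hE ha hb hab (m + 1) l)).trans ?_
    simp only [Pi.smul_apply, smul_eq_mul]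
    rw [← mul_assoc, ← mul_assoc]
    refine mul_le_mul' ?_ le_rfl
    rw [ENNReal.div_eq_inv_mul, ENNReal.div_eq_inv_mul, mul_assoc, mul_left_comm (ENNReal.ofReal τ)]
    refine mul_le_mul' le_rfl ?_
    calc (‖(lam : ℂ)‖ₑ * ENNReal.ofReal τ) ^ (m + 1) * (2 * (m + 1 : ℕ) + 1 : ℝ≥0∞) =
          ENNReal.ofReal τ * (ENNReal.ofReal τ ^ m * ((2 * (m + 1 : ℕ) + 1 : ℝ≥0∞) *
            ‖(lam : ℂ)‖ₑ ^ (m + 1))) := by ring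
      _ ≤ ENNReal.ofReal τ * (1 * (3 ^ (m + 1) * ‖(lam : ℂ)‖ₑ ^ (m + 1))) := by gcongr
      _ = _ := by ring
  exact (ENNReal.tsum_le_tsum hle).trans
    (ENNReal.tsum_comp_le_tsum_of_injective (add_left_injective 1) _)

/-- The kernel in the stability estimate. -/
def stabMaj (L lam : ℝ) (M A : ℤ → ℝ≥0∞) : ℤ → ℝ≥0∞ :=
  expMaj lam A + (6 * ‖(lam : ℂ)‖ₑ) • (A ⊛ A) + (3 * ‖(lam : ℂ)‖ₑ) • (M ⊛ A ⊛ A) + M ⊛ M +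
    (3 : ℝ≥0∞) • (om L * M)

lemma enorm_psiI_le {L τ : ℝ} (hτ : 0 < τ) (k j : ℤ) :
    ‖psiI L τ k j‖ₑ ≤ ENNReal.ofReal τ * (3 * om L k) :=
  enorm_intervalIntegral_le hτ fun _ hρ => enorm_psi_le hτ hρ k j

variable {L lam τ : ℝ} {x : ℤ → ℂ} {M : ℤ → ℝ≥0∞}

/-- Stability of one step of the integrator. -/
lemma enorm_stepc_sub_le (hτ : 0 < τ) (hτ1 : τ ≤ 1) (hla : LOne a) (hlb : LOne b)
    (hA : ∀ l, A (-l) = A l) (hE : ∀ l, E (-l) = E l)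
    (ha : ∀ l, ‖a l‖ₑ ≤ A l) (hb : ∀ l, ‖b l‖ₑ ≤ A l) (hab : ∀ l, ‖(a - b) l‖ₑ ≤ E l)
    (hN : ∑' l, (om L * M) l ≠ ⊤) (hx : ∀ l, ‖x l‖ₑ ≤ M l) (l : ℤ) :
    ‖stepc L lam τ x a l - stepc L lam τ x b l - (a - b) l‖ₑ ≤
      ENNReal.ofReal τ * (stabMaj L lam M A ⊛ E) l := by
  have hMt : ∑' l, M l ≠ ⊤ := ne_top_of_le_ne_top hN (ENNReal.tsum_le_tsum (le_om_mul L M))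
  have hlx : LOne x := lOne_of_le hx hMt
  set t := ENNReal.ofReal τ with ht
  have ht1 : t ≤ 1 := by simpa [ht] using hτ1
  have hone : ∀ k j : ℤ, ‖(fun _ _ => 1 : ℤ → ℤ → ℂ) k j‖ ≤ 1 := by simp
  have h1 := enorm_expc_sub_le hla hlb hA hE ha hb hab (lam := lam) hτ.le hτ1 l
  have h2 := enorm_trilinear_sub_le hla hlb hA hE ha hb hab
    (fun k j => norm_phi_le hτ.le (alpha L k j)) hone l
  have h3 := enorm_trilinear_sub_le hla hlb hA hE ha hb hab hone
    (fun k j => norm_phi_le hτ.le (beta L k j)) l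
  have h4 : ‖conv x (conv (cj a) (conv a a) - conv (cj b) (conv b b)) l‖ₑ ≤
      (M ⊛ ((3 : ℝ≥0∞) • ((A ⊛ A) ⊛ E))) l :=
    enorm_conv_le hx (fun l => by
      simpa [conv] using enorm_trilinear_sub_le hla hlb hA hE ha hb hab hone hone l) l
  have h5 : ‖conv x (conv x (a - b)) l‖ₑ ≤ (M ⊛ M ⊛ E) l :=
    enorm_conv_le hx (enorm_conv_le hx hab) l
  have h6 : ‖bil (psiI L τ) x (a - b) l‖ₑ ≤ (((3 * t) • (om L * M)) ⊛ E) l :=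
    enorm_bil_le (fun k j => by
      simp only [Pi.smul_apply, Pi.mul_apply, smul_eq_mul]
      calc _ ≤ (t * (3 * om L k)) * M k * E j := by
            gcongr
            exacts [enorm_psiI_le hτ k j, hx k, hab j]
        _ = _ := by ring) l
  have hps : ∀ c : ℤ → ℂ, LOne c → BilSummable (psiI L τ) x c l := fun c hc =>
    bilSummable_of_le (A := (3 * t) • (om L * M)) (B := fun l => ‖c l‖ₑ) (fun k j => by
      simp only [Pi.smul_apply, Pi.mul_apply, smul_eq_mul]
      calc _ ≤ (t * (3 * om L k)) * M k * ‖c j‖ₑ := by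
            gcongr
            exacts [enorm_psiI_le hτ k j, hx k]
        _ = _ := by ring)
      (cv_ne_top (by
        simp only [Pi.smul_apply, smul_eq_mul, ENNReal.tsum_mul_left]
        finiteness) (lOne_iff.mp hc) l)
  have e4 := conv_sub_right hlx (hla.cj.conv (hla.conv hla)) (hlb.cj.conv (hlb.conv hlb))
  have e5 : conv x (conv x (a - b)) = conv x (conv x a) - conv x (conv x b) := by
    rw [conv_sub_right hlx hla hlb, conv_sub_right hlx (hlx.conv hla) (hlx.conv hlb)]
  have e6 := bil_sub_right (hps a hla) (hps b hlb)
  have e : stepc L lam τ x a l - stepc L lam τ x b l - (a - b) l =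
      (expc (I * lam * τ) a l - expc (I * lam * τ) b l - (a - b) l) +
      (-I * lam) * (bil (fun k j => phi τ (alpha L k j)) (cj a) (conv a a) l -
        bil (fun k j => phi τ (alpha L k j)) (cj b) (conv b b) l) +
      (-I * lam) * (conv (cj a) (bil (fun k j => phi τ (beta L k j)) a a) l -
        conv (cj b) (bil (fun k j => phi τ (beta L k j)) b b) l) +
      (-(lam * τ ^ 2)) * conv x (conv (cj a) (conv a a) - conv (cj b) (conv b b)) l +
      (-(τ ^ 2 / 2)) * conv x (conv x (a - b)) l + (-I) * bil (psiI L τ) x (a - b) l := by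
    rw [e4, e5, e6]
    simp only [stepc, Pi.add_apply, Pi.sub_apply, Pi.smul_apply, smul_eq_mul]
    ring
  have hc1 : ‖-I * (lam : ℂ)‖ₑ = ‖(lam : ℂ)‖ₑ := by rw [enorm_mul, enorm_neg_I, one_mul]
  have hτe : ‖(τ : ℂ)‖ₑ = t := by
    rw [← ofReal_norm, Complex.norm_real, Real.norm_eq_abs, abs_of_nonneg hτ.le]
  have ht2 : t ^ 2 ≤ t := by rw [sq]; simpa using mul_le_mul' (le_refl t) ht1
  have hc2 : ‖-((lam : ℂ) * τ ^ 2)‖ₑ ≤ ‖(lam : ℂ)‖ₑ * t := by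
    rw [enorm_neg, enorm_mul, enorm_pow, hτe]
    gcongr
  have hc3 : ‖-((τ : ℂ) ^ 2 / 2)‖ₑ ≤ t := by
    refine le_trans ?_ ht2
    rw [enorm_neg, ← hτe, ← enorm_pow]
    refine enorm_le_iff_norm_le.mpr ?_
    rw [norm_div, Complex.norm_two]
    linarith [norm_nonneg ((τ : ℂ) ^ 2)]
  rw [e]
  refine (enorm_add_le _ _).trans ((add_le_add ((enorm_add_le _ _).trans (add_le_add
    ((enorm_add_le _ _).trans (add_le_add ((enorm_add_le _ _).trans (add_le_add
    ((enorm_add_le _ _).trans (add_le_add h1 ((enorm_mul _ _).le.trans (mul_le_mul' hc1.le h2))))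
    ((enorm_mul _ _).le.trans (mul_le_mul' hc1.le h3))))
    ((enorm_mul _ _).le.trans (mul_le_mul' hc2 h4))))
    ((enorm_mul _ _).le.trans (mul_le_mul' hc3 h5))))
    ((enorm_mul _ _).le.trans (mul_le_mul' enorm_neg_I.le h6))).trans (le_of_eq ?_))
  have c1 : M ⊛ (A ⊛ A) ⊛ E = (M ⊛ A ⊛ A) ⊛ E := by ac_rfl
  have c2 : M ⊛ M ⊛ E = (M ⊛ M) ⊛ E := by ac_rfl
  simp only [stabMaj, cv_add_left, cv_smul_left, cv_smul_right, Pi.add_apply, Pi.smul_apply,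
    smul_eq_mul, c1, c2, ENNReal.ofReal_one, ← ht]
  ring

lemma n1_stabMaj_le {p : ℤ → ℝ≥0∞} (hp : Submul p) (hp0 : p 0 = 1) {R : ℝ≥0∞}
    (hR : n1 p A ≤ R) : n1 p (stabMaj L lam M A) ≤
      ∑' m : ℕ, (3 * ‖(lam : ℂ)‖ₑ * R ^ 2) ^ m / (m.factorial : ℝ≥0∞) +
        6 * ‖(lam : ℂ)‖ₑ * (R * R) + 3 * ‖(lam : ℂ)‖ₑ * (n1 p M * (R * R)) + n1 p M * n1 p M +
        3 * n1 p (om L * M) := by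
  have h1 : n1 p (A ⊛ A) ≤ R * R := (hp.n1_cv_le A A).trans (by gcongr)
  have h2 : n1 p (M ⊛ A ⊛ A) ≤ n1 p M * (R * R) := (hp.n1_cv_le _ _).trans (by gcongr)
  rw [stabMaj, n1_add, n1_add, n1_add, n1_add, n1_smul, n1_smul, n1_smul]
  gcongr
  · exact hp.n1_expMaj_le hp0 lam hR
  · exact hp.n1_cv_le M M

end stability

end

section

/-! ### Summation over the time steps -/

/-- The bound `min(n, π / dist(θ, 2πℤ))` for the sums `∑_{m < s} exp(i m θ)`, `s ≤ n`. -/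
def dirichlet (n : ℕ) (y : ℝ) : ℝ≥0∞ := min (n : ℝ≥0∞) (ENNReal.ofReal Real.pi / ENNReal.ofReal |y|)

/-- The representative of `θ` modulo `2π` in `[-π, π]`. -/
def angle (θ : ℝ) : ℝ := θ - 2 * Real.pi * round (θ / (2 * Real.pi))

lemma abs_angle_le (θ : ℝ) : |angle θ| ≤ Real.pi := by
  have hπ := Real.pi_pos
  have h := abs_sub_round (θ / (2 * Real.pi))
  have e : angle θ = (2 * Real.pi) * (θ / (2 * Real.pi) - round (θ / (2 * Real.pi))) := by
    rw [angle]; field_simp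
  rw [e, abs_mul, abs_of_pos (by positivity : 0 < 2 * Real.pi)]
  nlinarith

lemma enorm_geom_sum_le (θ : ℝ) {s n : ℕ} (hs : s ≤ n) :
    ‖∑ m ∈ Finset.range s, Complex.exp (I * θ) ^ m‖ₑ ≤ dirichlet n (angle θ) := by
  have hn : ‖Complex.exp (I * (θ : ℂ))‖ = 1 := by rw [mul_comm, Complex.norm_exp_ofReal_mul_I]
  refine le_min ?_ ?_
  · have h : ‖∑ m ∈ Finset.range s, Complex.exp (I * θ) ^ m‖ ≤ (n : ℝ) := by
      refine (norm_sum_le _ _).trans ?_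
      simp only [norm_pow, hn, one_pow, Finset.sum_const, Finset.card_range, nsmul_eq_mul, mul_one]
      exact_mod_cast hs
    simpa using enorm_le_of_norm_le h
  -- At an exact resonance the second entry of the minimum is `⊤` and imposes nothing.
  · rcases eq_or_ne (angle θ) 0 with h0 | h0
    · simp [h0, ENNReal.div_zero, Real.pi_pos]
    have hpos : 0 < |angle θ| := abs_pos.mpr h0
    rw [← ENNReal.ofReal_div_of_pos hpos]
    refine enorm_le_of_norm_le ?_
    rw [le_div_iff₀ hpos]
    have h1 := congrArg norm (geom_sum_mul (Complex.exp (I * θ)) s)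
    have h2 : ‖Complex.exp (I * (θ : ℂ)) ^ s - 1‖ ≤ 2 := by
      refine (norm_sub_le _ _).trans ?_
      rw [norm_pow, hn, one_pow, norm_one]
      norm_num
    have h3 : Complex.exp (I * (θ : ℂ)) = Complex.exp (I * (angle θ : ℝ)) := by
      rw [← Complex.exp_periodic.int_mul (round (θ / (2 * Real.pi))) (I * (angle θ : ℝ))]
      congr 1
      rw [angle]
      push_cast
      ring
    -- Jordan's inequality again, applicable because half the reduced angle is at most π/2.
    have h4 : 2 / Real.pi * |angle θ| ≤ ‖Complex.exp (I * (θ : ℂ)) - 1‖ := by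
      rw [h3, Complex.norm_exp_I_mul_ofReal_sub_one, norm_mul, Real.norm_eq_abs, abs_two,
        Real.norm_eq_abs]
      have h5 := Real.mul_abs_le_abs_sin (x := angle θ / 2) (by
        rw [abs_div, abs_two]; linarith [abs_angle_le θ])
      rw [abs_div, abs_two] at h5
      calc 2 / Real.pi * |angle θ| = 2 * (2 / Real.pi * (|angle θ| / 2)) := by ring
        _ ≤ _ := by gcongr
    rw [norm_mul] at h1
    have hπ := Real.pi_pos
    have h6 : ‖∑ m ∈ Finset.range s, Complex.exp (I * θ) ^ m‖ * (2 / Real.pi * |angle θ|) ≤ 2 :=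
      (mul_le_mul_of_nonneg_left h4 (norm_nonneg _)).trans (h1.le.trans h2)
    have h7 : ‖∑ m ∈ Finset.range s, Complex.exp (I * θ) ^ m‖ * |angle θ| =
        ‖∑ m ∈ Finset.range s, Complex.exp (I * θ) ^ m‖ * (2 / Real.pi * |angle θ|) *
          (Real.pi / 2) := by
      field_simp
    rw [h7]
    nlinarith

/-- Summation by parts. -/
lemma sum_range_mul_eq (z V : ℕ → ℂ) (n : ℕ) :
    ∑ m ∈ Finset.range n, z m * V m = (∑ m ∈ Finset.range n, z m) * V n -
      ∑ m ∈ Finset.range n, (∑ i ∈ Finset.range (m + 1), z i) * (V (m + 1) - V m) := by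
  induction n with
  | zero => simp
  | succ n ih =>
    rw [Finset.sum_range_succ, ih, Finset.sum_range_succ _ n, Finset.sum_range_succ _ n]
    rw [Finset.sum_range_succ z n]
    ring

/-- After summation by parts only the partial geometric sums and the total variation n t B of the
amplitude enter; with t = τ and nτ ≤ T this variation is bounded. -/
lemma enorm_sum_exp_mul_le (θ : ℝ) (V : ℕ → ℂ) {n : ℕ} {t B : ℝ≥0∞} (hV : ‖V n‖ₑ ≤ B)
    (hd : ∀ m < n, ‖V (m + 1) - V m‖ₑ ≤ t * B) :
    ‖∑ m ∈ Finset.range n, Complex.exp (I * θ) ^ m * V m‖ₑ ≤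
      dirichlet n (angle θ) * ((1 + n * t) * B) := by
  rw [sum_range_mul_eq (fun m => Complex.exp (I * θ) ^ m)]
  refine enorm_sub_le.trans ?_
  have h1 : ‖(∑ m ∈ Finset.range n, Complex.exp (I * θ) ^ m) * V n‖ₑ ≤
      dirichlet n (angle θ) * B := by
    rw [enorm_mul]
    exact mul_le_mul' (enorm_geom_sum_le θ le_rfl) hV
  have h2 : ‖∑ m ∈ Finset.range n, (∑ i ∈ Finset.range (m + 1), Complex.exp (I * θ) ^ i) *
      (V (m + 1) - V m)‖ₑ ≤ ∑ _m ∈ Finset.range n, dirichlet n (angle θ) * (t * B) := by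
    refine (enorm_sum_le _ _).trans (Finset.sum_le_sum fun m hm => ?_)
    rw [enorm_mul]
    rw [Finset.mem_range] at hm
    exact mul_le_mul' (enorm_geom_sum_le θ hm) (hd m hm)
  refine (add_le_add h1 h2).trans (le_of_eq ?_)
  rw [Finset.sum_const, Finset.card_range, nsmul_eq_mul]
  ring

/-- `∑_{j ≠ 0} j⁻²`. -/
def zetaTwo : ℝ≥0∞ := ∑' j : ℤ, ENNReal.ofReal (1 / (j : ℝ) ^ 2)

lemma zetaTwo_ne_top : zetaTwo ≠ ⊤ :=
  (Real.summable_one_div_int_pow.mpr one_lt_two).tsum_ofReal_ne_top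

/-- Recentred at the integer nearest to the zero of the affine function, the j = 0 term is at most
n², and for j ≠ 0 the argument is at least |h||j|/2. -/
lemma tsum_dirichlet_sq_le (n : ℕ) (y : ℝ) {h : ℝ} (hh : h ≠ 0) :
    ∑' j : ℤ, dirichlet n (y + h * j) ^ 2 ≤
      (n : ℝ≥0∞) ^ 2 + ENNReal.ofReal (4 * Real.pi ^ 2 / h ^ 2) * zetaTwo := by
  set r := round (y / h)
  set e := y / h - r
  have he : |e| ≤ 1 / 2 := abs_sub_round _
  rw [← (Equiv.subRight r).tsum_eq]
  have hle : ∀ j : ℤ, dirichlet n (y + h * ((Equiv.subRight r) j : ℤ)) ^ 2 ≤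
      (Pi.single 0 ((n : ℝ≥0∞) ^ 2) : ℤ → ℝ≥0∞) j +
        ENNReal.ofReal (4 * Real.pi ^ 2 / h ^ 2) * ENNReal.ofReal (1 / (j : ℝ) ^ 2) := fun j => by
    rcases eq_or_ne j 0 with rfl | hj
    · simp only [Pi.single_eq_same]
      refine le_trans ?_ le_self_add
      exact pow_le_pow_left' (min_le_left _ _) 2
    · have e1 : y + h * ((Equiv.subRight r) j : ℤ) = h * (j + e) := by
        simp only [Equiv.subRight_apply, Int.cast_sub, e]
        field_simp
        ring
      have hj1 : (1 : ℝ) ≤ |(j : ℝ)| := by exact_mod_cast Int.one_le_abs hj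
      have h2 : |(j : ℝ)| / 2 ≤ |(j : ℝ) + e| := by
        have := abs_sub_abs_le_abs_sub (j : ℝ) (-e)
        rw [abs_neg, sub_neg_eq_add] at this
        linarith
      have h3 : |h| * (|(j : ℝ)| / 2) ≤ |h * (j + e)| := by
        rw [abs_mul]; gcongr
      have hpos : 0 < |h| * (|(j : ℝ)| / 2) := by positivity
      have h4 : dirichlet n (h * (j + e)) ≤ ENNReal.ofReal (Real.pi / (|h| * (|(j : ℝ)| / 2))) := by
        refine (min_le_right _ _).trans ?_
        rw [← ENNReal.ofReal_div_of_pos (hpos.trans_le h3)]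
        refine ENNReal.ofReal_le_ofReal ?_
        gcongr
      rw [e1]
      refine (pow_le_pow_left' h4 2).trans (le_trans (le_of_eq ?_) le_add_self)
      rw [← ENNReal.ofReal_pow (by positivity), ← ENNReal.ofReal_mul (by positivity)]
      congr 1
      rw [div_pow, mul_pow, div_pow, sq_abs, sq_abs]
      have hj0 : (j : ℝ) ≠ 0 := by exact_mod_cast hj
      field_simp
      ring
  refine (ENNReal.tsum_le_tsum hle).trans (le_of_eq ?_)
  rw [ENNReal.tsum_add, tsum_pi_single, ENNReal.tsum_mul_left, zetaTwo]

/-- The sum of the squares of the resonance kernel. -/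
lemma tsum_kernel_sq_le (n : ℕ) (θ : ℝ) {h : ℝ} (hh : h ≠ 0) :
    ∑' j : ℤ, (min 1 (ENNReal.ofReal |h * j|)⁻¹ * dirichlet n (angle (θ + h * j))) ^ 2 ≤
      (4 * ∑' p : ℤ, ((om Real.pi p)⁻¹) ^ 2) *
        ((n : ℝ≥0∞) ^ 2 + ENNReal.ofReal (4 * Real.pi ^ 2 / h ^ 2) * zetaTwo) := by
  have hπ := Real.pi_pos
  have hπ3 := Real.pi_gt_three
  set r := round (θ / (2 * Real.pi)) with hr
  -- The terms are grouped by the multiple p of 2π nearest to θ + hj. Moving |p - r| periods away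
  -- from θ forces |hj| to be of that size, so the factor min(1, 1/|hj|) makes the contributions of
  -- the periods summable like p⁻². Without it each period would contribute equally.
  have hle : ∀ j : ℤ, (min 1 (ENNReal.ofReal |h * j|)⁻¹ * dirichlet n (angle (θ + h * j))) ^ 2 ≤
      ∑' p : ℤ, 4 * ((om Real.pi (p - r))⁻¹) ^ 2 *
        dirichlet n ((θ - 2 * Real.pi * p) + h * j) ^ 2 := fun j => by
    set p := round ((θ + h * j) / (2 * Real.pi)) with hp
    refine le_trans ?_ (ENNReal.le_tsum p)
    rw [mul_pow]
    have e1 : angle (θ + h * j) = (θ - 2 * Real.pi * p) + h * j := by rw [angle]; ring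
    rw [e1]
    refine mul_le_mul' ?_ le_rfl
    -- With L = π the weight `om` is 1 + |p|.
    have hom : om Real.pi (p - r) = ENNReal.ofReal (1 + |((p - r : ℤ) : ℝ)|) := by
      rw [om, freq, mul_div_assoc, mul_div_cancel₀ _ hπ.ne']
    have h4 : (4 : ℝ≥0∞) = 2 ^ 2 := by norm_num
    rw [h4, ← mul_pow]
    refine pow_le_pow_left' ?_ 2
    have hpd : 0 < 1 + |((p - r : ℤ) : ℝ)| := by positivity
    rw [hom, ← ENNReal.ofReal_inv_of_pos hpd,
      show (2 : ℝ≥0∞) = ENNReal.ofReal 2 by simp, ← ENNReal.ofReal_mul (by norm_num)]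
    set d := |((p - r : ℤ) : ℝ)| with hd
    rcases le_or_gt d 1 with h1 | h1
    · refine (min_le_left _ _).trans ?_
      rw [← ENNReal.ofReal_one]
      refine ENNReal.ofReal_le_ofReal ?_
      rw [← div_eq_mul_inv, le_div_iff₀ (by positivity)]
      linarith
    · have a1 := abs_angle_le (θ + h * j)
      have a2 := abs_angle_le θ
      have a3 : 2 * Real.pi * ((p - r : ℤ) : ℝ) = h * j - angle (θ + h * j) + angle θ := by
        rw [e1, angle, ← hr]; push_cast; ring
      have a4 : 2 * Real.pi * d ≤ |h * j| + Real.pi + Real.pi := by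
        have : 2 * Real.pi * d = |2 * Real.pi * ((p - r : ℤ) : ℝ)| := by
          rw [abs_mul, abs_of_pos (by positivity : 0 < 2 * Real.pi)]
        rw [this, a3]
        exact (abs_add_le _ _).trans (by linarith [abs_sub (h * (j : ℝ)) (angle (θ + h * j))])
      -- Integrality improves d > 1 to d ≥ 2, which leaves room to subtract the two angles of size
      -- at most π.
      have h2 : (2 : ℝ) ≤ d := by
        have : (1 : ℤ) < |p - r| := by
          have h1' : (1 : ℝ) < ((|p - r| : ℤ) : ℝ) := by rw [Int.cast_abs]; exact h1
          exact_mod_cast h1'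
        have h2' : ((2 : ℤ) : ℝ) ≤ ((|p - r| : ℤ) : ℝ) := by exact_mod_cast this
        rw [Int.cast_abs] at h2'
        simpa only [Int.cast_ofNat] using h2'
      have h3 : (1 + d) / 2 ≤ |h * j| := by nlinarith
      refine (min_le_right _ _).trans ?_
      rw [← ENNReal.ofReal_inv_of_pos (by linarith)]
      refine ENNReal.ofReal_le_ofReal ?_
      calc |h * j|⁻¹ ≤ ((1 + d) / 2)⁻¹ := by gcongr
        _ = _ := by rw [inv_div]; rfl
  refine (ENNReal.tsum_le_tsum hle).trans ?_
  rw [ENNReal.tsum_comm]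
  simp only [ENNReal.tsum_mul_left]
  calc _ ≤ ∑' p : ℤ, 4 * ((om Real.pi (p - r))⁻¹) ^ 2 *
        ((n : ℝ≥0∞) ^ 2 + ENNReal.ofReal (4 * Real.pi ^ 2 / h ^ 2) * zetaTwo) :=
        ENNReal.tsum_le_tsum fun p => mul_le_mul' le_rfl (tsum_dirichlet_sq_le n _ hh)
    _ = _ := by
        rw [ENNReal.tsum_mul_right, ENNReal.tsum_mul_left,
          ← (Equiv.subRight r).tsum_eq (fun p => ((om Real.pi p)⁻¹) ^ 2)]
        rfl

end

/-! ### The resonance kernel and the sum of the non-smoothing errors over the steps. -/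

section

section badSum

variable {L τ : ℝ}

/-- The resonance kernel that remains after summation by parts. -/
def resKer (L τ : ℝ) (n : ℕ) (k j : ℤ) : ℝ≥0∞ :=
  if k = 0 then 0 else
    min 1 (ENNReal.ofReal |τ * beta L k j|)⁻¹ * dirichlet n (angle (τ * eta L k j))

lemma kap_zero_left (L τ : ℝ) (j : ℤ) : kap L τ 0 j = 0 := by
  simp [kap, badS, beta, freq_zero]

/-- Combines a first-order and a second-order bound into the second-order one with a gain for large
x. -/
lemma le_sq_mul_min {x z : ℝ≥0∞} (hx : x ≠ ⊤) (h1 : z ≤ x) (h2 : z ≤ x ^ 2) :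
    z ≤ x ^ 2 * min 1 x⁻¹ := by
  rcases eq_or_ne x 0 with rfl | h0
  · simpa using h1
  rcases le_total 1 x⁻¹ with h | h
  · rwa [min_eq_left h, mul_one]
  · rwa [min_eq_right h, sq, mul_assoc, ENNReal.mul_inv_cancel h0 hx, mul_one]

/-- The second-order Taylor bound gives τ³ at the cost of ω² on both factors. The first-order bound
adds the gain min(1, 1/|τβ|), which later makes the kernel summable over periods. -/
lemma enorm_kap_le (hτ : 0 < τ) (k j : ℤ) : ‖kap L τ k j‖ₑ ≤
    8 * ENNReal.ofReal τ ^ 3 * (om L k ^ 2 * om L j ^ 2) *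
      min 1 (ENNReal.ofReal |τ * beta L k j|)⁻¹ := by
  set t := ENNReal.ofReal τ
  set X := ENNReal.ofReal |τ * beta L k j|
  have hX : X ≤ 2 * t * (om L k * om L j) := by
    calc X = t * ENNReal.ofReal |beta L k j| := by
          rw [← ENNReal.ofReal_mul hτ.le]
          simp only [X, abs_mul, abs_of_pos hτ]
      _ ≤ t * (2 * (om L k * om L j)) := by gcongr; exact abs_beta_le L k j
      _ = _ := by ring
  have habs : ∀ ρ ∈ Icc 0 τ, |ρ * beta L k j| ≤ |τ * beta L k j| := fun ρ hρ => by
    rw [abs_mul, abs_mul, abs_of_nonneg hρ.1, abs_of_pos hτ]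
    gcongr
    exact hρ.2
  have hb : ∀ ρ ∈ Icc 0 τ, ‖badS L ρ k j‖ₑ ≤ 2 * (X ^ 2 * min 1 X⁻¹) := fun ρ hρ => by
    have h1 : ‖badS L ρ k j‖ₑ ≤ 2 * X := by
      rw [show (2 : ℝ≥0∞) = ENNReal.ofReal 2 by simp, ← ENNReal.ofReal_mul (by norm_num)]
      refine enorm_le_of_norm_le ?_
      rw [norm_badS]
      refine (norm_exp_I_sub_one_sub_le _).trans ?_
      gcongr 2 * ?_
      exact habs ρ hρ
    have h2 : ‖badS L ρ k j‖ₑ ≤ 2 * X ^ 2 := by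
      rw [show (2 : ℝ≥0∞) = ENNReal.ofReal 2 by simp, ← ENNReal.ofReal_pow (abs_nonneg _),
        ← ENNReal.ofReal_mul (by norm_num)]
      refine enorm_le_of_norm_le ?_
      rw [norm_badS]
      refine (norm_exp_I_sub_one_sub_le_sq _).trans ?_
      gcongr 2 * ?_ ^ 2
      exact habs ρ hρ
    have h3 : ∀ z : ℝ≥0∞, ‖badS L ρ k j‖ₑ ≤ 2 * z → ‖badS L ρ k j‖ₑ / 2 ≤ z := fun z hz =>
      ENNReal.div_le_of_le_mul' hz
    have h4 := le_sq_mul_min ENNReal.ofReal_ne_top (h3 _ h1) (h3 _ h2)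
    rwa [ENNReal.div_le_iff_le_mul (by simp) (by simp), mul_comm] at h4
  rw [kap, enorm_mul, enorm_neg_I, one_mul]
  refine (enorm_intervalIntegral_le hτ hb).trans ?_
  calc t * (2 * (X ^ 2 * min 1 X⁻¹)) ≤
        t * (2 * ((2 * t * (om L k * om L j)) ^ 2 * min 1 X⁻¹)) := by
        refine mul_le_mul' le_rfl (mul_le_mul' le_rfl (mul_le_mul' (pow_le_pow_left' hX 2) le_rfl))
    _ = _ := by ring

lemma enorm_kap_mul_dirichlet_le (hτ : 0 < τ) (n : ℕ) (k j : ℤ) :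
    ‖kap L τ k j‖ₑ * dirichlet n (angle (τ * eta L k j)) ≤
      8 * ENNReal.ofReal τ ^ 3 * (om L k ^ 2 * om L j ^ 2) * resKer L τ n k j := by
  rcases eq_or_ne k 0 with rfl | hk
  · simp [kap_zero_left]
  · rw [resKer, if_neg hk, ← mul_assoc]
    exact mul_le_mul' (enorm_kap_le hτ k j) le_rfl

/-- For k ≠ 0 the quantity τβ is hj, and τη is hj plus a constant, with h = 2τμ_kπ/L. The spectral
gap |μ_k| ≥ π/L bounds τ²/h² uniformly in k, and nτ ≤ T bounds the n² term. -/
lemma tsum_resKer_sq_le [Fact (0 < 2 * L)] (hτ : 0 < τ) {T : ℝ} {n : ℕ}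
    (hn : n * τ ≤ T) (k : ℤ) :
    ENNReal.ofReal τ ^ 2 * ∑' j, resKer L τ n k j ^ 2 ≤
      (4 * ∑' p : ℤ, ((om Real.pi p)⁻¹) ^ 2) * (ENNReal.ofReal T ^ 2 +
        ENNReal.ofReal (Real.pi ^ 2 / (Real.pi / L) ^ 4) * zetaTwo) := by
  rcases eq_or_ne k 0 with rfl | hk
  · simp [resKer]
  have hL := pos_L L
  have hπ := Real.pi_pos
  have hμ := le_abs_freq (L := L) hk
  set h := 2 * τ * freq L k * (Real.pi / L) with hh
  have hh0 : h ≠ 0 := by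
    have := freq_ne_zero (L := L) hk
    positivity
  have e1 : ∀ j : ℤ, τ * beta L k j = h * j := fun j => by
    rw [beta, hh]; conv_lhs => rw [freq.eq_def L j]
    ring
  have e2 : ∀ j : ℤ, τ * eta L k j = τ * freq L k ^ 2 + h * j := fun j => by
    rw [← e1, eta, beta]; ring
  simp only [resKer, if_neg hk, e1, e2]
  refine (mul_le_mul' le_rfl (tsum_kernel_sq_le n _ hh0)).trans ?_
  rw [mul_left_comm, mul_add, ← mul_assoc (ENNReal.ofReal τ ^ 2)]
  have h1 : ENNReal.ofReal τ ^ 2 * (n : ℝ≥0∞) ^ 2 ≤ ENNReal.ofReal T ^ 2 := by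
    rw [← mul_pow, ← ENNReal.ofReal_natCast, ← ENNReal.ofReal_mul hτ.le, mul_comm]
    gcongr
  have h2 : ENNReal.ofReal τ ^ 2 * ENNReal.ofReal (4 * Real.pi ^ 2 / h ^ 2) ≤
      ENNReal.ofReal (Real.pi ^ 2 / (Real.pi / L) ^ 4) := by
    rw [← ENNReal.ofReal_pow hτ.le, ← ENNReal.ofReal_mul (by positivity)]
    refine ENNReal.ofReal_le_ofReal ?_
    have h3 : (Real.pi / L) ^ 2 ≤ freq L k ^ 2 := by
      rw [← sq_abs (freq L k)]; gcongr
    have h4 : freq L k ^ 2 ≠ 0 := pow_ne_zero 2 (freq_ne_zero (L := L) hk)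
    have h5 : τ ^ 2 * (4 * Real.pi ^ 2 / h ^ 2) =
        Real.pi ^ 2 / (freq L k ^ 2 * (Real.pi / L) ^ 2) := by
      rw [hh]; field_simp; ring
    rw [h5]
    have h6 : (Real.pi / L) ^ 4 ≤ freq L k ^ 2 * (Real.pi / L) ^ 2 := by
      calc (Real.pi / L) ^ 4 = (Real.pi / L) ^ 2 * (Real.pi / L) ^ 2 := by ring
        _ ≤ _ := by gcongr
    gcongr
  gcongr

/-- Replaces Young's inequality when both sequences are only in ℓ²: the missing summability comes
from the kernel, square summable in j for each k. -/
lemma tsum_sq_tsum_kernel_le (F G : ℤ → ℝ≥0∞) (K : ℤ → ℤ → ℝ≥0∞) :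
    ∑' l, (∑' k, F k * G (l - k) * K k (l - k)) ^ 2 ≤
      (∑' j, G j ^ 2) * ∑' k, F k ^ 2 * ∑' j, K k j ^ 2 := by
  have h1 : ∀ l, (∑' k, F k * G (l - k) * K k (l - k)) ^ 2 ≤
      (∑' j, G j ^ 2) * ∑' k, F k ^ 2 * K k (l - k) ^ 2 := fun l => by
    have h := tsum_mul_sq_le (fun k => G (l - k)) (fun k => F k * K k (l - k))
    have e : ∑' k, G (l - k) ^ 2 = ∑' j, G j ^ 2 :=
      (Equiv.subLeft l).tsum_eq (fun j => G j ^ 2)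
    rw [e] at h
    simp only [mul_pow] at h
    refine le_trans (le_of_eq ?_) h
    congr 1
    exact tsum_congr fun k => by ring
  refine (ENNReal.tsum_le_tsum h1).trans (le_of_eq ?_)
  rw [ENNReal.tsum_mul_left, ENNReal.tsum_comm]
  congr 1
  refine tsum_congr fun k => ?_
  rw [ENNReal.tsum_mul_left]
  congr 1
  exact (Equiv.subRight k).tsum_eq (fun j => K k j ^ 2)

variable {x : ℤ → ℂ} {M : ℤ → ℝ≥0∞}

lemma enorm_sum_bil_kap_le (hτ : 0 < τ) (hN2 : ∀ l, cv (om L ^ 2 * M) (om L ^ 2 * M) l ≠ ⊤)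
    (hx : ∀ l, ‖x l‖ₑ ≤ M l) {n : ℕ} {a : ℕ → ℤ → ℂ} (ha : ∀ m ≤ n, ∀ l, ‖a m l‖ₑ ≤ M l)
    (hd : ∀ m < n, ∀ l, ‖tw L ((m + 1 : ℕ) * τ) l * a (m + 1) l - tw L (m * τ) l * a m l‖ₑ ≤
      ENNReal.ofReal τ * M l) (l : ℤ) :
    ‖∑ m ∈ Finset.range n, tw L (m * τ) l * bil (kap L τ) x (a m) l‖ₑ ≤
      (1 + n * ENNReal.ofReal τ) * (8 * ENNReal.ofReal τ ^ 3) *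
        ∑' k, (om L ^ 2 * M) k * (om L ^ 2 * M) (l - k) * resKer L τ n k (l - k) := by
  set t := ENNReal.ofReal τ
  have hs : ∀ m ≤ n, BilSummable (kap L τ) x (a m) l := fun m hm =>
    bilSummable_of_le (A := (8 * t ^ 3) • (om L ^ 2 * M)) (B := om L ^ 2 * M) (fun k j => by
      simp only [Pi.smul_apply, Pi.mul_apply, Pi.pow_apply, smul_eq_mul]
      calc _ ≤ (8 * t ^ 3 * (om L k ^ 2 * om L j ^ 2) * 1) * M k * M j := by
            gcongr
            · exact (enorm_kap_le hτ k j).trans (mul_le_mul' le_rfl (min_le_left _ _))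
            · exact hx k
            · exact ha m hm j
        _ = _ := by ring) (by
      rw [cv_smul_left, Pi.smul_apply, smul_eq_mul]
      have := hN2 l
      finiteness)
  have e : ∑ m ∈ Finset.range n, tw L (m * τ) l * bil (kap L τ) x (a m) l =
      ∑' k, kap L τ k (l - k) * x k * ∑ m ∈ Finset.range n,
        Complex.exp (I * (τ * eta L k (l - k) : ℝ)) ^ m *
          (tw L (m * τ) (l - k) * a m (l - k)) := by
    have h1 : ∀ m ∈ Finset.range n, Summable fun k => tw L (m * τ) l *
        (kap L τ k (l - k) * x k * a m (l - k)) := fun m hm =>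
      Summable.mul_left _ (hs m (Finset.mem_range.mp hm).le)
    simp only [bil, ← tsum_mul_left]
    rw [← Summable.tsum_finsetSum h1]
    refine tsum_congr fun k => ?_
    rw [Finset.mul_sum]
    refine Finset.sum_congr rfl fun m _ => ?_
    -- Since τη = τ(μ_l² - μ_j²), the propagator at l is a pure power in m times the propagator at
    -- j, which makes the solution coefficient slowly varying in m.
    have h2 : tw L (m * τ) l = Complex.exp (I * (τ * eta L k (l - k) : ℝ)) ^ m *
        tw L (m * τ) (l - k) := by
      have h3 : freq L l = freq L k + freq L (l - k) := by rw [← freq_add, add_sub_cancel]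
      rw [← Complex.exp_nat_mul, tw, tw, ← Complex.exp_add, h3, eta]
      congr 1
      push_cast
      ring
    rw [h2]
    ring
  rw [e, ← ENNReal.tsum_mul_left]
  refine (enorm_tsum_le' _).trans (ENNReal.tsum_le_tsum fun k => ?_)
  rw [enorm_mul, enorm_mul]
  have h1 := enorm_sum_exp_mul_le (τ * eta L k (l - k))
    (fun m => tw L (m * τ) (l - k) * a m (l - k)) (n := n) (t := t) (B := M (l - k))
    (by rw [enorm_tw_mul]; exact ha n le_rfl _) (fun m hm => hd m hm _)
  calc _ ≤ ‖kap L τ k (l - k)‖ₑ * M k * (dirichlet n (angle (τ * eta L k (l - k))) *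
        ((1 + n * t) * M (l - k))) := mul_le_mul' (mul_le_mul' le_rfl (hx k)) h1
    _ = (‖kap L τ k (l - k)‖ₑ * dirichlet n (angle (τ * eta L k (l - k)))) *
        (M k * ((1 + n * t) * M (l - k))) := by ring
    _ ≤ (8 * t ^ 3 * (om L k ^ 2 * om L (l - k) ^ 2) * resKer L τ n k (l - k)) *
        (M k * ((1 + n * t) * M (l - k))) :=
        mul_le_mul' (enorm_kap_mul_dirichlet_le hτ n k (l - k)) le_rfl
    _ = _ := by
        simp only [Pi.mul_apply, Pi.pow_apply]
        ring

/-- The non-smoothing parts of the local errors add up to an error of order `τ²`. -/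
lemma n2_sum_bil_kap_le [Fact (0 < 2 * L)] (hτ : 0 < τ) {p : ℤ → ℝ≥0∞} (hp : Submul p)
    (hp1 : ∀ l, 1 ≤ p l) (hM2 : n2 p (om L ^ 2 * M) ≠ ⊤)
    (hx : ∀ l, ‖x l‖ₑ ≤ M l) {T : ℝ} {n : ℕ} (hn : n * τ ≤ T) {a : ℕ → ℤ → ℂ}
    (ha : ∀ m ≤ n, ∀ l, ‖a m l‖ₑ ≤ M l)
    (hd : ∀ m < n, ∀ l, ‖tw L ((m + 1 : ℕ) * τ) l * a (m + 1) l - tw L (m * τ) l * a m l‖ₑ ≤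
      ENNReal.ofReal τ * M l) :
    n2 p (fun l => ‖∑ m ∈ Finset.range n, tw L (m * τ) l * bil (kap L τ) x (a m) l‖ₑ) ≤
      ENNReal.ofReal τ ^ 4 * (((1 + ENNReal.ofReal T) * 8) ^ 2 * (n2 p (om L ^ 2 * M)) ^ 2 *
        ((4 * ∑' p : ℤ, ((om Real.pi p)⁻¹) ^ 2) * (ENNReal.ofReal T ^ 2 +
        ENNReal.ofReal (Real.pi ^ 2 / (Real.pi / L) ^ 4) * zetaTwo))) := by
  set t := ENNReal.ofReal τ
  set C₀ := (4 * ∑' p : ℤ, ((om Real.pi p)⁻¹) ^ 2) * (ENNReal.ofReal T ^ 2 +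
        ENNReal.ofReal (Real.pi ^ 2 / (Real.pi / L) ^ 4) * zetaTwo)
  set F : ℤ → ℝ≥0∞ := p * (om L ^ 2 * M)
  have hF : ∑' k, F k ^ 2 = n2 p (om L ^ 2 * M) := rfl
  have hMF : om L ^ 2 * M ≤ F := fun l => by
    have h := mul_le_mul' (hp1 l) (le_refl ((om L ^ 2 * M) l))
    rwa [one_mul] at h
  -- Two ℓ² sequences have a finite convolution at each frequency; this gives convergence of the
  -- series, but no ℓ² bound.
  have hN2 : ∀ l, cv (om L ^ 2 * M) (om L ^ 2 * M) l ≠ ⊤ := fun l htop => by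
    have h := tsum_mul_sq_le (om L ^ 2 * M) (fun k => (om L ^ 2 * M) (l - k))
    have e : ∑' k, (om L ^ 2 * M) (l - k) ^ 2 = ∑' k, (om L ^ 2 * M) k ^ 2 :=
      (Equiv.subLeft l).tsum_eq (fun k => (om L ^ 2 * M) k ^ 2)
    have hle : ∑' k, (om L ^ 2 * M) k ^ 2 ≤ n2 p (om L ^ 2 * M) :=
      ENNReal.tsum_le_tsum fun k => pow_le_pow_left' (hMF k) 2
    rw [e] at h
    have h2 : cv (om L ^ 2 * M) (om L ^ 2 * M) l ^ 2 ≠ ⊤ :=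
      ne_top_of_le_ne_top (by finiteness) (h.trans (mul_le_mul' hle hle))
    rw [htop] at h2
    simp at h2
  have hnt : (n : ℝ≥0∞) * t ≤ ENNReal.ofReal T := by
    rw [← ENNReal.ofReal_natCast, ← ENNReal.ofReal_mul (by positivity)]
    exact ENNReal.ofReal_le_ofReal hn
  have h1 : ∀ l, p l * ‖∑ m ∈ Finset.range n, tw L (m * τ) l * bil (kap L τ) x (a m) l‖ₑ ≤
      ((1 + ENNReal.ofReal T) * (8 * t ^ 3)) *
        ∑' k, F k * F (l - k) * resKer L τ n k (l - k) := fun l => by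
    refine (mul_le_mul' le_rfl (enorm_sum_bil_kap_le hτ hN2 hx ha hd l)).trans ?_
    rw [mul_left_comm]
    refine mul_le_mul' (by gcongr) ?_
    rw [← ENNReal.tsum_mul_left]
    refine ENNReal.tsum_le_tsum fun k => ?_
    have h2 := hp k (l - k)
    rw [add_sub_cancel] at h2
    calc _ ≤ (p k * p (l - k)) * ((om L ^ 2 * M) k * (om L ^ 2 * M) (l - k) *
          resKer L τ n k (l - k)) := by gcongr
      _ = _ := by simp only [F, Pi.mul_apply]; ring
  calc _ ≤ ∑' l, (((1 + ENNReal.ofReal T) * (8 * t ^ 3)) *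
        ∑' k, F k * F (l - k) * resKer L τ n k (l - k)) ^ 2 :=
        ENNReal.tsum_le_tsum fun l => pow_le_pow_left' (h1 l) 2
    _ ≤ ((1 + ENNReal.ofReal T) * (8 * t ^ 3)) ^ 2 *
        ((∑' j, F j ^ 2) * ∑' k, F k ^ 2 * ∑' j, resKer L τ n k j ^ 2) := by
        simp only [mul_pow _ (∑' k, F k * F (_ - k) * resKer L τ n k (_ - k)),
          ENNReal.tsum_mul_left]
        exact mul_le_mul' le_rfl (tsum_sq_tsum_kernel_le F F _)
    -- Of the six powers of τ, two pay for the kernel, and four remain in the squared norm.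
    _ = t ^ 4 * (((1 + ENNReal.ofReal T) * 8) ^ 2 * (∑' j, F j ^ 2) *
        ∑' k, F k ^ 2 * (t ^ 2 * ∑' j, resKer L τ n k j ^ 2)) := by
        simp only [mul_left_comm _ (t ^ 2), ENNReal.tsum_mul_left]
        ring
    _ ≤ t ^ 4 * (((1 + ENNReal.ofReal T) * 8) ^ 2 * (∑' j, F j ^ 2) * ∑' k, F k ^ 2 * C₀) := by
        gcongr with k
        exact tsum_resKer_sq_le hτ hn k
    _ = _ := by
        rw [ENNReal.tsum_mul_right, hF]
        ring

end badSum

end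

section

/-! ### Global error -/

section gronwall

lemma ennreal_sq_sum_range_le (n : ℕ) (f : ℕ → ℝ≥0∞) :
    (∑ i ∈ Finset.range n, f i) ^ 2 ≤ n * ∑ i ∈ Finset.range n, f i ^ 2 := by
  have h := tsum_mul_sq_le (fun _ : Fin n => (1 : ℝ≥0∞)) (fun i : Fin n => f i)
  simpa [tsum_fintype, Finset.sum_range] using h

lemma n2_sum_range_le (p : ℤ → ℝ≥0∞) (A : ℕ → ℤ → ℝ≥0∞) (n : ℕ) :
    n2 p (fun l => ∑ m ∈ Finset.range n, A m l) ≤ n * ∑ m ∈ Finset.range n, n2 p (A m) := by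
  have e : ∑ m ∈ Finset.range n, n2 p (A m) =
      ∑' l, ∑ m ∈ Finset.range n, (p l * A m l) ^ 2 :=
    (Summable.tsum_finsetSum fun _ _ => ENNReal.summable).symm
  rw [e, ← ENNReal.tsum_mul_left]
  refine ENNReal.tsum_le_tsum fun l => ?_
  rw [Finset.mul_sum]
  exact ennreal_sq_sum_range_le n _

lemma one_add_mul_pow_le {τ T : ℝ} (hτ : 0 ≤ τ) {c : ℝ≥0∞} (hc : c ≠ ⊤) {n : ℕ}
    (hn : n * τ ≤ T) :
    (1 + ENNReal.ofReal τ * c) ^ n ≤ ENNReal.ofReal (Real.exp (T * c.toReal)) := by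
  have hc0 : 0 ≤ c.toReal := ENNReal.toReal_nonneg
  rw [← ENNReal.ofReal_toReal hc, ENNReal.toReal_ofReal hc0, ← ENNReal.ofReal_mul hτ,
    ← ENNReal.ofReal_one, ← ENNReal.ofReal_add zero_le_one (by positivity),
    ← ENNReal.ofReal_pow (by positivity)]
  refine ENNReal.ofReal_le_ofReal ?_
  have h1 : 1 + τ * c.toReal ≤ Real.exp (τ * c.toReal) := by
    linarith [Real.add_one_le_exp (τ * c.toReal)]
  calc (1 + τ * c.toReal) ^ n ≤ Real.exp (τ * c.toReal) ^ n := by gcongr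
    _ = Real.exp (n * τ * c.toReal) := by rw [← Real.exp_nat_mul]; ring_nf
    _ ≤ _ := by gcongr

/-- Discrete Gronwall inequality in summed form. -/
lemma le_mul_pow_of_le_sum {z : ℕ → ℝ≥0∞} {B c : ℝ≥0∞} {N : ℕ}
    (h : ∀ n ≤ N, z n ≤ B + c * ∑ m ∈ Finset.range n, z m) {n : ℕ} (hn : n ≤ N) :
    z n ≤ B * (1 + c) ^ n := by
  have h1 : ∀ n ≤ N, B + c * ∑ m ∈ Finset.range n, z m ≤ B * (1 + c) ^ n := by
    intro n
    induction n with
    | zero => simp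
    | succ n ih =>
      intro hn
      have h2 := ih (by omega)
      rw [Finset.sum_range_succ]
      calc B + c * (∑ m ∈ Finset.range n, z m + z n) =
            (B + c * ∑ m ∈ Finset.range n, z m) + c * z n := by ring
        _ ≤ B * (1 + c) ^ n + c * (B * (1 + c) ^ n) := by
            gcongr
            exact (h n (by omega)).trans h2
        _ = _ := by ring
  exact (h n hn).trans (h1 n hn)

end gronwall

/-- The even majorant `|e(l)| + |e(-l)|`. -/
def sym (e : ℤ → ℂ) (l : ℤ) : ℝ≥0∞ := ‖e l‖ₑ + ‖e (-l)‖ₑ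

lemma sym_neg (e : ℤ → ℂ) (l : ℤ) : sym e (-l) = sym e l := by
  rw [sym, sym, neg_neg, add_comm]

lemma n1_sym {p : ℤ → ℝ≥0∞} (hp : ∀ l, p (-l) = p l) (e : ℤ → ℂ) :
    n1 p (sym e) = 2 * n1 p (fun l => ‖e l‖ₑ) := by
  have h := n1_add p (fun l => ‖e l‖ₑ) (fun l => ‖e (-l)‖ₑ)
  rw [n1_neg hp (fun l => ‖e l‖ₑ), ← two_mul] at h
  exact h

lemma n2_sym_le {p : ℤ → ℝ≥0∞} (hp : ∀ l, p (-l) = p l) (e : ℤ → ℂ) :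
    n2 p (sym e) ≤ 4 * n2 p (fun l => ‖e l‖ₑ) := by
  have h := n2_add_le p (fun l => ‖e l‖ₑ) (fun l => ‖e (-l)‖ₑ)
  rw [n2_neg hp (fun l => ‖e l‖ₑ)] at h
  refine h.trans (le_of_eq ?_)
  ring

/-! ### Stability bootstrap in ℓ¹ and discrete Gronwall in ℓ². -/

section globalError

variable {L lam τ T : ℝ} {x : ℤ → ℂ} {M p : ℤ → ℝ≥0∞} {a b : ℕ → ℤ → ℂ} {N : ℕ}

/-- The propagated error of one step. -/
def stabErr (L lam τ : ℝ) (x a b : ℤ → ℂ) (l : ℤ) : ℂ :=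
  stepc L lam τ x a l - stepc L lam τ x b l - (a - b) l

/-- The numerical solution is dominated by `M` plus the error itself, so its size is controlled as
soon as the ℓ¹ error is at most 1. -/
lemma enorm_stabErr_le (hτ : 0 < τ) (hτ1 : τ ≤ 1) (hM : ∀ l, M (-l) = M l)
    (hN : ∑' l, (om L * M) l ≠ ⊤) (hx : ∀ l, ‖x l‖ₑ ≤ M l) {a b : ℤ → ℂ}
    (ha : ∀ l, ‖a l‖ₑ ≤ M l) (hlb : LOne b) (l : ℤ) :
    ‖stabErr L lam τ x a b l‖ₑ ≤
      ENNReal.ofReal τ * (stabMaj L lam M (M + sym (a - b)) ⊛ sym (a - b)) l := by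
  have hMt : ∑' l, M l ≠ ⊤ := ne_top_of_le_ne_top hN (ENNReal.tsum_le_tsum (le_om_mul L M))
  refine enorm_stepc_sub_le hτ hτ1 (lOne_of_le ha hMt) hlb
    (fun l => by simp only [hM, sym_neg]) (sym_neg _)
    (fun l => (ha l).trans le_self_add) (fun l => ?_) (fun l => le_self_add) hN hx l
  have e : b l = a l - (a - b) l := by simp
  rw [e]
  exact enorm_sub_le.trans (add_le_add (ha l) le_self_add)

/-- The constant in the stability estimate. -/
def stabConst (L lam : ℝ) (p M : ℤ → ℝ≥0∞) : ℝ≥0∞ :=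
  ∑' m : ℕ, (3 * ‖(lam : ℂ)‖ₑ * (n1 p M + 2) ^ 2) ^ m / (m.factorial : ℝ≥0∞) +
    6 * ‖(lam : ℂ)‖ₑ * ((n1 p M + 2) * (n1 p M + 2)) +
    3 * ‖(lam : ℂ)‖ₑ * (n1 p M * ((n1 p M + 2) * (n1 p M + 2))) + n1 p M * n1 p M +
    3 * n1 p (om L * M)

lemma stabConst_ne_top (hN : n1 p (om L * M) ≠ ⊤) : stabConst L lam p M ≠ ⊤ := by
  have h1 := n1_ne_top_of_om hN
  have h2 : ‖(lam : ℂ)‖ₑ ≠ ⊤ := enorm_ne_top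
  have h3 := tsum_pow_div_factorial_ne_top (x := 3 * ‖(lam : ℂ)‖ₑ * (n1 p M + 2) ^ 2)
    (by finiteness)
  unfold stabConst
  finiteness

lemma n1_stabMaj_sym_le (hp : Submul p) (hp0 : p 0 = 1) (hpe : ∀ l, p (-l) = p l) {e : ℤ → ℂ}
    (he : n1 p (fun l => ‖e l‖ₑ) ≤ 1) : n1 p (stabMaj L lam M (M + sym e)) ≤
      stabConst L lam p M := by
  refine n1_stabMaj_le hp hp0 ?_
  rw [n1_add, n1_sym hpe]
  gcongr
  calc 2 * n1 p (fun l => ‖e l‖ₑ) ≤ 2 * 1 := by gcongr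
    _ = 2 := mul_one 2

/-- The sum of the contributions of the single steps. -/
lemma tw_mul_error_eq (hab : a 0 = b 0)
    (hb : ∀ m < N, ∀ l, tw L τ l * b (m + 1) l = stepc L lam τ x (b m) l) {n : ℕ} (hn : n ≤ N) (l : ℤ) :
    tw L (n * τ) l * (a n - b n) l =
      ∑ m ∈ Finset.range n, tw L (m * τ) l * stabErr L lam τ x (a m) (b m) l +
      ∑ m ∈ Finset.range n, tw L (m * τ) l * (tw L τ l * a (m + 1) l -
        stepc L lam τ x (a m) l - bil (kap L τ) x (a m) l) +
      ∑ m ∈ Finset.range n, tw L (m * τ) l * bil (kap L τ) x (a m) l := by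
  induction n with
  | zero => simp [hab]
  | succ n ih =>
    have h := ih (by omega)
    have e : tw L ((n + 1 : ℕ) * τ) l = tw L (n * τ) l * tw L τ l := by
      rw [← tw_add]; congr 1; push_cast; ring
    rw [Finset.sum_range_succ, Finset.sum_range_succ, Finset.sum_range_succ, e, stabErr,
      ← hb n (by omega)]
    simp only [Pi.sub_apply] at h ⊢
    linear_combination h

/-- The constant in the bound of the non-smoothing part of the error. -/
def badConst (L T : ℝ) (p M : ℤ → ℝ≥0∞) : ℝ≥0∞ :=
  ((1 + ENNReal.ofReal T) * 8) ^ 2 * (n2 p (om L ^ 2 * M)) ^ 2 *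
    ((4 * ∑' p : ℤ, ((om Real.pi p)⁻¹) ^ 2) * (ENNReal.ofReal T ^ 2 +
      ENNReal.ofReal (Real.pi ^ 2 / (Real.pi / L) ^ 4) * zetaTwo))

/-- The constant in the global error estimate. -/
def errConst (L lam T : ℝ) (p M : ℤ → ℝ≥0∞) : ℝ≥0∞ :=
  (4 * (ENNReal.ofReal T ^ 2 * n2 p (errMaj' L lam M)) + 4 * badConst L T p M) *
    ENNReal.ofReal (Real.exp (T * (8 * ENNReal.ofReal T * stabConst L lam p M ^ 2).toReal))

/-- The error in the weighted Wiener algebra is of order `τ`. -/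
lemma n1_error_le
    (hτ : 0 < τ) (hτ1 : τ ≤ 1) (hp : Submul p) (hp0 : p 0 = 1) (hpe : ∀ l, p (-l) = p l)
    (hM : ∀ l, M (-l) = M l) (hN : ∑' l, (om L * M) l ≠ ⊤) (hx : ∀ l, ‖x l‖ₑ ≤ M l)
    (hab : a 0 = b 0) (ha : ∀ m ≤ N, ∀ l, ‖a m l‖ₑ ≤ M l) (hlb : ∀ m ≤ N, LOne (b m))
    (hb : ∀ m < N, ∀ l, tw L τ l * b (m + 1) l = stepc L lam τ x (b m) l) (hc : ∀ m < N, ∀ l, ‖tw L τ l * a (m + 1) l - stepc L lam τ x (a m) l‖ₑ ≤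
      ENNReal.ofReal τ ^ 2 * errMaj L lam M l) (hNT : N * τ ≤ T)
    (hNp : n1 p (om L * M) ≠ ⊤)
    (hsmall : ENNReal.ofReal τ * (ENNReal.ofReal T * n1 p (errMaj L lam M) *
      ENNReal.ofReal (Real.exp (T * (2 * stabConst L lam p M).toReal))) ≤ 1)
    {n : ℕ} (hn : n ≤ N) : n1 p (fun l => ‖(a n - b n) l‖ₑ) ≤ 1 := by
  set t := ENNReal.ofReal τ with ht
  set K := stabConst L lam p M with hK
  set Q := n1 p (errMaj L lam M)
  have hKt : 2 * K ≠ ⊤ := by have := stabConst_ne_top (lam := lam) hNp; finiteness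
  -- Smallness of τ turns the O(τ) bound into the bound 1 under which the stability constant was
  -- fixed; this closes the bootstrap.
  have hone : ∀ m ≤ N, m * t ^ 2 * Q * (1 + t * (2 * K)) ^ m ≤ 1 := fun m hm => by
    have hmT : m * τ ≤ T := le_trans (by gcongr) hNT
    have h1 : (m : ℝ≥0∞) * t ≤ ENNReal.ofReal T := by
      rw [← ENNReal.ofReal_natCast, ← ENNReal.ofReal_mul (by positivity)]
      exact ENNReal.ofReal_le_ofReal hmT
    calc m * t ^ 2 * Q * (1 + t * (2 * K)) ^ m = t * ((m * t) * Q * (1 + t * (2 * K)) ^ m) := by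
          ring
      _ ≤ t * (ENNReal.ofReal T * Q * ENNReal.ofReal (Real.exp (T * (2 * K).toReal))) := by
          gcongr
          exact one_add_mul_pow_le hτ.le hKt hmT
      _ ≤ 1 := hsmall
  have key : ∀ m ≤ N, n1 p (fun l => ‖(a m - b m) l‖ₑ) ≤
      m * t ^ 2 * Q * (1 + t * (2 * K)) ^ m := by
    intro m
    induction m with
    | zero => intro _; simp [hab, n1]
    | succ m ih =>
      intro hm
      have ih' := ih (by omega)
      have hle1 := ih'.trans (hone m (by omega))
      have h1 : (fun l => ‖(a (m + 1) - b (m + 1)) l‖ₑ) ≤ (fun l => ‖(a m - b m) l‖ₑ) +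
          t • (stabMaj L lam M (M + sym (a m - b m)) ⊛ sym (a m - b m)) +
            t ^ 2 • errMaj L lam M := fun l => by
        have e : tw L τ l * (a (m + 1) - b (m + 1)) l = (a m - b m) l +
            stabErr L lam τ x (a m) (b m) l +
            (tw L τ l * a (m + 1) l - stepc L lam τ x (a m) l) := by
          rw [stabErr, ← hb m (by omega)]
          simp only [Pi.sub_apply]
          ring
        calc ‖(a (m + 1) - b (m + 1)) l‖ₑ = ‖tw L τ l * (a (m + 1) - b (m + 1)) l‖ₑ :=
              (enorm_tw_mul _ _ _ _).symm
          _ ≤ _ := by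
              rw [e]
              exact (enorm_add_le _ _).trans (add_le_add ((enorm_add_le _ _).trans (add_le_add
                le_rfl (enorm_stabErr_le hτ hτ1 hM hN hx (ha m (by omega)) (hlb m (by omega)) l)))
                (hc m (by omega) l))
      refine (n1_mono h1).trans ?_
      rw [n1_add, n1_add, n1_smul, n1_smul]
      calc _ ≤ n1 p (fun l => ‖(a m - b m) l‖ₑ) +
            t * (K * (2 * n1 p (fun l => ‖(a m - b m) l‖ₑ))) + t ^ 2 * Q := by
            gcongr
            refine (hp.n1_cv_le _ _).trans ?_
            rw [n1_sym hpe]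
            gcongr
            exact n1_stabMaj_sym_le hp hp0 hpe hle1
        _ = (1 + t * (2 * K)) * n1 p (fun l => ‖(a m - b m) l‖ₑ) + t ^ 2 * Q * 1 := by ring
        _ ≤ (1 + t * (2 * K)) * (m * t ^ 2 * Q * (1 + t * (2 * K)) ^ m) +
            t ^ 2 * Q * (1 + t * (2 * K)) ^ (m + 1) := by
            gcongr
            exact one_le_pow₀ le_self_add
        _ = _ := by push_cast; ring
  exact (key n hn).trans (hone n hn)

/-- The recursion is unrolled to all earlier steps before norms are taken, because the `kap` parts
are small enough only after summation over m. Cauchy–Schwarz over the steps costs a factor n in the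
stability term, paid by one power of τ. -/
lemma n2_error_le
    (hτ : 0 < τ) (hτ1 : τ ≤ 1) (hp : Submul p) (hp0 : p 0 = 1) (hpe : ∀ l, p (-l) = p l)
    (hM : ∀ l, M (-l) = M l) (hN : ∑' l, (om L * M) l ≠ ⊤) (hx : ∀ l, ‖x l‖ₑ ≤ M l)
    (hab : a 0 = b 0) (ha : ∀ m ≤ N, ∀ l, ‖a m l‖ₑ ≤ M l) (hlb : ∀ m ≤ N, LOne (b m))
    (hb : ∀ m < N, ∀ l, tw L τ l * b (m + 1) l = stepc L lam τ x (b m) l) [Fact (0 < 2 * L)] (hp1 : ∀ l, 1 ≤ p l)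
    (hf : ∀ m < N, ∀ l, ‖tw L τ l * a (m + 1) l - stepc L lam τ x (a m) l -
      bil (kap L τ) x (a m) l‖ₑ ≤ ENNReal.ofReal τ ^ 3 * errMaj' L lam M l)
    (hd : ∀ m < N, ∀ l, ‖tw L ((m + 1 : ℕ) * τ) l * a (m + 1) l - tw L (m * τ) l * a m l‖ₑ ≤
      ENNReal.ofReal τ * M l)
    (hNT : N * τ ≤ T) (hNp : n1 p (om L * M) ≠ ⊤) (hM2 : n2 p (om L ^ 2 * M) ≠ ⊤)
    (h1 : ∀ m ≤ N, n1 p (fun l => ‖(a m - b m) l‖ₑ) ≤ 1) {n : ℕ} (hn : n ≤ N) :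
    n2 p (fun l => ‖(a n - b n) l‖ₑ) ≤ ENNReal.ofReal τ ^ 4 * errConst L lam T p M := by
  set t := ENNReal.ofReal τ with ht
  set K := stabConst L lam p M with hK
  have hKt : K ≠ ⊤ := stabConst_ne_top hNp
  have hnT : ∀ n ≤ N, (n : ℝ≥0∞) * t ≤ ENNReal.ofReal T := fun n hn => by
    rw [← ENNReal.ofReal_natCast, ← ENNReal.ofReal_mul (by positivity)]
    exact ENNReal.ofReal_le_ofReal (le_trans (by gcongr) hNT)
  set B := 4 * (ENNReal.ofReal T ^ 2 * n2 p (errMaj' L lam M)) + 4 * badConst L T p M with hB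
  set c := 8 * ENNReal.ofReal T * K ^ 2 with hc
  have hct : c ≠ ⊤ := by finiteness
  have key : ∀ n ≤ N, n2 p (fun l => ‖(a n - b n) l‖ₑ) ≤
      t ^ 4 * B + t * c * ∑ m ∈ Finset.range n, n2 p (fun l => ‖(a m - b m) l‖ₑ) := by
    intro n hn
    set P : ℕ → ℤ → ℝ≥0∞ := fun m =>
      t • (stabMaj L lam M (M + sym (a m - b m)) ⊛ sym (a m - b m)) with hP
    set S : ℤ → ℝ≥0∞ := fun l =>
      ‖∑ m ∈ Finset.range n, tw L (m * τ) l * bil (kap L τ) x (a m) l‖ₑ with hS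
    have hle : (fun l => ‖(a n - b n) l‖ₑ) ≤ (fun l => ∑ m ∈ Finset.range n, P m l) +
        ((n * t ^ 3) • errMaj' L lam M + S) := fun l => by
      have e := tw_mul_error_eq hab hb hn l
      rw [add_assoc] at e
      calc ‖(a n - b n) l‖ₑ = ‖tw L (n * τ) l * (a n - b n) l‖ₑ := (enorm_tw_mul _ _ _ _).symm
        _ ≤ _ := by
            rw [e]
            refine (enorm_add_le _ _).trans (add_le_add ?_ ((enorm_add_le _ _).trans
              (add_le_add ?_ le_rfl)))
            · refine (enorm_sum_le _ _).trans (Finset.sum_le_sum fun m hm => ?_)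
              have hm' := Finset.mem_range.mp hm
              rw [enorm_tw_mul]
              exact enorm_stabErr_le hτ hτ1 hM hN hx (ha m (by omega)) (hlb m (by omega)) l
            · refine (enorm_sum_le _ _).trans ((Finset.sum_le_sum fun m hm => ?_).trans
                (le_of_eq (b := (n * t ^ 3) * errMaj' L lam M l)
                  (a := ∑ m ∈ Finset.range n, t ^ 3 * errMaj' L lam M l) ?_))
              · have hm' := Finset.mem_range.mp hm
                rw [enorm_tw_mul]
                exact hf m (by omega) l
              · rw [Finset.sum_const, Finset.card_range, nsmul_eq_mul, mul_assoc]
    have b1 : n2 p (fun l => ∑ m ∈ Finset.range n, P m l) ≤ t * (4 * ENNReal.ofReal T * K ^ 2) *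
        ∑ m ∈ Finset.range n, n2 p (fun l => ‖(a m - b m) l‖ₑ) := by
      have hPm : ∀ m ∈ Finset.range n, n2 p (P m) ≤
          t ^ 2 * (K ^ 2 * (4 * n2 p (fun l => ‖(a m - b m) l‖ₑ))) := fun m hm => by
        have hm' := Finset.mem_range.mp hm
        rw [hP, n2_smul]
        gcongr
        refine (hp.n2_cv_le _ _).trans ?_
        gcongr
        · exact n1_stabMaj_sym_le hp hp0 hpe (h1 m (by omega))
        · exact n2_sym_le hpe _
      calc _ ≤ (n : ℝ≥0∞) * ∑ m ∈ Finset.range n, t ^ 2 *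
            (K ^ 2 * (4 * n2 p (fun l => ‖(a m - b m) l‖ₑ))) :=
            (n2_sum_range_le p P n).trans (mul_le_mul' le_rfl (Finset.sum_le_sum hPm))
        _ = t * (4 * (n * t) * K ^ 2) *
            ∑ m ∈ Finset.range n, n2 p (fun l => ‖(a m - b m) l‖ₑ) := by
            simp only [← Finset.mul_sum]
            ring
        _ ≤ _ := by gcongr; exact hnT n hn
    have b2 : n2 p ((n * t ^ 3) • errMaj' L lam M) ≤
        t ^ 4 * (ENNReal.ofReal T ^ 2 * n2 p (errMaj' L lam M)) := by
      rw [n2_smul]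
      calc _ = t ^ 4 * ((n * t) ^ 2 * n2 p (errMaj' L lam M)) := by ring
        _ ≤ _ := by gcongr; exact hnT n hn
    have b3 : n2 p S ≤ t ^ 4 * badConst L T p M :=
      n2_sum_bil_kap_le hτ hp hp1 hM2 hx (le_trans (by gcongr) hNT)
        (fun m hm => ha m (hm.trans hn)) (fun m hm => hd m (hm.trans_le hn))
    calc _ ≤ _ := n2_mono hle
      _ ≤ 2 * n2 p (fun l => ∑ m ∈ Finset.range n, P m l) +
          2 * (2 * n2 p ((n * t ^ 3) • errMaj' L lam M) + 2 * n2 p S) :=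
          (n2_add_le _ _ _).trans (by gcongr; exact n2_add_le _ _ _)
      _ ≤ 2 * (t * (4 * ENNReal.ofReal T * K ^ 2) *
            ∑ m ∈ Finset.range n, n2 p (fun l => ‖(a m - b m) l‖ₑ)) +
          2 * (2 * (t ^ 4 * (ENNReal.ofReal T ^ 2 * n2 p (errMaj' L lam M))) +
            2 * (t ^ 4 * badConst L T p M)) := by gcongr
      _ = _ := by rw [hB, hc]; ring
  calc _ ≤ t ^ 4 * B * (1 + t * c) ^ n :=
        le_mul_pow_of_le_sum (z := fun n => n2 p (fun l => ‖(a n - b n) l‖ₑ)) key hn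
    _ ≤ t ^ 4 * B * ENNReal.ofReal (Real.exp (T * c.toReal)) := by
        gcongr
        exact one_add_mul_pow_le hτ.le hct (le_trans (by gcongr) hNT)
    _ = _ := by rw [errConst, mul_assoc]

end globalError

end

section

/-! ### Sobolev norms and the convergence theorem -/

section sobolev

variable {L : ℝ}

lemma om_rpow_sq (L : ℝ) {s : ℝ} (hs : 0 ≤ s) (l : ℤ) :
    (om L l ^ s) ^ 2 = ENNReal.ofReal (((1 + |freq L l|) ^ 2) ^ s) := by
  rw [om, ENNReal.ofReal_rpow_of_nonneg (by positivity) hs, ← ENNReal.ofReal_pow (by positivity),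
    ← Real.rpow_natCast, ← Real.rpow_natCast, ← Real.rpow_mul (by positivity),
    ← Real.rpow_mul (by positivity), mul_comm s]

lemma ofReal_one_add_sq_rpow_le (L : ℝ) {s : ℝ} (hs : 0 ≤ s) (l : ℤ) :
    ENNReal.ofReal ((1 + freq L l ^ 2) ^ s) ≤ (om L l ^ s) ^ 2 := by
  rw [om_rpow_sq L hs]
  refine ENNReal.ofReal_le_ofReal (Real.rpow_le_rpow (by positivity) ?_ hs)
  nlinarith [abs_nonneg (freq L l), sq_abs (freq L l)]

lemma om_rpow_sq_le (L : ℝ) {s : ℝ} (hs : 0 ≤ s) (l : ℤ) :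
    (om L l ^ s) ^ 2 ≤ ENNReal.ofReal (2 ^ s) * ENNReal.ofReal ((1 + freq L l ^ 2) ^ s) := by
  rw [om_rpow_sq L hs, ← ENNReal.ofReal_mul (by positivity),
    ← Real.mul_rpow (by norm_num) (by positivity)]
  refine ENNReal.ofReal_le_ofReal (Real.rpow_le_rpow (by positivity) ?_ hs)
  nlinarith [sq_nonneg (|freq L l| - 1), sq_abs (freq L l)]

variable [Fact (0 < 2 * L)]

lemma MemSobolev.n2_ne_top {s : ℝ} (hs : 0 ≤ s) {f : Torus L → ℂ} (hf : MemSobolev s f) :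
    n2 (fun l => om L l ^ s) (fun l => ‖fourierCoeff f l‖ₑ) ≠ ⊤ := by
  have h := hf.2.tsum_ofReal_ne_top
  refine ne_top_of_le_ne_top (ENNReal.mul_ne_top (ENNReal.ofReal_ne_top (r := 2 ^ s)) h) ?_
  rw [← ENNReal.tsum_mul_left]
  refine ENNReal.tsum_le_tsum fun l => ?_
  rw [mul_pow, ENNReal.ofReal_mul (by positivity), ENNReal.ofReal_pow (norm_nonneg _), ofReal_norm,
    ← mul_assoc]
  exact mul_le_mul' (om_rpow_sq_le L hs l) le_rfl

lemma HasCoeff.sobolev_bound {s : ℝ} (hs : 0 ≤ s) {f : Torus L → ℂ} {e : ℤ → ℂ}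
    (hf : HasCoeff f e) {D : ℝ≥0∞} (hD : D ≠ ⊤)
    (h : n2 (fun l => om L l ^ s) (fun l => ‖e l‖ₑ) ≤ D) :
    MemSobolev s f ∧ sobolevNorm s f ≤ Real.sqrt (2 * L * D.toReal) := by
  have hle : ∑' l, ENNReal.ofReal ((1 + freq L l ^ 2) ^ s * ‖fourierCoeff f l‖ ^ 2) ≤ D := by
    refine le_trans (ENNReal.tsum_le_tsum fun l => ?_) h
    rw [hf.fourierCoeff_eq, mul_pow, ENNReal.ofReal_mul (by positivity),
      ENNReal.ofReal_pow (norm_nonneg _), ofReal_norm]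
    exact mul_le_mul' (ofReal_one_add_sq_rpow_le L hs l) le_rfl
  have hnn : ∀ l, 0 ≤ (1 + freq L l ^ 2) ^ s * ‖fourierCoeff f l‖ ^ 2 := fun l => by positivity
  have hsum : Summable fun l => (1 + freq L l ^ 2) ^ s * ‖fourierCoeff f l‖ ^ 2 := by
    have := ENNReal.summable_toReal (ne_top_of_le_ne_top hD hle)
    simpa only [ENNReal.toReal_ofReal (hnn _)] using this
  refine ⟨⟨hf.memLp, hsum⟩, Real.sqrt_le_sqrt ?_⟩
  have hL := pos_L L
  gcongr
  rw [← ENNReal.ofReal_tsum_of_nonneg hnn hsum] at hle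
  exact (ENNReal.ofReal_le_iff_le_toReal hD).mp hle

end sobolev

/-- The Fourier coefficients of the numerical solution. -/
def lriCoeff (L lam τ : ℝ) (x a : ℤ → ℂ) : ℕ → ℤ → ℂ
  | 0 => a
  | n + 1 => fun l => tw L (-τ) l * stepc L lam τ x (lriCoeff L lam τ x a n) l

section convergence

variable {L : ℝ} [Fact (0 < 2 * L)] {lam : ℝ} {ξ : Torus L → ℝ} {u₀ : Torus L → ℂ} {x : ℤ → ℂ}

lemma hasCoeff_lri {a : ℤ → ℂ} (hξ : HasCoeff (fun y => (ξ y : ℂ)) x) (hu : HasCoeff u₀ a) {τ : ℝ}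
    (hτ : 0 < τ) (n : ℕ) : HasCoeff (lri lam ξ u₀ τ n) (lriCoeff L lam τ x a n) := by
  induction n with
  | zero => exact hu
  | succ n ih =>
    have e : ∀ l, tw L (-τ) l = Complex.exp (-I * τ * freq L l ^ 2) := fun l => by
      rw [tw]; congr 1; push_cast; ring
    have h := HasCoeff.lriStep ih hξ lam hτ
    simp only [← e] at h
    exact h

lemma cj_eq_self_of_real (hξ : HasCoeff (fun y => (ξ y : ℂ)) x) : cj x = x := by
  have h := hξ.conjugate
  simp only [Complex.conj_ofReal] at h
  rw [← h.fourierCoeff_eq, hξ.fourierCoeff_eq]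

theorem exists_error_bound {γ : ℝ} (hγ : 0 ≤ γ) (hξ : MemSobolev (γ + 2) fun y => (ξ y : ℂ))
    (hu₀ : MemSobolev (γ + 2) u₀) {T : ℝ} (hT : 0 < T) {u : ℝ → Torus L → ℂ}
    (hu : IsSolution lam ξ u₀ T u) :
    ∃ τ₀ : ℝ, 0 < τ₀ ∧ ∃ C : ℝ, ∀ τ : ℝ, 0 < τ → τ ≤ τ₀ → ∀ n : ℕ, (n : ℝ) * τ ≤ T →
      MemSobolev γ (u (n * τ) - lri lam ξ u₀ τ n) ∧
        sobolevNorm γ (u (n * τ) - lri lam ξ u₀ τ n) ≤ C * τ ^ 2 := by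
  have hL := pos_L L
  set p : ℤ → ℝ≥0∞ := fun l => om L l ^ γ with hpdef
  have hp : Submul p := om_rpow_submul L hγ
  have hp1 : ∀ l, 1 ≤ p l := one_le_om_rpow L hγ
  have hp0 : p 0 = 1 := by simp [hpdef, om, freq_zero]
  have hpe : ∀ l, p (-l) = p l := fun l => by simp only [hpdef, om_neg]
  have hpw : ∀ A : ℤ → ℝ≥0∞, n2 (fun l => om L l ^ (γ + 2)) A = n2 p (om L ^ 2 * A) := fun A => by
    refine tsum_congr fun l => ?_
    have h0 : om L l ≠ 0 := (zero_lt_one.trans_le (one_le_om L l)).ne'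
    beta_reduce
    rw [ENNReal.rpow_add γ 2 h0 (om_ne_top L l), ENNReal.rpow_two, mul_assoc]
    rfl
  have hlone : ∀ {f : Torus L → ℂ}, MemSobolev (γ + 2) f → HasCoeff f (fourierCoeff f) :=
    fun {f} hf => by
    refine hasCoeff_of_memLp hf.1 (lOne_iff.mpr ?_)
    have h1 := hf.n2_ne_top (by linarith)
    rw [hpw] at h1
    refine ne_top_of_le_ne_top (n1_ne_top_of_om (n1_om_ne_top hL h1))
      (ENNReal.tsum_le_tsum fun l => ?_)
    simpa using mul_le_mul' (hp1 l) (le_refl ‖fourierCoeff f l‖ₑ)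
  have hcξ := hlone hξ
  have hcu := hlone hu₀
  set x := fourierCoeff fun y => (ξ y : ℂ)
  have hxr : cj x = x := cj_eq_self_of_real hcξ
  -- One majorant serves all step sizes and all steps, so the constants depend neither on n nor on
  -- τ.
  obtain ⟨M, hM, hMn, hx, hMu⟩ := hu.exists_majorant hT hcξ (s := γ + 2) (by linarith)
    (hξ.n2_ne_top (by linarith)) (hu₀.n2_ne_top (by linarith))
  rw [hpw] at hMn
  have hNp : n1 p (om L * M) ≠ ⊤ := n1_om_ne_top hL hMn
  have hN : ∑' l, (om L * M) l ≠ ⊤ := ne_top_of_le_ne_top hNp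
    (ENNReal.tsum_le_tsum fun l => by simpa using mul_le_mul' (hp1 l) (le_refl ((om L * M) l)))
  set Y := ENNReal.ofReal T * n1 p (errMaj L lam M) *
    ENNReal.ofReal (Real.exp (T * (2 * stabConst L lam p M).toReal)) with hY
  have hYt : Y ≠ ⊤ := by
    have := n1_errMaj_ne_top (lam := lam) hp hp0 hNp
    finiteness
  have hD : errConst L lam T p M ≠ ⊤ := by
    have h1 := n2_errMaj'_ne_top (lam := lam) hp hp0 hNp hMn
    have h2 := tsum_om_inv_sq_ne_top Real.pi_pos
    have h3 := zetaTwo_ne_top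
    unfold errConst badConst
    finiteness
  -- The first entry allows τ ≤ 1; the second makes τY ≤ 1, the smallness needed for the ℓ¹
  -- bootstrap, and the 1 avoids division by zero.
  refine ⟨min 1 (1 / (1 + Y.toReal)), by positivity,
    Real.sqrt (2 * L * (errConst L lam T p M).toReal), fun τ hτ hτ₀ n hn => ?_⟩
  have hτ1 : τ ≤ 1 := hτ₀.trans (min_le_left _ _)
  have hsmall : ENNReal.ofReal τ * Y ≤ 1 := by
    rw [← ENNReal.ofReal_toReal hYt, ← ENNReal.ofReal_mul hτ.le, ← ENNReal.ofReal_one]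
    refine ENNReal.ofReal_le_ofReal ?_
    have h1 := hτ₀.trans (min_le_right _ _)
    have h0 : 0 ≤ Y.toReal := ENNReal.toReal_nonneg
    rw [le_div_iff₀ (by positivity)] at h1
    nlinarith
  set a : ℕ → ℤ → ℂ := fun m => fourierCoeff (u (m * τ)) with ha
  set b : ℕ → ℤ → ℂ := lriCoeff L lam τ x (fourierCoeff u₀) with hb
  have hmem : ∀ m ≤ n, (m : ℝ) * τ ∈ Icc 0 T := fun m hm =>
    ⟨by positivity, le_trans (by gcongr) hn⟩
  have hsol : ∀ m < n, LocalSol L lam τ x M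
      (fun ρ l => tw L ρ l * fourierCoeff (u (m * τ + ρ)) l) := fun m hm =>
    hu.localSol hcξ hMu (hmem m hm.le).1 (by
      have := (hmem (m + 1) hm).2
      push_cast at this
      linarith)
  have hv0 : ∀ m : ℕ, (fun l => tw L 0 l * fourierCoeff (u (m * τ + 0)) l) = a m := fun m => by
    funext l
    rw [tw_zero, one_mul, add_zero]
  have hvτ : ∀ m : ℕ, u (m * τ + τ) = u ((m + 1 : ℕ) * τ) := fun m => by
    congr 1; push_cast; ring
  -- Duhamel's formula at t = 0 gives equal coefficients; u(0) need not be u₀ as a function.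
  have hab : a 0 = b 0 := by
    funext l
    have h := hu.duhamel 0 ⟨le_rfl, hT.le⟩ l
    simpa [ha, hb, lriCoeff] using h
  have haM : ∀ m ≤ n, ∀ l, ‖a m l‖ₑ ≤ M l := fun m hm => (hMu _ (hmem m hm)).2.1
  have hcb : ∀ m, HasCoeff (lri lam ξ u₀ τ m) (b m) := hasCoeff_lri hcξ hcu hτ
  have hstep : ∀ m < n, ∀ l, tw L τ l * b (m + 1) l = stepc L lam τ x (b m) l := fun m _ l => by
    have h := tw_neg_mul L τ l
    simp only [hb, lriCoeff]
    linear_combination stepc L lam τ x (lriCoeff L lam τ x (fourierCoeff u₀) m) l * h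
  have hcrude : ∀ m < n, ∀ l, ‖tw L τ l * a (m + 1) l - stepc L lam τ x (a m) l‖ₑ ≤
      ENNReal.ofReal τ ^ 2 * errMaj L lam M l := fun m hm l => by
    have h := (hsol m hm).enorm_local_error_le hτ hM hN hx hxr l hτ1
    rwa [hv0, hvτ] at h
  have hfine : ∀ m < n, ∀ l, ‖tw L τ l * a (m + 1) l - stepc L lam τ x (a m) l -
      bil (kap L τ) x (a m) l‖ₑ ≤ ENNReal.ofReal τ ^ 3 * errMaj' L lam M l := fun m hm l => by
    have h := (hsol m hm).enorm_local_error_sub_le hτ hM hN hx hxr l hτ1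
    rwa [hv0, hvτ] at h
  have hd : ∀ m < n, ∀ l, ‖tw L ((m + 1 : ℕ) * τ) l * a (m + 1) l - tw L (m * τ) l * a m l‖ₑ ≤
      ENNReal.ofReal τ * M l := fun m hm l => by
    have h := (hsol m hm).enorm_sub_le (ρ := τ) ⟨hτ.le, le_rfl⟩ l
    rw [hvτ, tw_zero, one_mul, add_zero, ← enorm_tw_mul L (m * τ) l] at h
    have e : tw L ((m + 1 : ℕ) * τ) l = tw L (m * τ) l * tw L τ l := by
      rw [← tw_add]; congr 1; push_cast; ring
    rw [e, mul_assoc, ← mul_sub]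
    exact h
  have h1 : ∀ m ≤ n, n1 p (fun l => ‖(a m - b m) l‖ₑ) ≤ 1 := fun m hm =>
    n1_error_le hτ hτ1 hp hp0 hpe hM hN hx hab haM (fun m _ => (hcb m).1) hstep hcrude hn hNp
      hsmall hm
  have h2 := n2_error_le hτ hτ1 hp hp0 hpe hM hN hx hab haM (fun m _ => (hcb m).1) hstep hp1
    hfine hd hn hNp hMn h1 le_rfl
  have hcun : HasCoeff (u (n * τ)) (a n) := hasCoeff_of_memLp
    (memLp_of_continuous (hu.continuous (hmem n le_rfl))) (hMu _ (hmem n le_rfl)).1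
  have h3 := (hcun.sub (hcb n)).sobolev_bound hγ (by finiteness) h2
  refine ⟨h3.1, h3.2.trans (le_of_eq ?_)⟩
  rw [ENNReal.toReal_mul, ENNReal.toReal_pow, ENNReal.toReal_ofReal hτ.le,
    show 2 * L * (τ ^ 4 * (errConst L lam T p M).toReal) =
      2 * L * (errConst L lam T p M).toReal * (τ ^ 2) ^ 2 by ring,
    Real.sqrt_mul (by positivity), Real.sqrt_sq (by positivity)]

end convergence

end

end DNLS

end

theorem theorem1 {L : ℝ} [Fact (0 < 2 * L)] (lam : ℝ) (γ : ℝ) (hγ : 0 ≤ γ)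
    (ξ : DNLS.Torus L → ℝ) (hξ : DNLS.MemSobolev (γ + 2) fun x => (ξ x : ℂ))
    (u₀ : DNLS.Torus L → ℂ) (hu₀ : DNLS.MemSobolev (γ + 2) u₀)
    (T : ℝ) (hT : 0 < T)
    (u : ℝ → DNLS.Torus L → ℂ) (hu : DNLS.IsSolution lam ξ u₀ T u) :
    ∃ τ₀ : ℝ, 0 < τ₀ ∧ ∃ C : ℝ, ∀ τ : ℝ, 0 < τ → τ ≤ τ₀ → ∀ n : ℕ, (n : ℝ) * τ ≤ T →
      DNLS.MemSobolev γ (u (n * τ) - DNLS.lri lam ξ u₀ τ n) ∧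
        DNLS.sobolevNorm γ (u (n * τ) - DNLS.lri lam ξ u₀ τ n) ≤ C * τ ^ 2 :=
  DNLS.exists_error_bound hγ hξ hu₀ hT hu
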